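/- **Theorem 3.2.** Let $G_0$ be one of the groups $\mathrm{SL}(2,\mathbb R)$, $\mathrm{SL}(2,\mathbb C)$ or $\mathrm{SO}_e(n,1)$ (the identity component of $\mathrm{SO}(n,1)$) with $n\ge 2$, and let $\mathfrak g_0$ be its Lie algebra, regarded as a real Lie algebra. Put $G=G_0\times G_0\times G_0$ and let $H=\{(g,g,g)\mid g\in G_0\}$ be the diagonal subgroup. Let $\mathfrak g_0=\mathfrak k_0\oplus\mathfrak s_0$ be any Cartan decomposition, that is, a vector space decomposition with $[\mathfrak k_0,\mathfrak k_0]\subset\mathfrak k_0$, $[\mathfrak k_0,\mathfrak s_0]\subset\mathfrak s_0$, $[\mathfrak s_0,\mathfrak s_0]\subset\mathfrak k_0$ such that the Killing form of $\mathfrak g_0$ is negative definite on $\mathfrak k_0$ and positive definite on $\mathfrak s_0$. Let $K_0$ be the subgroup of $G_0$ generated by $\exp\mathfrak k_0$ and put $K=K_0\times K_0\times K_0$. Let $\mathfrak a_1,\mathfrak a_2,\mathfrak a_3$ be maximal abelian subspaces of $\mathfrak s_0$, and put $\mathfrak a=\mathfrak a_1\times\mathfrak a_2\times\mathfrak a_3$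 and $A=\exp\mathfrak a$. Then $$G=KAH\quad\Longleftrightarrow\quad \dim_{\mathbb R}(\mathfrak a_1+\mathfrak a_2+\mathfrak a_3)=2.$$ In particular, the triple space $G/H$ is of polar type: there are a Cartan decomposition $\mathfrak g_0=\mathfrak k_0\oplus\mathfrak s_0$ and an abelian subspace $\mathfrak a\subset\mathfrak s_0\times\mathfrak s_0\times\mathfrak s_0$ such that $G=KAH$, where $A=\exp\mathfrak a$ and $K$ is defined as above. -/

import Mathlib

open Matrix
open scoped Pointwise

attribute [local instance 100] LieRing.ofAssociativeRing LieAlgebra.ofAssociativeAlgebra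

noncomputable section

namespace TripleSpace

/-! ### The groups and their Lie algebras -/

section Groups

variable {ι 𝕜 : Type} [Fintype ι] [DecidableEq ι] [RCLike 𝕜]

/-- `SL(ι, 𝕜)`, as a subgroup of `GL(ι, 𝕜)`. -/
def SL (ι 𝕜 : Type) [Fintype ι] [DecidableEq ι] [RCLike 𝕜] : Subgroup (GL ι 𝕜) :=
  (Matrix.GeneralLinearGroup.det (n := ι) (R := 𝕜)).ker

/-- `𝔰𝔩(ι, 𝕜)`, the trace zero matrices, viewed as a *real* Lie algebra. -/
def slReal (ι 𝕜 : Type) [Fintype ι] [DecidableEq ι] [RCLike 𝕜] :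
    LieSubalgebra ℝ (Matrix ι ι 𝕜) where
  carrier := {X | X.trace = 0}
  zero_mem' := Matrix.trace_zero ι 𝕜
  add_mem' := by
    intro X Y hX hY
    simp only [Set.mem_ofPred_eq] at *
    rw [Matrix.trace_add, hX, hY, add_zero]
  smul_mem' := by
    intro c X hX
    simp only [Set.mem_ofPred_eq] at *
    rw [Matrix.trace_smul, hX, smul_zero]
  lie_mem' := by
    intro X Y _ _
    simp only [Set.mem_ofPred_eq] at *
    change (X * Y - Y * X).trace = 0
    rw [Matrix.trace_sub, Matrix.trace_mul_comm, sub_self]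

/-- The matrix `diag(1, …, 1, -1)` of the standard quadratic form of signature `(n, 1)`. -/
abbrev J (n : ℕ) : Matrix (Fin n ⊕ Fin 1) (Fin n ⊕ Fin 1) ℝ :=
  LieAlgebra.Orthogonal.indefiniteDiagonal (Fin n) (Fin 1) ℝ

/-- `SO(n,1) = {g | gᵀ J g = J, det g = 1}`. -/
def SO (n : ℕ) : Subgroup (GL (Fin n ⊕ Fin 1) ℝ) where
  carrier := {g | (g : Matrix (Fin n ⊕ Fin 1) (Fin n ⊕ Fin 1) ℝ)ᵀ * J n * g.1 = J n ∧
    (g : Matrix (Fin n ⊕ Fin 1) (Fin n ⊕ Fin 1) ℝ).det = 1}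
  one_mem' := by simp
  mul_mem' := by
    rintro a b ⟨ha, ha'⟩ ⟨hb, hb'⟩
    refine ⟨?_, by simp [ha', hb']⟩
    calc ((a * b : GL (Fin n ⊕ Fin 1) ℝ).1)ᵀ * J n * (a * b : GL (Fin n ⊕ Fin 1) ℝ).1
        = b.1ᵀ * (a.1ᵀ * J n * a.1) * b.1 := by
          simp only [Units.val_mul, Matrix.transpose_mul, Matrix.mul_assoc]
      _ = J n := by rw [ha, hb]
  inv_mem' := by
    rintro a ⟨ha, ha'⟩
    have h1 : a.1 * (a⁻¹).1 = 1 := a.mul_inv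
    have h2 : (a⁻¹).1ᵀ * a.1ᵀ = 1 := by rw [← Matrix.transpose_mul, h1, Matrix.transpose_one]
    refine ⟨?_, ?_⟩
    · calc (a⁻¹).1ᵀ * J n * (a⁻¹).1 = (a⁻¹).1ᵀ * (a.1ᵀ * J n * a.1) * (a⁻¹).1 := by rw [ha]
        _ = ((a⁻¹).1ᵀ * a.1ᵀ) * J n * (a.1 * (a⁻¹).1) := by simp only [Matrix.mul_assoc]
        _ = J n := by rw [h1, h2, Matrix.one_mul, Matrix.mul_one]
    · have := congrArg Matrix.det h1
      rwa [Matrix.det_mul, ha', one_mul, Matrix.det_one] at this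

/-- `SO_e(n,1)`, the identity component of `SO(n,1)`. -/
def SOe (n : ℕ) : Subgroup (GL (Fin n ⊕ Fin 1) ℝ) :=
  (Subgroup.connectedComponentOfOne (SO n)).map (SO n).subtype

/-- `𝔰𝔬(n,1) = {X | Xᵀ J = - J X}`, the Lie algebra of `SO_e(n,1)`. -/
abbrev so (n : ℕ) : LieSubalgebra ℝ (Matrix (Fin n ⊕ Fin 1) (Fin n ⊕ Fin 1) ℝ) :=
  LieAlgebra.Orthogonal.so' (Fin n) (Fin 1) ℝ

/-- `IsListed G₀ 𝔤₀`: the linear group `G₀` is one of `SL(2,ℝ)`, `SL(2,ℂ)`, `SO_e(n,1)` with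
`n ≥ 2`, and `𝔤₀` is its (real) Lie algebra. -/
inductive IsListed : ∀ {ι 𝕜 : Type} [Fintype ι] [DecidableEq ι] [RCLike 𝕜],
    Subgroup (GL ι 𝕜) → LieSubalgebra ℝ (Matrix ι ι 𝕜) → Prop
  | SL2R : IsListed (SL (Fin 2) ℝ) (slReal (Fin 2) ℝ)
  | SL2C : IsListed (SL (Fin 2) ℂ) (slReal (Fin 2) ℂ)
  | SOe (n : ℕ) (hn : 2 ≤ n) : IsListed (SOe n) (so n)

end Groups

/-! ### Cartan decompositions and maximal abelian subspaces -/

section Cartan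

variable {L : Type} [LieRing L] [LieAlgebra ℝ L]

/-- `L = 𝔨 ⊕ 𝔰` is a Cartan decomposition of the real semisimple Lie algebra `L`: the map that is
`1` on `𝔨` and `-1` on `𝔰` respects brackets, and the Killing form is negative definite on `𝔨` and
positive definite on `𝔰`. -/
structure IsCartanDecomposition (𝔨 𝔰 : Submodule ℝ L) : Prop where
  isCompl : IsCompl 𝔨 𝔰
  lie_kk : ∀ X ∈ 𝔨, ∀ Y ∈ 𝔨, ⁅X, Y⁆ ∈ 𝔨
  lie_ks : ∀ X ∈ 𝔨, ∀ Y ∈ 𝔰, ⁅X, Y⁆ ∈ 𝔰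
  lie_ss : ∀ X ∈ 𝔰, ∀ Y ∈ 𝔰, ⁅X, Y⁆ ∈ 𝔨
  neg_def : ∀ X ∈ 𝔨, X ≠ 0 → killingForm ℝ L X X < 0
  pos_def : ∀ X ∈ 𝔰, X ≠ 0 → 0 < killingForm ℝ L X X

/-- A linear subspace is abelian if all brackets of its elements vanish. -/
def IsAbelian (𝔞 : Submodule ℝ L) : Prop := ∀ X ∈ 𝔞, ∀ Y ∈ 𝔞, ⁅X, Y⁆ = 0

/-- `𝔞` is maximal among the abelian subspaces contained in `𝔰`. -/
def IsMaximalAbelian (𝔰 𝔞 : Submodule ℝ L) : Prop :=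
  Maximal (fun 𝔟 : Submodule ℝ L => 𝔟 ≤ 𝔰 ∧ IsAbelian 𝔟) 𝔞

end Cartan

/-! ### The triple space `G/H` and polar decompositions

Here `G = G₀ × G₀ × G₀` is written `Fin 3 → G₀`, and its Lie algebra is `Fin 3 → 𝔤₀`. -/

section Polar

variable {ι 𝕜 : Type} [Fintype ι] [DecidableEq ι] [RCLike 𝕜]
  (G₀ : Subgroup (GL ι 𝕜)) {𝔤₀ : LieSubalgebra ℝ (Matrix ι ι 𝕜)}

/-- The subgroup `K₀` of `G₀` generated by `exp 𝔨₀`, i.e. the connected subgroup with Lie algebra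
`𝔨₀`. If `𝔤₀ = 𝔨₀ ⊕ 𝔰₀` is a Cartan decomposition and `G₀` is connected with finite centre, this is
the maximal compact subgroup of `G₀` belonging to that decomposition. -/
def K₀ (𝔨₀ : Submodule ℝ 𝔤₀) : Subgroup G₀ :=
  Subgroup.closure {k : G₀ | ∃ X ∈ 𝔨₀, ((k : GL ι 𝕜) : Matrix ι ι 𝕜) =
    NormedSpace.exp (X : Matrix ι ι 𝕜)}

/-- `K = K₀ × K₀ × K₀`. -/
def K (𝔨₀ : Submodule ℝ 𝔤₀) : Subgroup (Fin 3 → G₀) :=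
  Subgroup.pi Set.univ fun _ => K₀ G₀ 𝔨₀

/-- `A = exp 𝔞`, for a subspace `𝔞` of `𝔤₀ × 𝔤₀ × 𝔤₀`. -/
def A (𝔞 : Submodule ℝ (Fin 3 → 𝔤₀)) : Set (Fin 3 → G₀) :=
  {a | ∃ X ∈ 𝔞, ∀ j, ((a j : GL ι 𝕜) : Matrix ι ι 𝕜) = NormedSpace.exp (X j : Matrix ι ι 𝕜)}

/-- `H = diag(G₀)`. -/
def H : Subgroup (Fin 3 → G₀) where
  carrier := {h | ∃ g : G₀, h = fun _ => g}
  one_mem' := ⟨1, rfl⟩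
  mul_mem' := by
    rintro _ _ ⟨a, rfl⟩ ⟨b, rfl⟩
    exact ⟨a * b, rfl⟩
  inv_mem' := by
    rintro _ ⟨a, rfl⟩
    exact ⟨a⁻¹, rfl⟩

/-- The decomposition `G = KAH` with `A = exp 𝔞`. -/
def KAHDecomposition (𝔨₀ : Submodule ℝ 𝔤₀) (𝔞 : Submodule ℝ (Fin 3 → 𝔤₀)) : Prop :=
  (K G₀ 𝔨₀ : Set (Fin 3 → G₀)) * A G₀ 𝔞 * (H G₀ : Set (Fin 3 → G₀)) = Set.univ

/-- The triple space `G/H` is of polar type: for some Cartan decomposition `𝔤₀ = 𝔨₀ ⊕ 𝔰₀` there is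
an abelian subspace `𝔞` of `𝔰 = 𝔰₀ × 𝔰₀ × 𝔰₀` with `G = KAH`. -/
def IsPolarType (𝔤₀ : LieSubalgebra ℝ (Matrix ι ι 𝕜)) : Prop :=
  ∃ 𝔨₀ 𝔰₀ : Submodule ℝ 𝔤₀, IsCartanDecomposition 𝔨₀ 𝔰₀ ∧
    ∃ 𝔞 : Submodule ℝ (Fin 3 → 𝔤₀), 𝔞 ≤ Submodule.pi Set.univ (fun _ => 𝔰₀) ∧
      (∀ X ∈ 𝔞, ∀ Y ∈ 𝔞, ∀ j, ⁅X j, Y j⁆ = 0) ∧ KAHDecomposition G₀ 𝔨₀ 𝔞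

end Polar

end TripleSpace

end

noncomputable section

namespace TripleSpace

/-! ### One-parameter groups and linear differential equations -/

section Flow
variable {ι 𝕜 : Type} [Fintype ι] [DecidableEq ι] [RCLike 𝕜]

/-! Each listed group acts by isometries on a hyperbolic space `hyp n` (n = 2 for SL(2,ℝ), n = 3 for
SL(2,ℂ)), in such a way that `K₀` is the stabilizer of a base point and the maximal abelian
subspaces of 𝔰₀ are lines, generating the translations along geodesics through that point. Writing
(g_j)⁻¹ = k_j a_j x and applying the inverses to the base point, G = KAH becomes a statement about
triangles: every triple of points can be carried by one group element x to a triple whose j-th point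
lies on the j-th of three given geodesics through the base point (`Model.KAHDecomposition_iff`). The
dimension in question is that of the span of the three directions.

If the directions span a line, every movable triple is degenerate. If they are independent, consider
a point and two others of which it is the midpoint: the linear relation between the three vectors
forces all of them to the base point. This is `finrank_eq_two_of_forall_exists_move`. If the
directions span a plane, two of the geodesics differ. After `exists_normal_form` the triangle lies
in that plane. The positions of one side with its ends on the two different geodesics form a closed
curve, symmetric under reversing both parameters, and the signed deviation of the third vertex from
the third geodesic is odd on it, hence vanishes somewhere (`exists_zero_of_odd`,
`exists_move_planar`).

An arbitrary Cartan decomposition is reduced to the standard one by a fixed point argument. The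
isometries preserving it form a bounded semigroup, because they preserve a positive definite form on
the Lie algebra; such a semigroup fixes a point of `hyp n`, and moving this point to the base point
identifies the decompositions (`exists_fixed_point`, `exists_conj_std`). The structure `Model`
isolates what is needed of the group; it is realized by `modelSOe` and, through Hermitian matrices,
by `HermitianModel.model`. -/

theorem hasDerivAt_exp_smul (X : Matrix ι ι 𝕜) (t : ℝ) :
    HasDerivAt (fun s : ℝ => NormedSpace.exp (s • X)) (NormedSpace.exp (t • X) * X) t := by
  -- The derivative depends only on the topology, so an auxiliary norm local to the proof suffices.
  open scoped Matrix.Norms.Operator in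
  let _ : NormedAlgebra ℝ (Matrix ι ι 𝕜) := Matrix.linftyOpNormedAlgebra
  exact hasDerivAt_exp_smul_const X t

theorem hasDerivAt_exp_smul' (X : Matrix ι ι 𝕜) (t : ℝ) :
    HasDerivAt (fun s : ℝ => NormedSpace.exp (s • X)) (X * NormedSpace.exp (t • X)) t := by
  open scoped Matrix.Norms.Operator in
  let _ : NormedAlgebra ℝ (Matrix ι ι 𝕜) := Matrix.linftyOpNormedAlgebra
  exact hasDerivAt_exp_smul_const' X t

theorem hasDerivAt_matrix {ι' κ : Type} [Fintype ι'] [Fintype κ]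
    {A : ℝ → Matrix ι' κ 𝕜} {A' : Matrix ι' κ 𝕜} {t : ℝ} :
    HasDerivAt A A' t ↔ ∀ i j, HasDerivAt (fun s => A s i j) (A' i j) t := by
  constructor
  · intro h i j
    have := (hasDerivAt_pi (φ := A)).1 h i
    exact (hasDerivAt_pi.1 this) j
  · intro h
    exact hasDerivAt_pi.2 fun i => hasDerivAt_pi.2 fun j => h i j

theorem HasDerivAt.matrix_mul {ι₁ ι₂ ι₃ : Type} [Fintype ι₁] [Fintype ι₂] [Fintype ι₃]
    {A : ℝ → Matrix ι₁ ι₂ 𝕜} {A' : Matrix ι₁ ι₂ 𝕜} {B : ℝ → Matrix ι₂ ι₃ 𝕜}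
    {B' : Matrix ι₂ ι₃ 𝕜} {t : ℝ} (hA : HasDerivAt A A' t) (hB : HasDerivAt B B' t) :
    HasDerivAt (fun s => A s * B s) (A' * B t + A t * B') t := by
  rw [hasDerivAt_matrix] at hA hB ⊢
  intro i j
  simp only [Matrix.mul_apply, Matrix.add_apply, ← Finset.sum_add_distrib]
  exact HasDerivAt.fun_sum fun k _ => (hA i k).mul (hB k j)

theorem HasDerivAt.mulVec {ι₁ ι₂ : Type} [Fintype ι₁] [Fintype ι₂]
    {A : ℝ → Matrix ι₁ ι₂ 𝕜} {A' : Matrix ι₁ ι₂ 𝕜} {v : ℝ → ι₂ → 𝕜}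
    {v' : ι₂ → 𝕜} {t : ℝ} (hA : HasDerivAt A A' t) (hB : HasDerivAt v v' t) :
    HasDerivAt (fun s => A s *ᵥ v s) (A' *ᵥ v t + A t *ᵥ v') t := by
  rw [hasDerivAt_matrix] at hA
  rw [hasDerivAt_pi] at hB ⊢
  intro i
  simp only [Matrix.mulVec, dotProduct, Pi.add_apply, ← Finset.sum_add_distrib]
  exact HasDerivAt.fun_sum fun k _ => (hA i k).mul (hB k)

theorem exp_neg_mul_exp (X : Matrix ι ι 𝕜) : NormedSpace.exp (-X) * NormedSpace.exp X = 1 := by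
  rw [← Matrix.exp_add_of_commute (-X) X (Commute.neg_left rfl), neg_add_cancel,
    NormedSpace.exp_zero]

theorem exp_mul_exp_neg (X : Matrix ι ι 𝕜) : NormedSpace.exp X * NormedSpace.exp (-X) = 1 := by
  rw [← Matrix.exp_add_of_commute X (-X) (Commute.neg_right rfl), add_neg_cancel,
    NormedSpace.exp_zero]

/-- An integral curve of the linear vector field `X` is the orbit of the one-parameter group. -/
theorem exp_smul_mulVec_of_hasDerivAt (X : Matrix ι ι ℝ) (c : ℝ → ι → ℝ)
    (hc : ∀ t, HasDerivAt c (X *ᵥ c t) t) (t : ℝ) : NormedSpace.exp (t • X) *ᵥ c 0 = c t := by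
  have key : ∀ s, HasDerivAt (fun s => NormedSpace.exp (s • -X) *ᵥ c s) 0 s := fun s => by
    convert HasDerivAt.mulVec (hasDerivAt_exp_smul (-X) s) (hc s) using 1
    rw [← Matrix.mulVec_mulVec, Matrix.neg_mulVec, Matrix.mulVec_neg, neg_add_cancel]
  have h := is_const_of_deriv_eq_zero (fun s => (key s).differentiableAt)
    (fun s => (key s).deriv) t 0
  simp only [zero_smul, NormedSpace.exp_zero, Matrix.one_mulVec] at h
  rw [← h, Matrix.mulVec_mulVec, smul_neg, exp_mul_exp_neg, Matrix.one_mulVec]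

/-- An integral curve of a linear vector field stays in every invariant subspace. -/
theorem mem_of_hasDerivAt_of_invariant {F : Type} [NormedAddCommGroup F] [NormedSpace ℝ F]
    [FiniteDimensional ℝ F] (D : F →ₗ[ℝ] F) (W : Submodule ℝ F) (hW : ∀ w ∈ W, D w ∈ W)
    (c : ℝ → F) (hc : ∀ t, HasDerivAt c (D (c t)) t) (h0 : c 0 ∈ W) (t : ℝ) : c t ∈ W := by
  let _ : NormedAlgebra ℚ (F →L[ℝ] F) := NormedAlgebra.restrictScalars ℚ ℝ _
  let D' : F →L[ℝ] F := LinearMap.toContinuousLinearMap D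
  have key : ∀ s, HasDerivAt (fun s => NormedSpace.exp (s • -D') (c s)) 0 s := fun s => by
    convert HasDerivAt.clm_apply (hasDerivAt_exp_smul_const (-D') s) (hc s) using 1
    simp [D']
  have h := is_const_of_deriv_eq_zero (fun s => (key s).differentiableAt)
    (fun s => (key s).deriv) t 0
  simp only [zero_smul, NormedSpace.exp_zero, one_apply_eq_self] at h
  have h2 : c t = NormedSpace.exp (t • D') (c 0) := by
    rw [← h, smul_neg, ← mul_apply_eq_comp,
      ← NormedSpace.exp_add_of_commute (Commute.neg_right rfl), add_neg_cancel,
      NormedSpace.exp_zero, one_apply_eq_self]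
  -- The operators preserving `W` form a closed subalgebra, which therefore contains the exponential
  -- of each of its members.
  let S : Subalgebra ℝ (F →L[ℝ] F) :=
    { carrier := {T | ∀ w ∈ W, T w ∈ W}
      mul_mem' := fun ha hb w hw => ha _ (hb w hw)
      add_mem' := fun ha hb w hw => W.add_mem (ha w hw) (hb w hw)
      algebraMap_mem' := fun r w hw => by
        rw [Algebra.algebraMap_eq_smul_one]
        exact W.smul_mem r hw }
  have hS : IsClosed (S : Set (F →L[ℝ] F)) := by
    have : (S : Set (F →L[ℝ] F)) = ⋂ w ∈ W, (fun T : F →L[ℝ] F => T w) ⁻¹' (W : Set F) := by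
      ext T
      simp only [Set.mem_iInter]
      exact Iff.rfl
    rw [this]
    exact isClosed_biInter fun w _ => W.closed_of_finiteDimensional.preimage
      (ContinuousLinearMap.apply ℝ F w).continuous
  have hD : t • D' ∈ S := S.smul_mem (fun w hw => hW w hw) t
  rw [h2]
  have _ : IsScalarTower ℚ ℝ (F →L[ℝ] F) :=
    ⟨fun q r T => by rw [Algebra.smul_def q r, mul_smul]; rfl⟩
  exact NormedSpace.exp_mem (R := ℝ) hS hD _ h0

/-- The conjugates of `Y` by exp(tX) form an integral curve of ad X, so a subspace invariant under
ad X is invariant under conjugation by exp X. This is what makes exp 𝔨 preserve both summands of a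
Cartan decomposition. -/
theorem conj_exp_mem (X : Matrix ι ι ℝ) (W : Submodule ℝ (Matrix ι ι ℝ))
    (hW : ∀ Y ∈ W, X * Y - Y * X ∈ W) (Y : Matrix ι ι ℝ) (hY : Y ∈ W) :
    NormedSpace.exp X * Y * NormedSpace.exp (-X) ∈ W := by
  let D : Matrix ι ι ℝ →ₗ[ℝ] Matrix ι ι ℝ := LinearMap.mulLeft ℝ X - LinearMap.mulRight ℝ X
  have h (t : ℝ) : HasDerivAt
      (fun t : ℝ => NormedSpace.exp (t • X) * Y * NormedSpace.exp (t • -X))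
      (D (NormedSpace.exp (t • X) * Y * NormedSpace.exp (t • -X))) t := by
    have hY : HasDerivAt (fun _ : ℝ => Y) 0 t :=
      hasDerivAt_matrix.2 fun i j => hasDerivAt_const t (Y i j)
    have h1 := HasDerivAt.matrix_mul (HasDerivAt.matrix_mul (hasDerivAt_exp_smul' X t) hY)
      (hasDerivAt_exp_smul (-X) t)
    have h2 : (X * NormedSpace.exp (t • X) * Y + NormedSpace.exp (t • X) * 0) *
        NormedSpace.exp (t • -X) + NormedSpace.exp (t • X) * Y * (NormedSpace.exp (t • -X) * -X) =
        D (NormedSpace.exp (t • X) * Y * NormedSpace.exp (t • -X)) := by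
      simp only [D, LinearMap.sub_apply, LinearMap.mulLeft_apply, LinearMap.mulRight_apply]
      noncomm_ring
    rwa [h2] at h1
  let _ : NormedAddCommGroup (Matrix ι ι ℝ) := Matrix.normedAddCommGroup
  let _ : NormedSpace ℝ (Matrix ι ι ℝ) := Matrix.normedSpace
  have := mem_of_hasDerivAt_of_invariant D W hW _ h
    (by simpa only [zero_smul, NormedSpace.exp_zero, one_mul, mul_one] using hY) 1
  simpa using this

end Flow

/-! ### Minkowski space -/

section Minkowski

variable {n : ℕ}

/-- The vector with space component `a` and time component `t`. -/
def vec (a : Fin n → ℝ) (t : ℝ) : Fin n ⊕ Fin 1 → ℝ := Sum.elim a fun _ => t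

@[simp] theorem vec_inl (a : Fin n → ℝ) (t : ℝ) (i : Fin n) : vec a t (Sum.inl i) = a i := rfl
@[simp] theorem vec_inr (a : Fin n → ℝ) (t : ℝ) (i : Fin 1) : vec a t (Sum.inr i) = t := rfl

theorem eq_vec (v : Fin n ⊕ Fin 1 → ℝ) : v = vec (fun i => v (Sum.inl i)) (v (Sum.inr 0)) := by
  ext (i | i)
  · rfl
  · rw [Subsingleton.elim i 0]; rfl

theorem vec_add (a b : Fin n → ℝ) (s t : ℝ) : vec a s + vec b t = vec (a + b) (s + t) := by
  ext (i | i) <;> rfl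

theorem smul_vec (c : ℝ) (a : Fin n → ℝ) (t : ℝ) : c • vec a t = vec (c • a) (c * t) := by
  ext (i | i) <;> rfl

theorem vec_inj {a b : Fin n → ℝ} {s t : ℝ} : vec a s = vec b t ↔ a = b ∧ s = t := by
  constructor
  · intro h
    exact ⟨funext fun i => congrFun h (Sum.inl i), congrFun h (Sum.inr 0)⟩
  · rintro ⟨rfl, rfl⟩; rfl

/-- The base point of hyperbolic space. -/
def base (n : ℕ) : Fin n ⊕ Fin 1 → ℝ := vec 0 1

theorem J_mulVec_vec (a : Fin n → ℝ) (t : ℝ) : J n *ᵥ vec a t = vec a (-t) := by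
  ext (i | i) <;>
    simp [J, LieAlgebra.Orthogonal.indefiniteDiagonal, Matrix.mulVec_diagonal]

/-- The Minkowski form. -/
def form (v w : Fin n ⊕ Fin 1 → ℝ) : ℝ := v ⬝ᵥ (J n *ᵥ w)

theorem form_vec (a b : Fin n → ℝ) (s t : ℝ) : form (vec a s) (vec b t) = a ⬝ᵥ b - s * t := by
  rw [form, J_mulVec_vec]
  simp [dotProduct]
  ring

theorem form_comm (v w : Fin n ⊕ Fin 1 → ℝ) : form v w = form w v := by
  rw [eq_vec v, eq_vec w, form_vec, form_vec, dotProduct_comm, mul_comm]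

theorem form_add_left (u v w : Fin n ⊕ Fin 1 → ℝ) : form (u + v) w = form u w + form v w := by
  simp [form, add_dotProduct]

theorem form_add_right (u v w : Fin n ⊕ Fin 1 → ℝ) : form u (v + w) = form u v + form u w := by
  simp [form, Matrix.mulVec_add]

theorem form_smul_left (c : ℝ) (v w : Fin n ⊕ Fin 1 → ℝ) : form (c • v) w = c * form v w := by
  simp [form]

theorem form_smul_right (c : ℝ) (v w : Fin n ⊕ Fin 1 → ℝ) : form v (c • w) = c * form v w := by
  simp [form, Matrix.mulVec_smul]

theorem J_mul_J : J n * J n = 1 := by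
  rw [J, LieAlgebra.Orthogonal.indefiniteDiagonal, Matrix.diagonal_mul_diagonal,
    ← Matrix.diagonal_one]
  congr 1
  ext (i | i) <;> simp

theorem J_transpose : (J n)ᵀ = J n := by
  rw [J, LieAlgebra.Orthogonal.indefiniteDiagonal, Matrix.diagonal_transpose]

theorem form_mulVec {g : Matrix (Fin n ⊕ Fin 1) (Fin n ⊕ Fin 1) ℝ} (hg : gᵀ * J n * g = J n)
    (v w : Fin n ⊕ Fin 1 → ℝ) : form (g *ᵥ v) (g *ᵥ w) = form v w := by
  rw [form, ← Matrix.vecMul_transpose, ← Matrix.dotProduct_mulVec, Matrix.mulVec_mulVec,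
    Matrix.mulVec_mulVec, hg, form]

/-- From here on `J n * gᵀ * J n` serves as the explicit inverse of an isometry `g`. -/
theorem mul_conj_J {g : Matrix (Fin n ⊕ Fin 1) (Fin n ⊕ Fin 1) ℝ} (hg : gᵀ * J n * g = J n) :
    g * (J n * gᵀ * J n) = 1 := by
  rw [mul_eq_one_comm, Matrix.mul_assoc, Matrix.mul_assoc, ← Matrix.mul_assoc gᵀ, hg, J_mul_J]

theorem conj_J_mul {g : Matrix (Fin n ⊕ Fin 1) (Fin n ⊕ Fin 1) ℝ} (hg : gᵀ * J n * g = J n) :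
    (J n * gᵀ * J n) * g = 1 := by
  rw [mul_eq_one_comm, mul_conj_J hg]

theorem mem_so {X : Matrix (Fin n ⊕ Fin 1) (Fin n ⊕ Fin 1) ℝ} :
    X ∈ so n ↔ Xᵀ * J n = -(J n * X) := by
  rw [so, LieAlgebra.Orthogonal.so', mem_skewAdjointMatricesLieSubalgebra,
    mem_skewAdjointMatricesSubmodule, Matrix.IsSkewAdjoint, Matrix.IsAdjointPair, Matrix.mul_neg]

theorem exp_transpose_mul_J {X : Matrix (Fin n ⊕ Fin 1) (Fin n ⊕ Fin 1) ℝ} (hX : X ∈ so n) :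
    (NormedSpace.exp X)ᵀ * J n * NormedSpace.exp X = J n := by
  have hJ : (J n)⁻¹ = J n := Matrix.inv_eq_left_inv J_mul_J
  have hu : IsUnit (J n) := IsUnit.of_mul_eq_one _ J_mul_J
  have h1 : Xᵀ = J n * -X * (J n)⁻¹ := by
    rw [hJ, Matrix.mul_neg, ← mem_so.1 hX, Matrix.mul_assoc, J_mul_J, Matrix.mul_one]
  rw [← Matrix.exp_transpose, h1, Matrix.exp_conj _ _ hu, hJ, Matrix.mul_assoc _ (J n) (J n),
    J_mul_J, Matrix.mul_one, Matrix.mul_assoc, exp_neg_mul_exp, Matrix.mul_one]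

/-- The upper sheet of the hyperboloid: hyperbolic `n`-space. -/
def hyp (n : ℕ) : Set (Fin n ⊕ Fin 1 → ℝ) := {v | form v v = -1 ∧ 0 < v (Sum.inr 0)}

theorem vec_mem_hyp {a : Fin n → ℝ} {t : ℝ} : vec a t ∈ hyp n ↔ t ^ 2 = 1 + a ⬝ᵥ a ∧ 0 < t := by
  simp only [hyp, Set.mem_ofPred_eq, form_vec, vec_inr]
  constructor <;> rintro ⟨h1, h2⟩ <;> exact ⟨by linarith, h2⟩

theorem base_mem_hyp : base n ∈ hyp n := by
  simp [base, vec_mem_hyp]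

theorem dotProduct_sq_le (a b : Fin n → ℝ) : (a ⬝ᵥ b) ^ 2 ≤ (a ⬝ᵥ a) * (b ⬝ᵥ b) := by
  simpa [dotProduct, sq] using Finset.sum_mul_sq_le_sq_mul_sq Finset.univ a b

theorem dotProduct_self_nonneg' (a : Fin n → ℝ) : 0 ≤ a ⬝ᵥ a :=
  Finset.sum_nonneg fun _ _ => mul_self_nonneg _

/-- The strict reversed Cauchy–Schwarz inequality. It supplies the strict convexity behind the fixed
point theorem `exists_fixed_of_bounded`. -/
theorem form_lt_neg_one_of_ne {v w : Fin n ⊕ Fin 1 → ℝ} (hv : v ∈ hyp n) (hw : w ∈ hyp n)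
    (h : v ≠ w) : form v w < -1 := by
  rw [eq_vec v] at hv h ⊢
  rw [eq_vec w] at hw h ⊢
  generalize (fun i => v (Sum.inl i)) = a at *
  generalize (fun i => w (Sum.inl i)) = b at *
  generalize v (Sum.inr 0) = s at *
  generalize w (Sum.inr 0) = t at *
  rw [vec_mem_hyp] at hv hw
  rw [form_vec]
  by_contra! h1
  apply h
  -- If the form were at least -1, this squared length would be at most -(s - t)², forcing s = t and
  -- then a = b.
  have h2 : (t • a - s • b) ⬝ᵥ (t • a - s • b) =
      t ^ 2 * (a ⬝ᵥ a) + s ^ 2 * (b ⬝ᵥ b) - 2 * (s * t) * (a ⬝ᵥ b) := by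
    simp only [sub_dotProduct, dotProduct_sub, smul_dotProduct, dotProduct_smul, smul_eq_mul,
      dotProduct_comm b a]
    ring
  have h3 := dotProduct_self_nonneg' (t • a - s • b)
  have hst : 0 < s * t := mul_pos hv.2 hw.2
  have h4 : (t • a - s • b) ⬝ᵥ (t • a - s • b) ≤ -(s - t) ^ 2 := by
    rw [h2, eq_sub_of_add_eq' hv.1.symm, eq_sub_of_add_eq' hw.1.symm]
    nlinarith [mul_le_mul_of_nonneg_left h1 hst.le]
  have hs : s = t := by nlinarith [sq_nonneg (s - t)]
  subst hs
  have h5 : s • a - s • b = 0 := dotProduct_self_eq_zero.1 (le_antisymm (by simpa using h4) h3)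
  rw [← smul_sub, smul_eq_zero, sub_eq_zero] at h5
  rw [h5.resolve_left hv.2.ne']

/-- By Cauchy–Schwarz the space part of the product cannot outweigh the time part, so the sign of
the form tells the two sheets of the hyperboloid apart. -/
theorem mem_hyp_of_form_neg {v w : Fin n ⊕ Fin 1 → ℝ} (hv : v ∈ hyp n) (hw : form w w = -1)
    (h : form v w < 0) : w ∈ hyp n := by
  rw [eq_vec v] at hv h
  rw [eq_vec w] at hw h ⊢
  generalize (fun i => v (Sum.inl i)) = a at *
  generalize (fun i => w (Sum.inl i)) = b at *
  generalize v (Sum.inr 0) = s at *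
  generalize w (Sum.inr 0) = t at *
  rw [vec_mem_hyp] at hv ⊢
  rw [form_vec] at h hw
  refine ⟨by linarith, ?_⟩
  by_contra! ht
  have h1 := dotProduct_sq_le a b
  have ha := dotProduct_self_nonneg' a
  have hb := dotProduct_self_nonneg' b
  have h2 : s * t ≤ 0 := mul_nonpos_of_nonneg_of_nonpos hv.2.le ht
  have h3 : (s * t) ^ 2 < (a ⬝ᵥ b) ^ 2 := by nlinarith
  have h4 : (s * t) ^ 2 = (1 + a ⬝ᵥ a) * (1 + b ⬝ᵥ b) := by
    rw [mul_pow, hv.1]; congr 1; linarith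
  nlinarith

theorem mulVec_base_inr (g : Matrix (Fin n ⊕ Fin 1) (Fin n ⊕ Fin 1) ℝ) (i : Fin n ⊕ Fin 1) :
    (g *ᵥ base n) i = g i (Sum.inr 0) := by
  simp [base, Matrix.mulVec, dotProduct]

theorem mulVec_mem_hyp {g : Matrix (Fin n ⊕ Fin 1) (Fin n ⊕ Fin 1) ℝ} (hg : gᵀ * J n * g = J n)
    (h0 : 0 < g (Sum.inr 0) (Sum.inr 0)) {v : Fin n ⊕ Fin 1 → ℝ} (hv : v ∈ hyp n) :
    g *ᵥ v ∈ hyp n := by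
  have h1 : g *ᵥ base n ∈ hyp n :=
    ⟨(form_mulVec hg _ _).trans base_mem_hyp.1, by rwa [mulVec_base_inr]⟩
  refine mem_hyp_of_form_neg h1 ((form_mulVec hg _ _).trans hv.1) ?_
  rw [form_mulVec hg, eq_vec v, base, form_vec]
  simpa using hv.2

/-! ### Boosts and rotations -/

/-- The infinitesimal boost in direction `a`. -/
def boost (a : Fin n → ℝ) : Matrix (Fin n ⊕ Fin 1) (Fin n ⊕ Fin 1) ℝ :=
  Matrix.fromBlocks 0 (Matrix.of fun i _ => a i) (Matrix.of fun _ i => a i) 0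

/-- The infinitesimal rotation in the plane spanned by `a` and `b`. -/
def rot (a b : Fin n → ℝ) : Matrix (Fin n ⊕ Fin 1) (Fin n ⊕ Fin 1) ℝ :=
  Matrix.fromBlocks (Matrix.vecMulVec b a - Matrix.vecMulVec a b) 0 0 0

theorem mem_so_fromBlocks {X : Matrix (Fin n) (Fin n) ℝ} {Y : Matrix (Fin n) (Fin 1) ℝ}
    {Z : Matrix (Fin 1) (Fin n) ℝ} {W : Matrix (Fin 1) (Fin 1) ℝ} :
    Matrix.fromBlocks X Y Z W ∈ so n ↔ Xᵀ = -X ∧ Z = Yᵀ ∧ W = 0 := by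
  have hJ : J n = Matrix.fromBlocks 1 0 0 (-1) := by
    rw [J, LieAlgebra.Orthogonal.indefiniteDiagonal, ← Matrix.fromBlocks_diagonal]
    congr 1
    rw [← Matrix.diagonal_one, Matrix.diagonal_neg]
  rw [mem_so, hJ, Matrix.fromBlocks_transpose, Matrix.fromBlocks_multiply,
    Matrix.fromBlocks_multiply, Matrix.fromBlocks_neg, Matrix.fromBlocks_inj]
  simp only [Matrix.mul_one, Matrix.mul_zero, add_zero, zero_add, Matrix.one_mul, Matrix.zero_mul,
    Matrix.mul_neg, Matrix.neg_mul, neg_neg]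
  constructor
  · rintro ⟨h1, h2, h3, h4⟩
    refine ⟨h1, h3.symm, ?_⟩
    ext i j
    have := congrFun (congrFun h4 i) j
    rw [Subsingleton.elim j i] at this ⊢
    simp only [Matrix.neg_apply, Matrix.transpose_apply, Matrix.zero_apply] at this ⊢
    linarith
  · rintro ⟨h1, rfl, rfl⟩
    simp [h1]

theorem boost_mem_so (a : Fin n → ℝ) : boost a ∈ so n := by
  rw [boost, mem_so_fromBlocks]
  exact ⟨by simp, rfl, rfl⟩

theorem rot_mem_so (a b : Fin n → ℝ) : rot a b ∈ so n := by
  rw [rot, mem_so_fromBlocks]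
  exact ⟨by simp [Matrix.transpose_sub, Matrix.transpose_vecMulVec], rfl, rfl⟩

theorem boost_mulVec (a b : Fin n → ℝ) (t : ℝ) : boost a *ᵥ vec b t = vec (t • a) (a ⬝ᵥ b) := by
  rw [boost, vec, Matrix.fromBlocks_mulVec]
  ext (i | i) <;> simp [vec, Matrix.mulVec, dotProduct, mul_comm]

theorem rot_mulVec (a b c : Fin n → ℝ) (t : ℝ) :
    rot a b *ᵥ vec c t = vec ((a ⬝ᵥ c) • b - (b ⬝ᵥ c) • a) 0 := by
  rw [rot, vec, Matrix.fromBlocks_mulVec]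
  ext (i | i) <;> simp [vec, Matrix.sub_mulVec, Matrix.vecMulVec_mulVec, mul_comm]

theorem hasDerivAt_vec {a : ℝ → Fin n → ℝ} {a' : Fin n → ℝ} {t : ℝ → ℝ} {t' s : ℝ}
    (ha : HasDerivAt a a' s) (ht : HasDerivAt t t' s) :
    HasDerivAt (fun s => vec (a s) (t s)) (vec a' t') s := by
  rw [hasDerivAt_pi] at ha ⊢
  rintro (i | i)
  · exact ha i
  · exact ht

/-- The right-hand side, as a curve in `t`, solves the linear equation of the boost, so uniqueness
of integral curves identifies it with the orbit. The same argument gives `exp_rot_mulVec`. -/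
theorem exp_boost_mulVec {a : Fin n → ℝ} (ha : a ⬝ᵥ a = 1) {b : Fin n → ℝ} (hb : a ⬝ᵥ b = 0)
    (r s t : ℝ) :
    NormedSpace.exp (t • boost a) *ᵥ vec (r • a + b) s =
      vec ((r * Real.cosh t + s * Real.sinh t) • a + b) (r * Real.sinh t + s * Real.cosh t) := by
  have := exp_smul_mulVec_of_hasDerivAt (boost a) (fun t =>
    vec ((r * Real.cosh t + s * Real.sinh t) • a + b) (r * Real.sinh t + s * Real.cosh t))
    (fun t => by
      refine (hasDerivAt_vec (((((Real.hasDerivAt_cosh t).const_mul r).add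
        ((Real.hasDerivAt_sinh t).const_mul s)).smul_const a).add_const b)
        (((Real.hasDerivAt_sinh t).const_mul r).add
          ((Real.hasDerivAt_cosh t).const_mul s))).congr_deriv ?_
      rw [boost_mulVec]
      simp [ha, hb]) t
  simpa using this

theorem exp_rot_mulVec {a b : Fin n → ℝ} (ha : a ⬝ᵥ a = 1) (hb : b ⬝ᵥ b = 1) (hab : a ⬝ᵥ b = 0)
    {c : Fin n → ℝ} (hac : a ⬝ᵥ c = 0) (hbc : b ⬝ᵥ c = 0) (p q s t : ℝ) :
    NormedSpace.exp (t • rot a b) *ᵥ vec (p • a + q • b + c) s =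
      vec ((p * Real.cos t - q * Real.sin t) • a + (p * Real.sin t + q * Real.cos t) • b + c) s := by
  have hba : b ⬝ᵥ a = 0 := by rw [dotProduct_comm, hab]
  have := exp_smul_mulVec_of_hasDerivAt (rot a b) (fun t =>
    vec ((p * Real.cos t - q * Real.sin t) • a + (p * Real.sin t + q * Real.cos t) • b + c) s)
    (fun t => by
      refine (hasDerivAt_vec ((((((Real.hasDerivAt_cos t).const_mul p).sub
        ((Real.hasDerivAt_sin t).const_mul q)).smul_const a).add
        ((((Real.hasDerivAt_sin t).const_mul p).add
        ((Real.hasDerivAt_cos t).const_mul q)).smul_const b)).add_const c)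
        (hasDerivAt_const t s)).congr_deriv ?_
      rw [rot_mulVec]
      simp only [dotProduct_add, dotProduct_smul, ha, hb, hab, hba, hac, hbc, smul_eq_mul]
      congr 1
      module) t
  simpa using this

end Minkowski

/-! ### Moving points and triangles -/

section Geometry

variable {n : ℕ} {S : Submonoid (Matrix (Fin n ⊕ Fin 1) (Fin n ⊕ Fin 1) ℝ)}

theorem exists_polar (p q : ℝ) : ∃ r θ : ℝ, 0 ≤ r ∧ p = r * Real.cos θ ∧ q = r * Real.sin θ :=
  ⟨‖(⟨p, q⟩ : ℂ)‖, Complex.arg ⟨p, q⟩, norm_nonneg _, (Complex.norm_mul_cos_arg ⟨p, q⟩).symm,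
    (Complex.norm_mul_sin_arg ⟨p, q⟩).symm⟩

theorem exists_polar_of_sq {p q r : ℝ} (hr : 0 ≤ r) (h : p ^ 2 + q ^ 2 = r ^ 2) :
    ∃ θ : ℝ, p = r * Real.cos θ ∧ q = r * Real.sin θ := by
  obtain ⟨s, θ, hs, rfl, rfl⟩ := exists_polar p q
  have : s ^ 2 = r ^ 2 := by
    rw [← h]; linear_combination -s ^ 2 * Real.sin_sq_add_cos_sq θ
  rw [(sq_eq_sq₀ hs hr).1 this]
  exact ⟨θ, rfl, rfl⟩

theorem exists_hyperbolic {k c : ℝ} (h : c ^ 2 = 1 + k ^ 2) (hc : 0 < c) :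
    ∃ t, k = Real.sinh t ∧ c = Real.cosh t := by
  refine ⟨Real.arsinh k, (Real.sinh_arsinh k).symm, ?_⟩
  rw [Real.cosh_arsinh, ← h, Real.sqrt_sq hc.le]

theorem exists_unit_of_ne_zero {a : Fin n → ℝ} (ha : a ≠ 0) :
    ∃ (r : ℝ) (u : Fin n → ℝ), 0 < r ∧ u ⬝ᵥ u = 1 ∧ a = r • u := by
  have h : 0 < a ⬝ᵥ a := lt_of_le_of_ne (dotProduct_self_nonneg' a)
    fun h => ha (dotProduct_self_eq_zero.1 h.symm)
  have hs := Real.sqrt_pos.2 h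
  refine ⟨√(a ⬝ᵥ a), (√(a ⬝ᵥ a))⁻¹ • a, hs, ?_, ?_⟩
  · rw [smul_dotProduct, dotProduct_smul, smul_eq_mul, smul_eq_mul, ← mul_assoc, ← mul_inv,
      Real.mul_self_sqrt h.le, inv_mul_cancel₀ h.ne']
  · rw [smul_smul, mul_inv_cancel₀ hs.ne', one_smul]

theorem exp_boost_base {a : Fin n → ℝ} (ha : a ⬝ᵥ a = 1) (t : ℝ) :
    NormedSpace.exp (t • boost a) *ᵥ base n = vec (Real.sinh t • a) (Real.cosh t) := by
  have := exp_boost_mulVec ha (b := 0) (by simp) 0 1 t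
  simpa [base] using this

theorem exp_rot_base {a b : Fin n → ℝ} (ha : a ⬝ᵥ a = 1) (hb : b ⬝ᵥ b = 1) (hab : a ⬝ᵥ b = 0)
    (t : ℝ) : NormedSpace.exp (t • rot a b) *ᵥ base n = base n := by
  have := exp_rot_mulVec ha hb hab (c := 0) (by simp) (by simp) 0 0 1 t
  simpa [base] using this

/-- Transitivity on hyperbolic space: the boost along the geodesic from the base point to `z`, with
length given by arsinh of the space part. -/
theorem exists_eq_boost {z : Fin n ⊕ Fin 1 → ℝ} (hz : z ∈ hyp n) :
    ∃ X ∈ so n, NormedSpace.exp X *ᵥ base n = z := by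
  rw [eq_vec z, vec_mem_hyp] at hz
  rw [eq_vec z]
  generalize (fun i => z (Sum.inl i)) = a at *
  generalize z (Sum.inr 0) = t at *
  by_cases ha : a = 0
  · subst ha
    refine ⟨0, zero_mem _, ?_⟩
    have : t = 1 := by
      have : t ^ 2 = 1 ^ 2 := by simpa using hz.1
      exact (sq_eq_sq₀ hz.2.le zero_le_one).1 this
    rw [NormedSpace.exp_zero, Matrix.one_mulVec, this, base]
  · obtain ⟨r, u, -, hu, rfl⟩ := exists_unit_of_ne_zero ha
    obtain ⟨τ, rfl, rfl⟩ := exists_hyperbolic (k := r) (c := t)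
      (by rw [hz.1, smul_dotProduct, dotProduct_smul, hu, smul_eq_mul, smul_eq_mul]; ring) hz.2
    exact ⟨τ • boost u, (so n).smul_mem τ (boost_mem_so u), exp_boost_base hu τ⟩

/-- A product of rotations turns `a` into the line spanned by `f`, fixing everything orthogonal. -/
theorem exists_turn (hrot : ∀ (t : ℝ) (a b : Fin n → ℝ), NormedSpace.exp (t • rot a b) ∈ S)
    {f : Fin n → ℝ} (hf : f ⬝ᵥ f = 1) (a : Fin n → ℝ) :
    ∃ h ∈ S, ∃ c : ℝ, (∀ s, h *ᵥ vec a s = vec (c • f) s) ∧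
      ∀ y s, a ⬝ᵥ y = 0 → f ⬝ᵥ y = 0 → h *ᵥ vec y s = vec y s := by
  set p := f ⬝ᵥ a
  by_cases hw : a - p • f = 0
  · refine ⟨1, S.one_mem, p, fun s => ?_, fun y s _ _ => Matrix.one_mulVec _⟩
    rw [Matrix.one_mulVec, ← sub_eq_zero.1 hw]
  · obtain ⟨q, g, hq, hg, hqg⟩ := exists_unit_of_ne_zero hw
    have ha : a = p • f + q • g + 0 := by rw [← hqg]; module
    have hfg : f ⬝ᵥ g = 0 := by
      have : f ⬝ᵥ (q • g) = 0 := by rw [← hqg, dotProduct_sub, dotProduct_smul, hf]; simp [p]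
      rw [dotProduct_smul, smul_eq_mul] at this
      exact (mul_eq_zero.1 this).resolve_left hq.ne'
    obtain ⟨r, θ, -, hp, hqs⟩ := exists_polar p q
    -- `g` is the normalized component of `a` orthogonal to `f`, and (r, θ) are polar coordinates of
    -- `a` in the frame (f, g); rotating back by θ leaves r along `f`.
    refine ⟨_, hrot (-θ) f g, r, fun s => ?_, fun y s hay hfy => ?_⟩
    · conv_lhs => rw [ha]
      rw [exp_rot_mulVec hf hg hfg (by simp) (by simp), Real.cos_neg, Real.sin_neg]
      congr 1
      have h1 : p * Real.cos θ - q * -Real.sin θ = r := by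
        rw [hp, hqs]; linear_combination r * Real.sin_sq_add_cos_sq θ
      have h2 : p * -Real.sin θ + q * Real.cos θ = 0 := by rw [hp, hqs]; ring
      rw [h1, h2]; simp
    · have hgy : g ⬝ᵥ y = 0 := by
        have : (q • g) ⬝ᵥ y = 0 := by rw [← hqg, sub_dotProduct, smul_dotProduct, hay, hfy]; simp
        rw [smul_dotProduct, smul_eq_mul] at this
        exact (mul_eq_zero.1 this).resolve_left hq.ne'
      simpa using exp_rot_mulVec hf hg hfg hfy hgy 0 0 s (-θ)

theorem exists_turn_nonneg (hrot : ∀ (t : ℝ) (a b : Fin n → ℝ), NormedSpace.exp (t • rot a b) ∈ S)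
    {f g : Fin n → ℝ} (hf : f ⬝ᵥ f = 1) (hg : g ⬝ᵥ g = 1) (hfg : f ⬝ᵥ g = 0) (a : Fin n → ℝ) :
    ∃ h ∈ S, ∃ c : ℝ, 0 ≤ c ∧ (∀ s, h *ᵥ vec a s = vec (c • f) s) ∧
      ∀ y s, a ⬝ᵥ y = 0 → f ⬝ᵥ y = 0 → g ⬝ᵥ y = 0 → h *ᵥ vec y s = vec y s := by
  obtain ⟨h, hS, c, h1, h2⟩ := exists_turn hrot hf a
  rcases le_total 0 c with hc | hc
  · exact ⟨h, hS, c, hc, h1, fun y s ha hf _ => h2 y s ha hf⟩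
  -- A half turn in the plane of `f` and `g` corrects the sign; this is the only purpose of the
  -- second direction `g`.
  · refine ⟨_, S.mul_mem (hrot Real.pi f g) hS, -c, neg_nonneg.2 hc, fun s => ?_,
      fun y s hay hfy hgy => ?_⟩
    · rw [← Matrix.mulVec_mulVec, h1]
      simpa using exp_rot_mulVec hf hg hfg (c := 0) (by simp) (by simp) c 0 s Real.pi
    · rw [← Matrix.mulVec_mulVec, h2 y s hay hfy]
      simpa using exp_rot_mulVec hf hg hfg hfy hgy 0 0 s Real.pi

/-- Every triangle can be moved into standard position in the plane spanned by `f` and `g`. -/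
theorem exists_normal_form
    (hexp : ∀ X ∈ so n, NormedSpace.exp X ∈ S) (hhyp : ∀ h ∈ S, ∀ v ∈ hyp n, h *ᵥ v ∈ hyp n)
    {f g : Fin n → ℝ} (hf : f ⬝ᵥ f = 1) (hg : g ⬝ᵥ g = 1) (hfg : f ⬝ᵥ g = 0)
    {z₁ z₂ z₃ : Fin n ⊕ Fin 1 → ℝ} (h₁ : z₁ ∈ hyp n) (h₂ : z₂ ∈ hyp n) (h₃ : z₃ ∈ hyp n) :
    ∃ h ∈ S, ∃ d p q r : ℝ, 0 ≤ d ∧ h *ᵥ z₁ = base n ∧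
      h *ᵥ z₂ = vec (Real.sinh d • f) (Real.cosh d) ∧ h *ᵥ z₃ = vec (p • f + q • g) r ∧
      p ^ 2 + q ^ 2 + 1 = r ^ 2 := by
  have hrot : ∀ (t : ℝ) (a b : Fin n → ℝ), NormedSpace.exp (t • rot a b) ∈ S := fun t a b =>
    hexp _ ((so n).smul_mem t (rot_mem_so a b))
  obtain ⟨X, hX, hXz⟩ := exists_eq_boost h₁
  set k := NormedSpace.exp (-X)
  have hk : k ∈ S := hexp _ (neg_mem hX)
  have hk1 : k *ᵥ z₁ = base n := by
    rw [← hXz, Matrix.mulVec_mulVec, exp_neg_mul_exp, Matrix.one_mulVec]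
  have hk2 := hhyp k hk z₂ h₂
  rw [eq_vec (k *ᵥ z₂)] at hk2
  obtain ⟨l, hl, c, hc, hl1, hl2⟩ := exists_turn_nonneg hrot hf hg hfg
    (fun i => (k *ᵥ z₂) (Sum.inl i))
  have hlz2 := hl1 ((k *ᵥ z₂) (Sum.inr 0))
  have hl0 : l *ᵥ base n = base n := hl2 0 1 (by simp) (by simp) (by simp)
  have hc2 := hhyp l hl _ hk2
  rw [hlz2, vec_mem_hyp, smul_dotProduct, dotProduct_smul, hf] at hc2
  obtain ⟨d, hd1, hd2⟩ := exists_hyperbolic (k := c) (by rw [hc2.1, smul_eq_mul]; simp; ring) hc2.2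
  rw [hd2, hd1, ← hd2, ← eq_vec] at hlz2
  set w := l *ᵥ (k *ᵥ z₃)
  set b : Fin n → ℝ := fun i => w (Sum.inl i)
  set p := f ⬝ᵥ b
  -- The third vertex is brought into the plane by turning only its part orthogonal to `f`. Both
  -- this part and `g` are orthogonal to `f`, so the first two vertices stay put.
  obtain ⟨m, hm, q, hm1, hm2⟩ := exists_turn hrot hg (b - p • f)
  have hpf : (b - p • f) ⬝ᵥ f = 0 := by
    rw [sub_dotProduct, smul_dotProduct, hf, dotProduct_comm]; simp [p]
  have hmf : ∀ x s : ℝ, m *ᵥ vec (x • f) s = vec (x • f) s := fun x s => hm2 _ _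
    (by rw [dotProduct_smul, hpf, smul_zero]) (by rw [dotProduct_smul, dotProduct_comm, hfg, smul_zero])
  have hmw : m *ᵥ w = vec (p • f + q • g) (w (Sum.inr 0)) := by
    have : w = vec (p • f) 0 + vec (b - p • f) (w (Sum.inr 0)) := by
      rw [vec_add, add_sub_cancel, zero_add, ← eq_vec]
    conv_lhs => rw [this]
    rw [Matrix.mulVec_add, hmf, hm1, vec_add, zero_add]
  refine ⟨m * (l * k), S.mul_mem hm (S.mul_mem hl hk), d, p, q, w (Sum.inr 0),
    ?_, ?_, ?_, ?_, ?_⟩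
  · rw [hd1] at hc; exact Real.sinh_nonneg_iff.1 hc
  · rw [← Matrix.mulVec_mulVec, ← Matrix.mulVec_mulVec, hk1, hl0]
    simpa [base] using hmf 0 1
  · rw [← Matrix.mulVec_mulVec, ← Matrix.mulVec_mulVec, hlz2, hmf, hd2]
  · rw [← Matrix.mulVec_mulVec, ← Matrix.mulVec_mulVec, hmw]
  · have := hhyp m hm w (hhyp l hl _ (hhyp k hk _ h₃))
    rw [hmw, vec_mem_hyp] at this
    rw [this.1]
    simp only [add_dotProduct, dotProduct_add, smul_dotProduct, dotProduct_smul, hf, hg, hfg,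
      dotProduct_comm g f, smul_eq_mul]
    ring

/-- An odd continuous function on the closed curve of pairs of points at distance `d` on two lines
enclosing the angle `α` has a zero. -/
theorem exists_zero_of_odd {α : ℝ} (hα : Real.sin α ≠ 0) (d : ℝ) (F : ℝ → ℝ → ℝ)
    (hF : Continuous fun x : ℝ × ℝ => F x.1 x.2) (hodd : ∀ s t, F (-s) (-t) = -F s t) :
    ∃ s t, Real.cosh s * Real.cosh t - Real.cos α * (Real.sinh s * Real.sinh t) = Real.cosh d ∧
      F s t = 0 := by
  have hcos : Real.cos α ^ 2 < 1 := by
    have := Real.sin_sq_add_cos_sq α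
    have := sq_pos_of_ne_zero hα
    linarith
  have hlt := abs_lt.1 ((sq_lt_one_iff_abs_lt_one _).1 hcos)
  -- With s = P + Q and t = P - Q the constraint becomes the ellipse A² sinh²P + B² sinh²Q =
  -- sinh²(d/2). Its angle φ parametrizes the curve, and sin α ≠ 0 keeps both semi-axes finite.
  set A := √((1 - Real.cos α) / 2)
  set B := √((1 + Real.cos α) / 2)
  have hA : 0 < A := Real.sqrt_pos.2 (by linarith)
  have hB : 0 < B := Real.sqrt_pos.2 (by linarith)
  have hA2 : A ^ 2 = (1 - Real.cos α) / 2 := Real.sq_sqrt (by linarith)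
  have hB2 : B ^ 2 = (1 + Real.cos α) / 2 := Real.sq_sqrt (by linarith)
  let P : ℝ → ℝ := fun φ => Real.arsinh (Real.sinh (d / 2) * Real.cos φ / A)
  let Q : ℝ → ℝ := fun φ => Real.arsinh (Real.sinh (d / 2) * Real.sin φ / B)
  have hP : Continuous P :=
    Real.continuous_arsinh.comp ((continuous_const.mul Real.continuous_cos).div_const A)
  have hQ : Continuous Q :=
    Real.continuous_arsinh.comp ((continuous_const.mul Real.continuous_sin).div_const B)
  have hcont : Continuous fun φ => F (P φ + Q φ) (P φ - Q φ) :=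
    hF.comp ((hP.add hQ).prodMk (hP.sub hQ))
  -- The angles 0 and π give antipodal points of the curve, so oddness yields opposite signs and the
  -- intermediate value theorem applies.
  have hneg : F (P Real.pi + Q Real.pi) (P Real.pi - Q Real.pi) = -F (P 0 + Q 0) (P 0 - Q 0) := by
    rw [← hodd]
    simp [P, Q, neg_div]
  have hzero : ∃ φ, F (P φ + Q φ) (P φ - Q φ) = 0 := by
    rcases le_total (F (P 0 + Q 0) (P 0 - Q 0)) 0 with h | h
    · exact mem_range_of_exists_le_of_exists_ge hcont ⟨0, h⟩ ⟨Real.pi, by rw [hneg]; linarith⟩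
    · exact mem_range_of_exists_le_of_exists_ge hcont ⟨Real.pi, by rw [hneg]; linarith⟩ ⟨0, h⟩
  obtain ⟨φ, hφ⟩ := hzero
  refine ⟨_, _, ?_, hφ⟩
  have h1 : A * Real.sinh (P φ) = Real.sinh (d / 2) * Real.cos φ := by
    rw [Real.sinh_arsinh]; field_simp
  have h2 : B * Real.sinh (Q φ) = Real.sinh (d / 2) * Real.sin φ := by
    rw [Real.sinh_arsinh]; field_simp
  have h3 : Real.cosh d = 1 + 2 * Real.sinh (d / 2) ^ 2 := by
    have := Real.cosh_two_mul (d / 2)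
    rw [mul_div_cancel₀ _ two_ne_zero, Real.cosh_sq] at this
    linarith
  have h4 := Real.cosh_sq (P φ)
  have h5 := Real.cosh_sq (Q φ)
  rw [Real.cosh_add, Real.cosh_sub, Real.sinh_add, Real.sinh_sub, h3]
  have h6 : A ^ 2 * Real.sinh (P φ) ^ 2 + B ^ 2 * Real.sinh (Q φ) ^ 2 = Real.sinh (d / 2) ^ 2 := by
    rw [← mul_pow, ← mul_pow, h1, h2]
    linear_combination Real.sinh (d / 2) ^ 2 * Real.sin_sq_add_cos_sq φ
  rw [hA2, hB2] at h6
  rw [← h6]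
  linear_combination (Real.cosh (Q φ) ^ 2 + Real.cos α * Real.sinh (Q φ) ^ 2) * h4 +
    (Real.sinh (P φ) ^ 2 + 1 - Real.cos α * Real.sinh (P φ) ^ 2) * h5

/-- A triangle in standard position in a hyperbolic plane can be moved so that its vertices lie on
three given lines of that plane through the base point, provided the first two are different. -/
theorem exists_move_planar (hexp : ∀ X ∈ so n, NormedSpace.exp X ∈ S)
    {f g : Fin n → ℝ} (hf : f ⬝ᵥ f = 1) (hg : g ⬝ᵥ g = 1) (hfg : f ⬝ᵥ g = 0)
    {α : ℝ} (β : ℝ) (hα : Real.sin α ≠ 0) {d p q r : ℝ} (hd : 0 ≤ d)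
    (hpqr : p ^ 2 + q ^ 2 + 1 = r ^ 2) :
    ∃ h ∈ S, ∃ t₁ t₂ k c : ℝ, h *ᵥ base n = vec (Real.sinh t₁ • f) (Real.cosh t₁) ∧
      h *ᵥ vec (Real.sinh d • f) (Real.cosh d) =
        vec (Real.sinh t₂ • (Real.cos α • f + Real.sin α • g)) (Real.cosh t₂) ∧
      h *ᵥ vec (p • f + q • g) r = vec (k • (Real.cos β • f + Real.sin β • g)) c := by
  have hR : ∀ t a b s : ℝ, NormedSpace.exp (t • rot f g) *ᵥ vec (a • f + b • g) s =
      vec ((a * Real.cos t - b * Real.sin t) • f + (a * Real.sin t + b * Real.cos t) • g) s :=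
    fun t a b s => by simpa using exp_rot_mulVec hf hg hfg (c := 0) (by simp) (by simp) a b s t
  have hB : ∀ t a b s : ℝ, NormedSpace.exp (t • boost f) *ᵥ vec (a • f + b • g) s =
      vec ((a * Real.cosh t + s * Real.sinh t) • f + b • g) (a * Real.sinh t + s * Real.cosh t) :=
    fun t a b s => exp_boost_mulVec hf (b := b • g) (by rw [dotProduct_smul, hfg, smul_zero]) a s t
  have hRS : ∀ t, NormedSpace.exp (t • rot f g) ∈ S := fun t =>
    hexp _ ((so n).smul_mem t (rot_mem_so f g))
  -- If the first two vertices coincide, both stay at the base point and a rotation takes the third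
  -- vertex to its line.
  rcases hd.eq_or_lt with rfl | hd
  · obtain ⟨ρ, ω, -, rfl, rfl⟩ := exists_polar p q
    have h0 : NormedSpace.exp ((β - ω) • rot f g) *ᵥ base n = base n := exp_rot_base hf hg hfg _
    refine ⟨_, hRS (β - ω), 0, 0, ρ, r, ?_, ?_, ?_⟩
    · rw [h0]; simp [base]
    · simpa [base] using h0
    · rw [hR, smul_add, smul_smul, smul_smul]
      have h1 : Real.cos β = Real.cos ((β - ω) + ω) := by rw [sub_add_cancel]
      have h2 : Real.sin β = Real.sin ((β - ω) + ω) := by rw [sub_add_cancel]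
      rw [h1, h2, Real.cos_add, Real.sin_add]
      congr 3 <;> ring
  -- (x, y) is the space part of the point with parameter `t` on the second line, translated back by
  -- `s` along the first line.
  · let x : ℝ → ℝ → ℝ := fun s t =>
      Real.sinh t * Real.cos α * Real.cosh s - Real.cosh t * Real.sinh s
    let y : ℝ → ℝ := fun t => Real.sinh t * Real.sin α
    -- Up to the factor sinh d, this is the component normal to the third line of the moved third
    -- vertex. The factor turns the rotation angle into `x` and `y`, so continuity needs no
    -- continuous choice of angle.
    let F : ℝ → ℝ → ℝ := fun s t => Real.cos β * (p * y t + q * x s t) -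
      Real.sin β * ((p * x s t - q * y t) * Real.cosh s + Real.sinh d * r * Real.sinh s)
    have hF : Continuous fun z : ℝ × ℝ => F z.1 z.2 := by
      have c1 : Continuous fun z : ℝ × ℝ => Real.sinh z.1 := Real.continuous_sinh.comp continuous_fst
      have c2 : Continuous fun z : ℝ × ℝ => Real.sinh z.2 := Real.continuous_sinh.comp continuous_snd
      have c3 : Continuous fun z : ℝ × ℝ => Real.cosh z.1 := Real.continuous_cosh.comp continuous_fst
      have c4 : Continuous fun z : ℝ × ℝ => Real.cosh z.2 := Real.continuous_cosh.comp continuous_snd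
      have cx : Continuous fun z : ℝ × ℝ => x z.1 z.2 :=
        ((c2.mul continuous_const).mul c3).sub (c4.mul c1)
      have cy : Continuous fun z : ℝ × ℝ => y z.2 := c2.mul continuous_const
      exact (continuous_const.mul ((continuous_const.mul cy).add (continuous_const.mul cx))).sub
        (continuous_const.mul ((((continuous_const.mul cx).sub (continuous_const.mul cy)).mul
          c3).add (continuous_const.mul c1)))
    obtain ⟨s, t, hst, hzero⟩ := exists_zero_of_odd hα d F hF fun s t => by
      simp only [F, x, y, Real.sinh_neg, Real.cosh_neg]; ring
    have hs2 := Real.cosh_sq s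
    have ht2 := Real.cosh_sq t
    have hsd : 0 < Real.sinh d := Real.sinh_pos_iff.2 hd
    -- The two chosen points are at distance `d`, so (x, y) has length sinh d, and ψ is the rotation
    -- that must precede the translation.
    obtain ⟨ψ, hψ1, hψ2⟩ := exists_polar_of_sq (p := x s t) (q := y t) hsd.le (by
      have h1 := Real.cosh_sq d
      rw [← hst] at h1
      have h3 := Real.sin_sq_add_cos_sq α
      simp only [x, y]
      rw [← sub_eq_iff_eq_add.2 h1]
      linear_combination (Real.sinh t ^ 2 - Real.sinh t ^ 2 * Real.cosh s ^ 2 * 0) * h3 +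
        (Real.sinh t ^ 2 * Real.cos α ^ 2 - Real.cosh t ^ 2) * hs2 - ht2)
    refine ⟨_, S.mul_mem (hexp _ ((so n).smul_mem s (boost_mem_so f))) (hRS ψ), s, t,
      ((p * Real.cos ψ - q * Real.sin ψ) * Real.cosh s + r * Real.sinh s) * Real.cos β +
      (p * Real.sin ψ + q * Real.cos ψ) * Real.sin β,
      (p * Real.cos ψ - q * Real.sin ψ) * Real.sinh s + r * Real.cosh s, ?_, ?_, ?_⟩
    · rw [← Matrix.mulVec_mulVec, exp_rot_base hf hg hfg, exp_boost_base hf]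
    · have h1 : Real.sinh d • f = Real.sinh d • f + (0 : ℝ) • g := by simp
      rw [← Matrix.mulVec_mulVec, h1, hR, hB, smul_add, smul_smul, smul_smul]
      simp only [zero_mul, sub_zero, add_zero, ← hψ1, ← hψ2, x, y]
      have h2 : (Real.sinh t * Real.cos α * Real.cosh s - Real.cosh t * Real.sinh s) *
          Real.cosh s + Real.cosh d * Real.sinh s = Real.sinh t * Real.cos α := by
        rw [← hst]
        linear_combination Real.sinh t * Real.cos α * hs2
      have h3 : (Real.sinh t * Real.cos α * Real.cosh s - Real.cosh t * Real.sinh s) *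
          Real.sinh s + Real.cosh d * Real.cosh s = Real.cosh t := by
        rw [← hst]
        linear_combination Real.cosh t * hs2
      rw [h2, h3]
    · rw [← Matrix.mulVec_mulVec, hR, hB, smul_add, smul_smul, smul_smul]
      have h2 : Real.cos β * (p * Real.sin ψ + q * Real.cos ψ) =
          Real.sin β * ((p * Real.cos ψ - q * Real.sin ψ) * Real.cosh s + r * Real.sinh s) := by
        apply mul_left_cancel₀ hsd.ne'
        simp only [F] at hzero
        rw [hψ1, hψ2] at hzero
        linear_combination hzero
      have h3 := Real.sin_sq_add_cos_sq β
      congr 3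
      · linear_combination -((p * Real.cos ψ - q * Real.sin ψ) * Real.cosh s + r * Real.sinh s) * h3 -
          Real.sin β * h2
      · linear_combination -(p * Real.sin ψ + q * Real.cos ψ) * h3 + Real.cos β * h2

/-- Gram–Schmidt on v₁, v₂ gives a frame in which v₂ and v₃ have angles α and β. Independence
becomes sin α ≠ 0, so the normal form and the planar motion compose. -/
theorem exists_move_of_mem_span (hexp : ∀ X ∈ so n, NormedSpace.exp X ∈ S)
    (hhyp : ∀ h ∈ S, ∀ v ∈ hyp n, h *ᵥ v ∈ hyp n)
    {v₁ v₂ v₃ : Fin n → ℝ} (h₁ : v₁ ⬝ᵥ v₁ = 1) (h₂ : v₂ ⬝ᵥ v₂ = 1) (h₃ : v₃ ⬝ᵥ v₃ = 1)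
    (h₁₂ : LinearIndependent ℝ ![v₁, v₂]) (h : v₃ ∈ Submodule.span ℝ {v₁, v₂})
    {z₁ z₂ z₃ : Fin n ⊕ Fin 1 → ℝ} (hz₁ : z₁ ∈ hyp n) (hz₂ : z₂ ∈ hyp n) (hz₃ : z₃ ∈ hyp n) :
    ∃ h ∈ S, (∃ t, h *ᵥ z₁ = vec (Real.sinh t • v₁) (Real.cosh t)) ∧
      (∃ t, h *ᵥ z₂ = vec (Real.sinh t • v₂) (Real.cosh t)) ∧
      ∃ t, h *ᵥ z₃ = vec (Real.sinh t • v₃) (Real.cosh t) := by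
  set x := v₁ ⬝ᵥ v₂
  have hw : v₂ - x • v₁ ≠ 0 := by
    intro hw
    rw [LinearIndependent.pair_iff] at h₁₂
    have := h₁₂ (-x) 1 (by rw [← hw]; module)
    exact one_ne_zero this.2
  obtain ⟨y, g, hy, hg, hyg⟩ := exists_unit_of_ne_zero hw
  have hv2 : v₂ = x • v₁ + y • g := by rw [← hyg]; module
  have hfg : v₁ ⬝ᵥ g = 0 := by
    have : v₁ ⬝ᵥ (y • g) = 0 := by rw [← hyg, dotProduct_sub, dotProduct_smul, h₁]; simp [x]
    rw [dotProduct_smul, smul_eq_mul] at this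
    exact (mul_eq_zero.1 this).resolve_left hy.ne'
  have hnorm : ∀ a b : ℝ, (a • v₁ + b • g) ⬝ᵥ (a • v₁ + b • g) = a ^ 2 + b ^ 2 := fun a b => by
    simp only [add_dotProduct, dotProduct_add, smul_dotProduct, dotProduct_smul, h₁, hg, hfg,
      dotProduct_comm g v₁, smul_eq_mul]
    ring
  obtain ⟨α, hα1, hα2⟩ := exists_polar_of_sq (p := x) (q := y) zero_le_one
    (by rw [← hnorm, ← hv2, h₂, one_pow])
  rw [one_mul] at hα1 hα2
  obtain ⟨a, b, hab⟩ := Submodule.mem_span_pair.1 h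
  have hv3 : v₃ = (a + b * x) • v₁ + (b * y) • g := by rw [← hab, hv2]; module
  obtain ⟨β, hβ1, hβ2⟩ := exists_polar_of_sq (p := a + b * x) (q := b * y) zero_le_one
    (by rw [← hnorm, ← hv3, h₃, one_pow])
  rw [one_mul] at hβ1 hβ2
  obtain ⟨k, hk, d, p, q, r, hd, hk1, hk2, hk3, hpqr⟩ :=
    exists_normal_form hexp hhyp h₁ hg hfg hz₁ hz₂ hz₃
  obtain ⟨l, hl, t₁, t₂, m, c, hl1, hl2, hl3⟩ := exists_move_planar hexp h₁ hg hfg (α := α) β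
    (by rw [← hα2]; exact hy.ne') hd hpqr
  rw [← hβ1, ← hβ2, ← hv3] at hl3
  rw [← hα1, ← hα2, ← hv2] at hl2
  have hm := hhyp l hl _ (hhyp k hk _ hz₃)
  rw [hk3, hl3, vec_mem_hyp, smul_dotProduct, dotProduct_smul, h₃] at hm
  obtain ⟨t, ht1, ht2⟩ := exists_hyperbolic (k := m) (by rw [hm.1, smul_eq_mul]; simp; ring) hm.2
  refine ⟨l * k, S.mul_mem hl hk, ⟨t₁, ?_⟩, ⟨t₂, ?_⟩, t, ?_⟩
  · rw [← Matrix.mulVec_mulVec, hk1, hl1]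
  · rw [← Matrix.mulVec_mulVec, hk2, hl2]
  · rw [← Matrix.mulVec_mulVec, hk3, hl3, ht1, ht2]

theorem eq_smul_of_not_linearIndependent {v w : Fin n → ℝ} (hv : v ≠ 0)
    (h : ¬LinearIndependent ℝ ![v, w]) : ∃ c : ℝ, w = c • v := by
  rw [LinearIndependent.pair_iff' hv] at h
  push Not at h
  obtain ⟨c, hc⟩ := h
  exact ⟨c, hc.symm⟩

theorem mem_span_pair_of_finrank {v : Fin 3 → Fin n → ℝ}
    (h : Module.finrank ℝ (Submodule.span ℝ (Set.range v)) = 2) {i j : Fin 3} (k : Fin 3)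
    (hij : LinearIndependent ℝ ![v i, v j]) : v k ∈ Submodule.span ℝ {v i, v j} := by
  have h1 : Module.finrank ℝ (Submodule.span ℝ {v i, v j}) = 2 := by
    have hr : Set.range ![v i, v j] = {v i, v j} := by ext; simp [or_comm]
    have := finrank_span_eq_card hij
    rwa [hr, Fintype.card_fin] at this
  have hle : Submodule.span ℝ {v i, v j} ≤ Submodule.span ℝ (Set.range v) :=
    Submodule.span_mono (by rintro _ (rfl | rfl) <;> exact Set.mem_range_self _)
  rw [Submodule.eq_of_le_of_finrank_eq hle (h1.trans h.symm)]
  exact Submodule.subset_span (Set.mem_range_self k)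

/-- Any triangle can be moved so that its vertices lie on three given lines through the base point,
if these lines span a plane. -/
theorem exists_move_of_finrank_eq_two (hexp : ∀ X ∈ so n, NormedSpace.exp X ∈ S)
    (hhyp : ∀ h ∈ S, ∀ v ∈ hyp n, h *ᵥ v ∈ hyp n) {v : Fin 3 → Fin n → ℝ}
    (hv : ∀ j, v j ⬝ᵥ v j = 1) (h : Module.finrank ℝ (Submodule.span ℝ (Set.range v)) = 2)
    {z : Fin 3 → Fin n ⊕ Fin 1 → ℝ} (hz : ∀ j, z j ∈ hyp n) :
    ∃ h ∈ S, ∀ j, ∃ t, h *ᵥ z j = vec (Real.sinh t • v j) (Real.cosh t) := by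
  have hv0 : ∀ j, v j ≠ 0 := fun j h0 => by simpa [h0] using hv j
  by_cases h01 : LinearIndependent ℝ ![v 0, v 1]
  · obtain ⟨k, hk, h0, h1, h2⟩ := exists_move_of_mem_span hexp hhyp (hv 0) (hv 1) (hv 2) h01
      (mem_span_pair_of_finrank h 2 h01) (hz 0) (hz 1) (hz 2)
    exact ⟨k, hk, fun j => by fin_cases j <;> assumption⟩
  by_cases h02 : LinearIndependent ℝ ![v 0, v 2]
  · obtain ⟨k, hk, h0, h1, h2⟩ := exists_move_of_mem_span hexp hhyp (hv 0) (hv 2) (hv 1) h02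
      (mem_span_pair_of_finrank h 1 h02) (hz 0) (hz 2) (hz 1)
    exact ⟨k, hk, fun j => by fin_cases j <;> assumption⟩
  obtain ⟨a, ha⟩ := eq_smul_of_not_linearIndependent (hv0 0) h01
  obtain ⟨b, hb⟩ := eq_smul_of_not_linearIndependent (hv0 0) h02
  -- If `v 0` is proportional to each of the others, the span is only a line, so it is enough to try
  -- the two pairs containing `v 0`.
  have hle : Submodule.span ℝ (Set.range v) ≤ Submodule.span ℝ {v 0} := by
    rw [Submodule.span_le]
    rintro _ ⟨j, rfl⟩
    rw [SetLike.mem_coe, Submodule.mem_span_singleton]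
    fin_cases j
    exacts [⟨1, one_smul _ _⟩, ⟨a, ha.symm⟩, ⟨b, hb.symm⟩]
  have := (Submodule.finrank_mono hle).trans (finrank_span_singleton (hv0 0)).le
  omega

theorem mulVec_injective_of_form {g : Matrix (Fin n ⊕ Fin 1) (Fin n ⊕ Fin 1) ℝ}
    (hg : gᵀ * J n * g = J n) {v w : Fin n ⊕ Fin 1 → ℝ} (h : g *ᵥ v = g *ᵥ w) : v = w := by
  have := congrArg ((J n * gᵀ * J n) *ᵥ ·) h
  simpa only [Matrix.mulVec_mulVec, conj_J_mul hg, Matrix.one_mulVec] using this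

theorem boost_point_mem_hyp {a : Fin n → ℝ} (ha : a ⬝ᵥ a = 1) (t : ℝ) :
    vec (Real.sinh t • a) (Real.cosh t) ∈ hyp n := by
  rw [vec_mem_hyp, smul_dotProduct, dotProduct_smul, ha, Real.cosh_sq]
  exact ⟨by simp; ring, Real.cosh_pos t⟩

/-- If every triangle can be moved so that its vertices lie on three given lines through the base
point, then these lines span a plane. -/
theorem finrank_eq_two_of_forall_exists_move (hn : 2 ≤ n) {v : Fin 3 → Fin n → ℝ}
    (hv : ∀ j, v j ⬝ᵥ v j = 1)
    (H : ∀ z : Fin 3 → Fin n ⊕ Fin 1 → ℝ, (∀ j, z j ∈ hyp n) →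
      ∃ g : Matrix (Fin n ⊕ Fin 1) (Fin n ⊕ Fin 1) ℝ, gᵀ * J n * g = J n ∧
        ∀ j, ∃ t, g *ᵥ z j = vec (Real.sinh t • v j) (Real.cosh t)) :
    Module.finrank ℝ (Submodule.span ℝ (Set.range v)) = 2 := by
  have hv0 : ∀ j, v j ≠ 0 := fun j h0 => by simpa [h0] using hv j
  let i₀ : Fin n := ⟨0, by omega⟩
  let i₁ : Fin n := ⟨1, by omega⟩
  have hi : i₁ ≠ i₀ := by simp [i₀, i₁]
  let e₀ : Fin n → ℝ := Pi.single i₀ 1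
  let e₁ : Fin n → ℝ := Pi.single i₁ 1
  have he₀ : e₀ ⬝ᵥ e₀ = 1 := by simp [e₀]
  have he₁ : e₁ ⬝ᵥ e₁ = 1 := by simp [e₁]
  have hs : Real.sinh 1 ≠ 0 := (Real.sinh_pos_iff.2 one_pos).ne'
  have hle : Module.finrank ℝ (Submodule.span ℝ (Set.range v)) ≤ 3 :=
    finrank_range_le_card (R := ℝ) v
  have hsub : Submodule.span ℝ {v 0} ≤ Submodule.span ℝ (Set.range v) :=
    Submodule.span_mono (Set.singleton_subset_iff.2 (Set.mem_range_self 0))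
  have hge : 1 ≤ Module.finrank ℝ (Submodule.span ℝ (Set.range v)) :=
    (finrank_span_singleton (K := ℝ) (hv0 0)).symm.le.trans (Submodule.finrank_mono hsub)
  have hne1 : Module.finrank ℝ (Submodule.span ℝ (Set.range v)) ≠ 1 := by
    intro h1
    have hspan := Submodule.eq_of_le_of_finrank_eq hsub
      ((finrank_span_singleton (K := ℝ) (hv0 0)).trans h1.symm)
    have hmem : ∀ j, ∃ c : ℝ, c • v 0 = v j := fun j => Submodule.mem_span_singleton.1
      (hspan ▸ Submodule.subset_span (Set.mem_range_self j))
    choose c hc using hmem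
    -- A nondegenerate triangle is a linearly independent triple in Minkowski space, while all
    -- points of a single geodesic lie in the image of a two-dimensional space under `L`.
    let z : Fin 3 → Fin n ⊕ Fin 1 → ℝ := ![vec (Real.sinh 0 • e₀) (Real.cosh 0),
      vec (Real.sinh 1 • e₀) (Real.cosh 1), vec (Real.sinh 1 • e₁) (Real.cosh 1)]
    obtain ⟨g, hg, hgz⟩ := H z fun j => by
      fin_cases j
      exacts [boost_point_mem_hyp he₀ _, boost_point_mem_hyp he₀ _, boost_point_mem_hyp he₁ _]
    choose t ht using hgz
    let L : (ℝ × ℝ) →ₗ[ℝ] (Fin n ⊕ Fin 1 → ℝ) :=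
      { toFun := fun x => vec (x.1 • v 0) x.2
        map_add' := fun x y => by rw [vec_add, ← add_smul]; rfl
        map_smul' := fun r x => by rw [RingHom.id_apply, smul_vec, smul_smul]; rfl }
    let w : Fin 3 → ℝ × ℝ := fun j => (Real.sinh (t j) * c j, Real.cosh (t j))
    have hzind : LinearIndependent ℝ z := by
      rw [Fintype.linearIndependent_iff]
      intro x hx
      simp only [Fin.sum_univ_three, z, Matrix.cons_val_zero, Matrix.cons_val_one, Matrix.cons_val,
        smul_vec, vec_add] at hx
      have h0 := congrFun hx (Sum.inl i₀)
      have h1 := congrFun hx (Sum.inl i₁)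
      have h2 := congrFun hx (Sum.inr 0)
      simp [e₀, e₁, hi, hi.symm, hs] at h0 h1 h2
      rw [h0, h1] at h2
      intro j
      fin_cases j
      · simpa using h2
      · exact h0
      · exact h1
    have hLw : ∀ j, (Matrix.mulVecLin g ∘ z) j = (L ∘ w) j := fun j => by
      simp only [Function.comp_apply, Matrix.mulVecLin_apply, ht, L, w, LinearMap.coe_mk,
        AddHom.coe_mk]
      rw [← hc j, smul_smul]
    have h3 : LinearIndependent ℝ (Matrix.mulVecLin g ∘ z) :=
      hzind.map' _ (LinearMap.ker_eq_bot.2 fun _ _ h => mulVec_injective_of_form hg h)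
    rw [funext hLw] at h3
    have := (LinearIndependent.of_comp L h3).fintype_card_le_finrank
    simp at this
  have hne3 : Module.finrank ℝ (Submodule.span ℝ (Set.range v)) ≠ 3 := by
    intro h3
    have hind : LinearIndependent ℝ v := by
      rw [linearIndependent_iff_card_eq_finrank_span]
      exact h3.symm
    rw [Fintype.linearIndependent_iff] at hind
    let z : Fin 3 → Fin n ⊕ Fin 1 → ℝ := ![vec (Real.sinh 0 • e₀) (Real.cosh 0),
      vec (Real.sinh 1 • e₀) (Real.cosh 1), vec (Real.sinh (-1) • e₀) (Real.cosh (-1))]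
    obtain ⟨g, hg, hgz⟩ := H z fun j => by
      fin_cases j
      exacts [boost_point_mem_hyp he₀ _, boost_point_mem_hyp he₀ _, boost_point_mem_hyp he₀ _]
    choose t ht using hgz
    -- `z 0` is the midpoint of `z 1` and `z 2`. Applying `g` turns this into a relation among the
    -- directions `v j` with coefficients in sinh (t j); independence makes them all vanish, so
    -- distinct points would have the same image.
    have hz : z 1 + z 2 = (2 * Real.cosh 1) • z 0 := by
      simp only [z, Matrix.cons_val_zero, Matrix.cons_val_one, Matrix.cons_val, vec_add, smul_vec]
      rw [vec_inj]
      constructor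
      · simp
      · simp; ring
    have hgz := congrArg (g *ᵥ ·) hz
    simp only [Matrix.mulVec_add, Matrix.mulVec_smul, ht, vec_add, smul_vec, vec_inj] at hgz
    have := hind ![-(2 * Real.cosh 1 * Real.sinh (t 0)), Real.sinh (t 1), Real.sinh (t 2)] (by
      simp only [Fin.sum_univ_three, Matrix.cons_val_zero, Matrix.cons_val_one, Matrix.cons_val]
      rw [add_assoc, hgz.1, smul_smul, ← add_smul]
      simp)
    have h0 : t 0 = 0 := by simpa [(Real.cosh_pos 1).ne'] using this 0
    have h1 : t 1 = 0 := by simpa using this 1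
    have h01 : g *ᵥ z 0 = g *ᵥ z 1 := by rw [ht 0, ht 1, h0, h1]; simp
    have := congrFun (mulVec_injective_of_form hg h01) (Sum.inl i₀)
    exact hs (by simpa [z, e₀] using this.symm)
  omega

end Geometry

/-! ### Cartan decompositions -/

section Cartan

variable {L : Type} [LieRing L] [LieAlgebra ℝ L] {𝔨 𝔰 𝔨' 𝔰' : Submodule ℝ L}

/-- The trace of the square of a nonzero map which is symmetric or skew with respect to an inner
product has the expected sign. -/
theorem exists_trace_sq_eq {E : Type} [AddCommGroup E] [Module ℝ E] [FiniteDimensional ℝ E]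
    (b : E →ₗ[ℝ] E →ₗ[ℝ] ℝ) (hb : ∀ x y, b x y = b y x) (hpos : ∀ x, x ≠ 0 → 0 < b x x)
    (f : E →ₗ[ℝ] E) (hf0 : f ≠ 0) (ε : ℝ) (hf : ∀ x y, b x (f y) = ε * b (f x) y) :
    ∃ c : ℝ, 0 < c ∧ LinearMap.trace ℝ E (f ∘ₗ f) = ε * c := by
  -- Computing the trace of f² in an orthonormal basis for `b` gives ε times the sum of the squared
  -- lengths of the images of the basis vectors.
  let core : InnerProductSpace.Core ℝ E :=
    { inner := fun x y => b x y
      conj_inner_symm := fun x y => hb y x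
      re_inner_nonneg := fun x => by
        by_cases hx : x = 0
        · simp [hx]
        · exact (hpos x hx).le
      add_left := fun x y z => by simp
      smul_left := fun x y r => by simp
      definite := fun x hx => by
        by_contra h
        exact (hpos x h).ne' hx }
  let _ : NormedAddCommGroup E := core.toNormedAddCommGroup
  let _ : InnerProductSpace ℝ E := InnerProductSpace.ofCore core.toCore
  let e := stdOrthonormalBasis ℝ E
  have hinner : ∀ x y : E, inner ℝ x y = b x y := fun _ _ => rfl
  refine ⟨∑ i, b (f (e i)) (f (e i)), ?_, ?_⟩
  · obtain ⟨i, hi⟩ : ∃ i, f (e i) ≠ 0 := by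
      by_contra! h
      exact hf0 (e.toBasis.ext fun i => by simpa using h i)
    refine Finset.sum_pos' (fun i _ => ?_) ⟨i, Finset.mem_univ _, hpos _ hi⟩
    exact core.re_inner_nonneg _
  · rw [LinearMap.trace_eq_sum_inner _ e, Finset.mul_sum]
    exact Finset.sum_congr rfl fun i _ => (hinner _ _).trans (hf _ _)

namespace IsCartanDecomposition

theorem exists_add (h : IsCartanDecomposition 𝔨 𝔰) (X : L) : ∃ Y ∈ 𝔨, ∃ Z ∈ 𝔰, Y + Z = X :=
  Submodule.mem_sup.1 (h.isCompl.sup_eq_top ▸ Submodule.mem_top)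

/-- The involution which is `1` on `𝔨` and `-1` on `𝔰`. -/
def involution (h : IsCartanDecomposition 𝔨 𝔰) : L →ₗ[ℝ] L :=
  𝔨.projection 𝔰 h.isCompl - 𝔰.projection 𝔨 h.isCompl.symm

theorem involution_add (h : IsCartanDecomposition 𝔨 𝔰) {X Y : L} (hX : X ∈ 𝔨) (hY : Y ∈ 𝔰) :
    h.involution (X + Y) = X - Y := by
  have h1 := Submodule.projection_apply_of_mem_left h.isCompl hX
  have h2 := Submodule.projection_apply_of_mem_left h.isCompl.symm hY
  have h3 := (Submodule.projection_apply_eq_zero_iff h.isCompl).2 hY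
  have h4 := (Submodule.projection_apply_eq_zero_iff h.isCompl.symm).2 hX
  simp [involution, h1, h2, h3, h4, sub_eq_add_neg]

theorem involution_involution (h : IsCartanDecomposition 𝔨 𝔰) (X : L) :
    h.involution (h.involution X) = X := by
  obtain ⟨Y, hY, Z, hZ, rfl⟩ := h.exists_add X
  rw [h.involution_add hY hZ, sub_eq_add_neg, h.involution_add hY (neg_mem hZ), sub_neg_eq_add]

/-- ad X ∘ ad Y interchanges 𝔨 and 𝔰, so conjugation by the involution changes its sign and its
trace is zero. -/
theorem killingForm_eq_zero (h : IsCartanDecomposition 𝔨 𝔰) {X Y : L} (hX : X ∈ 𝔨) (hY : Y ∈ 𝔰) :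
    killingForm ℝ L X Y = 0 := by
  rw [killingForm_apply_apply]
  set M := LieAlgebra.ad ℝ L X ∘ₗ LieAlgebra.ad ℝ L Y
  have h1 : h.involution * M * h.involution = -M := by
    ext Z
    obtain ⟨A, hA, B, hB, rfl⟩ := h.exists_add Z
    have hAY : ⁅Y, A⁆ ∈ 𝔰 := by rw [← lie_skew]; exact neg_mem (h.lie_ks A hA Y hY)
    have e1 : ⁅X, ⁅Y, A⁆⁆ ∈ 𝔰 := h.lie_ks X hX _ hAY
    have e2 : ⁅X, ⁅Y, B⁆⁆ ∈ 𝔨 := h.lie_kk X hX _ (h.lie_ss Y hY B hB)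
    have e3 : h.involution (⁅X, ⁅Y, A⁆⁆ - ⁅X, ⁅Y, B⁆⁆) = -⁅X, ⁅Y, A⁆⁆ - ⁅X, ⁅Y, B⁆⁆ := by
      rw [sub_eq_neg_add, h.involution_add (neg_mem e2) e1]; abel
    simp only [Module.End.mul_apply, h.involution_add hA hB, M, LinearMap.comp_apply,
      LieAlgebra.ad_apply, LinearMap.neg_apply, lie_sub, lie_add, e3]
    abel
  have h2 : h.involution * h.involution = 1 := LinearMap.ext h.involution_involution
  have h3 : LinearMap.trace ℝ L (h.involution * M * h.involution) = LinearMap.trace ℝ L M := by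
    rw [LinearMap.trace_mul_comm, ← mul_assoc, h2, one_mul]
  rw [h1, map_neg] at h3
  linarith

/-- A vector in both 𝔨' and 𝔰 would have Killing square of both signs, which gives 𝔨 = 𝔨'; then 𝔰 is
determined as the Killing-orthogonal complement. So one inclusion is all the fixed point argument
has to deliver. -/
theorem eq_of_le (h : IsCartanDecomposition 𝔨 𝔰) (h' : IsCartanDecomposition 𝔨' 𝔰')
    (hle : 𝔨 ≤ 𝔨') : 𝔨 = 𝔨' ∧ 𝔰 = 𝔰' := by
  have hk : 𝔨 = 𝔨' := by
    refine le_antisymm hle fun X hX => ?_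
    obtain ⟨Y, hY, Z, hZ, rfl⟩ := h.exists_add X
    have hZ' : Z ∈ 𝔨' := by simpa using sub_mem hX (hle hY)
    by_cases h0 : Z = 0
    · rwa [h0, add_zero]
    · exact absurd (h.pos_def Z hZ h0) (h'.neg_def Z hZ' h0).not_gt
  refine ⟨hk, ?_⟩
  have key : ∀ {𝔰 𝔰' : Submodule ℝ L}, IsCartanDecomposition 𝔨 𝔰 → IsCartanDecomposition 𝔨 𝔰' →
      𝔰 ≤ 𝔰' := by
    intro 𝔰 𝔰' h h' X hX
    obtain ⟨Y, hY, Z, hZ, rfl⟩ := h'.exists_add X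
    by_cases h0 : Y = 0
    · rwa [h0, zero_add]
    · have h1 := h.killingForm_eq_zero hY hX
      rw [map_add, h'.killingForm_eq_zero hY hZ, add_zero] at h1
      exact absurd h1 (h.neg_def Y hY h0).ne
  exact le_antisymm (key h (hk ▸ h')) (key (hk ▸ h') h)

/-- The positive definite form attached to a Cartan decomposition. -/
def form (h : IsCartanDecomposition 𝔨 𝔰) : LinearMap.BilinForm ℝ L :=
  -(killingForm ℝ L).compl₂ h.involution

theorem form_apply (h : IsCartanDecomposition 𝔨 𝔰) {A B C D : L} (hA : A ∈ 𝔨) (hB : B ∈ 𝔰)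
    (hC : C ∈ 𝔨) (hD : D ∈ 𝔰) :
    h.form (A + B) (C + D) = killingForm ℝ L B D - killingForm ℝ L A C := by
  have h1 : killingForm ℝ L B C = 0 := by
    rw [LieModule.traceForm_comm]; exact h.killingForm_eq_zero hC hB
  change -(killingForm ℝ L (A + B) (h.involution (C + D))) = _
  rw [h.involution_add hC hD]
  simp only [map_add, map_sub, LinearMap.add_apply, h.killingForm_eq_zero hA hD, h1]
  ring

theorem form_isSymm (h : IsCartanDecomposition 𝔨 𝔰) : LinearMap.IsSymm h.form := by
  refine ⟨fun X Y => ?_⟩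
  obtain ⟨A, hA, B, hB, rfl⟩ := h.exists_add X
  obtain ⟨C, hC, D, hD, rfl⟩ := h.exists_add Y
  rw [h.form_apply hA hB hC hD, h.form_apply hC hD hA hB, killingForm, LieModule.traceForm_comm,
    LieModule.traceForm_comm ℝ L L A]
  rfl

theorem form_pos (h : IsCartanDecomposition 𝔨 𝔰) {X : L} (hX : X ≠ 0) : 0 < h.form X X := by
  obtain ⟨A, hA, B, hB, rfl⟩ := h.exists_add X
  rw [h.form_apply hA hB hA hB]
  by_cases hA0 : A = 0
  · subst hA0
    simpa using h.pos_def B hB (by simpa using hX)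
  · have h1 := h.neg_def A hA hA0
    by_cases hB0 : B = 0
    · simpa [hB0] using h1
    · linarith [h.pos_def B hB hB0]

/-- Lie algebra automorphisms preserving a Cartan decomposition are isometries. -/
theorem form_equiv (h : IsCartanDecomposition 𝔨 𝔰) (e : L ≃ₗ⁅ℝ⁆ L) (hk : ∀ X ∈ 𝔨, e X ∈ 𝔨)
    (hs : ∀ X ∈ 𝔰, e X ∈ 𝔰) (X : L) : h.form (e X) (e X) = h.form X X := by
  obtain ⟨A, hA, B, hB, rfl⟩ := h.exists_add X
  rw [map_add, h.form_apply (hk A hA) (hs B hB) (hk A hA) (hs B hB), h.form_apply hA hB hA hB,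
    LieAlgebra.killingForm_of_equiv_apply, LieAlgebra.killingForm_of_equiv_apply]

/-- Cartan decompositions are transported by Lie algebra isomorphisms. -/
theorem comap {L' : Type} [LieRing L'] [LieAlgebra ℝ L'] (h : IsCartanDecomposition 𝔨 𝔰)
    (e : L' ≃ₗ⁅ℝ⁆ L) :
    IsCartanDecomposition (𝔨.comap (e : L' →ₗ[ℝ] L)) (𝔰.comap (e : L' →ₗ[ℝ] L)) where
  isCompl := by
    constructor
    · rw [Submodule.disjoint_def]
      intro X hX hX'
      have := Submodule.disjoint_def.1 h.isCompl.disjoint (e X) hX hX'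
      exact (LinearEquiv.map_eq_zero_iff e.toLinearEquiv).1 this
    · rw [codisjoint_iff, eq_top_iff]
      intro X _
      obtain ⟨A, hA, B, hB, hAB⟩ := h.exists_add (e X)
      refine Submodule.mem_sup.2 ⟨e.symm A, ?_, e.symm B, ?_, ?_⟩
      · simpa using hA
      · simpa using hB
      · rw [← map_add, hAB, LieEquiv.symm_apply_apply]
  lie_kk X hX Y hY := by
    change e ⁅X, Y⁆ ∈ 𝔨
    rw [LieEquiv.map_lie]
    exact h.lie_kk _ hX _ hY
  lie_ks X hX Y hY := by
    change e ⁅X, Y⁆ ∈ 𝔰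
    rw [LieEquiv.map_lie]
    exact h.lie_ks _ hX _ hY
  lie_ss X hX Y hY := by
    change e ⁅X, Y⁆ ∈ 𝔨
    rw [LieEquiv.map_lie]
    exact h.lie_ss _ hX _ hY
  neg_def X hX h0 := by
    rw [← LieAlgebra.killingForm_of_equiv_apply e]
    exact h.neg_def _ hX fun h1 => h0 ((LinearEquiv.map_eq_zero_iff e.toLinearEquiv).1 h1)
  pos_def X hX h0 := by
    rw [← LieAlgebra.killingForm_of_equiv_apply e]
    exact h.pos_def _ hX fun h1 => h0 ((LinearEquiv.map_eq_zero_iff e.toLinearEquiv).1 h1)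

end IsCartanDecomposition

/-- A linear functional is bounded with respect to a positive definite form. -/
theorem exists_sq_le_of_pos {E : Type} [AddCommGroup E] [Module ℝ E] [FiniteDimensional ℝ E]
    (b : LinearMap.BilinForm ℝ E) (hb : LinearMap.IsSymm b) (hpos : ∀ x, x ≠ 0 → 0 < b x x)
    (l : E →ₗ[ℝ] ℝ) : ∃ C : ℝ, ∀ x, l x ^ 2 ≤ C * b x x := by
  have hker : LinearMap.ker b = ⊥ := by
    rw [LinearMap.ker_eq_bot']
    intro x hx
    by_contra h0
    have := hpos x h0
    rw [hx] at this
    simp at this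
  have hsurj : Function.Surjective b :=
    (LinearMap.injective_iff_surjective_of_finrank_eq_finrank
      (Subspace.dual_finrank_eq (K := ℝ) (V := E)).symm).1 (LinearMap.ker_eq_bot.1 hker)
  -- Riesz representation by the positive definite form; the bound is then Cauchy–Schwarz.
  obtain ⟨y, rfl⟩ := hsurj l
  refine ⟨b y y, fun x => b.apply_sq_le_of_symm (fun x => ?_) hb y x⟩
  by_cases hx : x = 0
  · simp [hx]
  · exact (hpos x hx).le

end Cartan

/-! ### The standard Cartan decomposition of `𝔰𝔬(n,1)` -/

section Standard

variable {n : ℕ}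

/-- The skew-symmetric matrices in `𝔰𝔬(n,1)`. -/
def kStd (n : ℕ) : Submodule ℝ (so n) where
  carrier := {X | (X : Matrix (Fin n ⊕ Fin 1) (Fin n ⊕ Fin 1) ℝ)ᵀ = -X.1}
  zero_mem' := by simp
  add_mem' := by
    intro X Y hX hY
    simp only [Set.mem_ofPred_eq] at *
    change (X.1 + Y.1)ᵀ = -(X.1 + Y.1)
    rw [Matrix.transpose_add, hX, hY, neg_add]
  smul_mem' := by
    intro c X hX
    simp only [Set.mem_ofPred_eq] at *
    change (c • X.1)ᵀ = -(c • X.1)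
    rw [Matrix.transpose_smul, hX, smul_neg]

/-- The symmetric matrices in `𝔰𝔬(n,1)`. -/
def sStd (n : ℕ) : Submodule ℝ (so n) where
  carrier := {X | (X : Matrix (Fin n ⊕ Fin 1) (Fin n ⊕ Fin 1) ℝ)ᵀ = X.1}
  zero_mem' := by simp
  add_mem' := by
    intro X Y hX hY
    simp only [Set.mem_ofPred_eq] at *
    change (X.1 + Y.1)ᵀ = X.1 + Y.1
    rw [Matrix.transpose_add, hX, hY]
  smul_mem' := by
    intro c X hX
    simp only [Set.mem_ofPred_eq] at *
    change (c • X.1)ᵀ = c • X.1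
    rw [Matrix.transpose_smul, hX]

theorem eq_zero_of_eq_neg {m : Type} {M : Matrix m m ℝ} (h : M = -M) : M = 0 := by
  ext i j
  have := congrFun (congrFun h i) j
  rw [Matrix.neg_apply] at this
  rw [Matrix.zero_apply]
  linarith

theorem mem_kStd {X : so n} : X ∈ kStd n ↔ X.1ᵀ = -X.1 := Iff.rfl

theorem mem_sStd {X : so n} : X ∈ sStd n ↔ X.1ᵀ = X.1 := Iff.rfl

theorem coe_lie_so (X Y : so n) : (⁅X, Y⁆ : so n).1 = X.1 * Y.1 - Y.1 * X.1 := by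
  rw [LieSubalgebra.coe_bracket, LieRing.of_associative_ring_bracket]

theorem exists_blocks (X : so n) : ∃ (A : Matrix (Fin n) (Fin n) ℝ) (b : Fin n → ℝ),
    Aᵀ = -A ∧ X.1 = Matrix.fromBlocks A 0 0 0 + boost b := by
  have hX := X.2
  rw [← Matrix.fromBlocks_toBlocks X.1] at hX ⊢
  rw [mem_so_fromBlocks] at hX
  refine ⟨_, fun i => X.1.toBlocks₁₂ i 0, hX.1, ?_⟩
  rw [boost, Matrix.fromBlocks_add, hX.2.1, hX.2.2]
  simp only [add_zero, zero_add]
  congr 1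
  · ext i j; rw [Subsingleton.elim j 0]; rfl
  · ext i j; rw [Subsingleton.elim i 0]; rfl

theorem boost_transpose (a : Fin n → ℝ) : (boost a)ᵀ = boost a := by
  rw [boost, Matrix.fromBlocks_transpose]; rfl

theorem mem_kStd_iff_blocks {X : so n} :
    X ∈ kStd n ↔ ∃ A : Matrix (Fin n) (Fin n) ℝ, Aᵀ = -A ∧ X.1 = Matrix.fromBlocks A 0 0 0 := by
  rw [mem_kStd]
  constructor
  · obtain ⟨A, b, hA, hX⟩ := exists_blocks X
    intro h
    refine ⟨A, hA, ?_⟩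
    rw [hX, Matrix.transpose_add, Matrix.fromBlocks_transpose, hA, boost_transpose] at h
    have hb : boost b = 0 := eq_zero_of_eq_neg (by
      have h3 : Matrix.fromBlocks (-A) (0 : Matrix (Fin 1) (Fin n) ℝ)ᵀ (0 : Matrix (Fin n) (Fin 1) ℝ)ᵀ
          (0 : Matrix (Fin 1) (Fin 1) ℝ)ᵀ = -Matrix.fromBlocks A 0 0 0 := by
        rw [Matrix.fromBlocks_neg]; simp
      rw [h3, neg_add] at h
      exact add_left_cancel h)
    rw [hX, hb, add_zero]
  · rintro ⟨A, hA, hX⟩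
    rw [hX, Matrix.fromBlocks_transpose, hA, Matrix.fromBlocks_neg]
    simp

theorem mem_sStd_iff_boost {X : so n} : X ∈ sStd n ↔ ∃ b : Fin n → ℝ, X.1 = boost b := by
  rw [mem_sStd]
  constructor
  · obtain ⟨A, b, hA, hX⟩ := exists_blocks X
    intro h
    refine ⟨b, ?_⟩
    rw [hX, Matrix.transpose_add, Matrix.fromBlocks_transpose, hA, boost_transpose,
      add_left_inj, Matrix.fromBlocks_inj] at h
    rw [hX, eq_zero_of_eq_neg h.1.symm, Matrix.fromBlocks_zero, zero_add]
  · rintro ⟨b, hX⟩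
    rw [hX, boost_transpose]

/-- On the base point only the boost part acts. This links the algebraic definition of `kStd` to the
isotropy algebra of a point of hyperbolic space. -/
theorem mem_kStd_iff_base {X : so n} : X ∈ kStd n ↔ X.1 *ᵥ base n = 0 := by
  obtain ⟨A, b, hA, hX⟩ := exists_blocks X
  have h1 : X.1 *ᵥ base n = vec b 0 := by
    rw [hX, Matrix.add_mulVec, base, boost_mulVec, vec, Matrix.fromBlocks_mulVec]
    ext (i | i) <;> simp [vec]
  rw [h1]
  constructor
  · rw [mem_kStd_iff_blocks]
    rintro ⟨B, hB, hX'⟩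
    rw [← h1, hX', base, vec, Matrix.fromBlocks_mulVec]
    ext (i | i) <;> simp
  · intro h
    have hb : b = 0 := funext fun i => congrFun h (Sum.inl i)
    refine mem_kStd_iff_blocks.2 ⟨A, hA, ?_⟩
    rw [hX, hb]
    rw [boost, Matrix.fromBlocks_add]
    congr 1 <;> ext i j <;> simp

theorem transpose_mem_so {X : Matrix (Fin n ⊕ Fin 1) (Fin n ⊕ Fin 1) ℝ} (hX : X ∈ so n) :
    Xᵀ ∈ so n := by
  rw [mem_so, Matrix.transpose_transpose] at *
  have : J n * (Xᵀ * J n) * J n = J n * (-(J n * X)) * J n := by rw [hX]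
  rw [Matrix.mul_assoc, Matrix.mul_assoc, J_mul_J, Matrix.mul_one, Matrix.mul_neg,
    ← Matrix.mul_assoc (J n), J_mul_J, Matrix.one_mul, Matrix.neg_mul] at this
  rw [this, neg_neg]

/-! The associative algebra generated by `𝔰𝔬(n,1)` contains the diagonal matrix units. -/

theorem single_mem_adjoin (hn : 2 ≤ n) (k : Fin n ⊕ Fin 1) :
    Matrix.single k k (1 : ℝ) ∈
      Algebra.adjoin ℝ (so n : Set (Matrix (Fin n ⊕ Fin 1) (Fin n ⊕ Fin 1) ℝ)) := by
  set U := Algebra.adjoin ℝ (so n : Set (Matrix (Fin n ⊕ Fin 1) (Fin n ⊕ Fin 1) ℝ))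
  let e : Fin n → Fin n → ℝ := fun i => Pi.single i 1
  let T : Matrix (Fin n ⊕ Fin 1) (Fin n ⊕ Fin 1) ℝ := Matrix.fromBlocks 0 0 0 1
  let P : Fin n → Matrix (Fin n ⊕ Fin 1) (Fin n ⊕ Fin 1) ℝ := fun i =>
    Matrix.fromBlocks (Matrix.single i i 1) 0 0 0
  have hboost : ∀ i, boost (e i) * boost (e i) = P i + T := fun i => by
    rw [boost, Matrix.fromBlocks_multiply, Matrix.fromBlocks_add]
    congr 1
    · ext a b; simp [e, Matrix.mul_apply, Matrix.single_apply, Pi.single_apply]; grind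
    · simp
    · simp
    · ext a b; simp [e, Matrix.mul_apply, Pi.single_apply, Subsingleton.elim a b]
  have hrot : ∀ i j, i ≠ j → rot (e i) (e j) * rot (e i) (e j) = -(P i + P j) := fun i j hij => by
    have h1 : rot (e i) (e j) =
        Matrix.fromBlocks (Matrix.single j i 1 - Matrix.single i j 1) 0 0 0 := by
      rw [rot, Matrix.single_eq_single_vecMulVec_single, Matrix.single_eq_single_vecMulVec_single]
    rw [h1, Matrix.fromBlocks_multiply, Matrix.fromBlocks_add, Matrix.fromBlocks_neg]
    simp only [Matrix.sub_mul, Matrix.mul_sub, Matrix.single_mul_single_same,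
      Matrix.single_mul_single_of_ne _ _ _ _ hij, Matrix.single_mul_single_of_ne _ _ _ _ hij.symm]
    congr 1
    · simp; abel
    all_goals simp
  have hb : ∀ i, P i + T ∈ U := fun i => by
    rw [← hboost]
    exact U.mul_mem (Algebra.subset_adjoin (boost_mem_so _)) (Algebra.subset_adjoin (boost_mem_so _))
  have hr : ∀ i j, i ≠ j → P i + P j ∈ U := fun i j hij => by
    rw [← neg_neg (P i + P j), ← hrot i j hij]
    exact U.neg_mem (U.mul_mem (Algebra.subset_adjoin (rot_mem_so _ _))
      (Algebra.subset_adjoin (rot_mem_so _ _)))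
  have hT : T ∈ U := by
    let i₀ : Fin n := ⟨0, by omega⟩
    let i₁ : Fin n := ⟨1, by omega⟩
    have hi : i₀ ≠ i₁ := by simp [i₀, i₁]
    -- Squares of boosts and rotations only give sums of two projections; a second spatial
    -- direction, hence n ≥ 2, is needed to separate them.
    have h1 : T = (2⁻¹ : ℝ) • ((P i₀ + T) + (P i₁ + T) - (P i₀ + P i₁)) := by module
    rw [h1]
    exact U.smul_mem (U.sub_mem (U.add_mem (hb _) (hb _)) (hr _ _ hi)) _
  rcases k with k | k
  · have : Matrix.single (Sum.inl k) (Sum.inl k) (1 : ℝ) = (P k + T) - T := by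
      rw [add_sub_cancel_right]
      ext (i | i) (j | j) <;> simp [P, Matrix.single_apply]
    rw [this]
    exact U.sub_mem (hb k) hT
  · have : Matrix.single (Sum.inr k) (Sum.inr k) (1 : ℝ) = T := by
      ext (i | i) (j | j)
      · simp [T]
      · simp [T]
      · simp [T]
      · rw [Subsingleton.elim i k, Subsingleton.elim j k]
        simp [T]
    rw [this]
    exact hT

/-- A central element commutes with the generated associative algebra, hence with the diagonal
matrix units, so it is diagonal; the defining relation of 𝔰𝔬(n,1) kills the diagonal. -/
theorem eq_zero_of_forall_lie_eq_zero (hn : 2 ≤ n) (X : so n) (h : ∀ Y : so n, ⁅X, Y⁆ = 0) :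
    X = 0 := by
  have hcomm : ∀ M ∈ Algebra.adjoin ℝ (so n : Set (Matrix (Fin n ⊕ Fin 1) (Fin n ⊕ Fin 1) ℝ)),
      X.1 * M = M * X.1 := by
    intro M hM
    induction hM using Algebra.adjoin_induction with
    | mem Y hY =>
      have := congrArg Subtype.val (h ⟨Y, hY⟩)
      rw [coe_lie_so] at this
      exact sub_eq_zero.1 this
    | algebraMap r => exact (Algebra.commutes r X.1).symm
    | add Y Z _ _ hY hZ => rw [mul_add, add_mul, hY, hZ]
    | mul Y Z _ _ hY hZ => rw [← mul_assoc, hY, mul_assoc, hZ, mul_assoc]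
  have hX := mem_so.1 X.2
  ext i j
  change X.1 i j = 0
  by_cases hij : i = j
  · subst hij
    have := congrFun (congrFun hX i) i
    rw [J, LieAlgebra.Orthogonal.indefiniteDiagonal, Matrix.mul_diagonal, Matrix.neg_apply,
      Matrix.diagonal_mul, Matrix.transpose_apply] at this
    rcases i with i | i <;> simp at this <;> linarith
  · have := congrFun (congrFun (hcomm _ (single_mem_adjoin hn j)) i) j
    simpa [Matrix.single_mul_apply_of_ne, hij] using this

/-- For the inner product tr(XᵀY), ad X is skew when X is skew and symmetric when X is symmetric, so
the trace of its square has the required sign; it is nonzero since the centre is trivial. -/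
theorem isCartanDecomposition_std (hn : 2 ≤ n) : IsCartanDecomposition (kStd n) (sStd n) := by
  let b : so n →ₗ[ℝ] so n →ₗ[ℝ] ℝ := LinearMap.mk₂ ℝ (fun X Y => (X.1ᵀ * Y.1).trace)
    (fun X Y Z => by simp [Matrix.add_mul]) (fun c X Y => by simp)
    (fun X Y Z => by simp [Matrix.mul_add]) (fun c X Y => by simp)
  have hsymm : ∀ X Y, b X Y = b Y X := fun X Y => by
    simp only [b, LinearMap.mk₂_apply]
    rw [← Matrix.trace_transpose, Matrix.transpose_mul, Matrix.transpose_transpose]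
  have hpos : ∀ X, X ≠ 0 → 0 < b X X := fun X hX => by
    have h1 : b X X = ∑ i, ∑ j, X.1 j i ^ 2 := by
      simp [b, Matrix.trace, Matrix.mul_apply, sq]
    obtain ⟨j, i, hij⟩ : ∃ j i, X.1 j i ≠ 0 := by
      by_contra! h0
      exact hX (Subtype.ext (Matrix.ext h0))
    rw [h1]
    refine Finset.sum_pos' (fun i _ => Finset.sum_nonneg fun j _ => sq_nonneg _)
      ⟨i, Finset.mem_univ _, Finset.sum_pos' (fun j _ => sq_nonneg _)
        ⟨j, Finset.mem_univ _, by positivity⟩⟩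
  have had : ∀ X : so n, X ≠ 0 → LieAlgebra.ad ℝ (so n) X ≠ 0 := fun X hX h0 =>
    hX (eq_zero_of_forall_lie_eq_zero hn X fun Y => by
      rw [← LieAlgebra.ad_apply (R := ℝ), h0, LinearMap.zero_apply])
  -- The adjoint of ad X for the trace inner product is ad Xᵀ.
  have htr : ∀ X Y Z : so n, (Y.1ᵀ * (X.1 * Z.1 - Z.1 * X.1)).trace =
      ((X.1ᵀ * Y.1 - Y.1 * X.1ᵀ)ᵀ * Z.1).trace := fun X Y Z => by
    rw [Matrix.transpose_sub, Matrix.transpose_mul, Matrix.transpose_mul,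
      Matrix.transpose_transpose, Matrix.mul_sub, Matrix.sub_mul, Matrix.trace_sub,
      Matrix.trace_sub, ← Matrix.mul_assoc, ← Matrix.mul_assoc, Matrix.trace_mul_comm _ X.1,
      Matrix.mul_assoc X.1]
  refine ⟨⟨?_, ?_⟩, ?_, ?_, ?_, ?_, ?_⟩
  · rw [Submodule.disjoint_def]
    intro X hX hX'
    rw [mem_kStd] at hX
    rw [mem_sStd] at hX'
    rw [hX'] at hX
    exact Subtype.ext (eq_zero_of_eq_neg hX)
  · rw [codisjoint_iff, eq_top_iff]
    intro X _
    let Y : so n := ⟨X.1ᵀ, transpose_mem_so X.2⟩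
    refine Submodule.mem_sup.2 ⟨(2⁻¹ : ℝ) • (X - Y), ?_, (2⁻¹ : ℝ) • (X + Y), ?_, by module⟩
    · rw [mem_kStd]; simp [Y, Matrix.transpose_sub, ← smul_neg]
    · rw [mem_sStd]; simp [Y, Matrix.transpose_add, add_comm]
  · intro X hX Y hY
    rw [mem_kStd] at *
    rw [coe_lie_so, Matrix.transpose_sub, Matrix.transpose_mul, Matrix.transpose_mul, hX, hY]
    noncomm_ring
  · intro X hX Y hY
    rw [mem_sStd, mem_kStd] at *
    rw [coe_lie_so, Matrix.transpose_sub, Matrix.transpose_mul, Matrix.transpose_mul, hX, hY]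
    noncomm_ring
  · intro X hX Y hY
    rw [mem_kStd, mem_sStd] at *
    rw [coe_lie_so, Matrix.transpose_sub, Matrix.transpose_mul, Matrix.transpose_mul, hX, hY]
    noncomm_ring
  · intro X hX hX0
    obtain ⟨c, hc, htrace⟩ := exists_trace_sq_eq b hsymm hpos (LieAlgebra.ad ℝ (so n) X) (had X hX0)
      (-1) fun Y Z => by
        rw [mem_kStd] at hX
        simp only [b, LinearMap.mk₂_apply, LieAlgebra.ad_apply, coe_lie_so]
        rw [htr, hX, neg_one_mul, ← Matrix.trace_neg, ← Matrix.neg_mul, ← Matrix.transpose_neg]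
        congr 3
        noncomm_ring
    rw [killingForm_apply_apply, htrace]
    linarith
  · intro X hX hX0
    obtain ⟨c, hc, htrace⟩ := exists_trace_sq_eq b hsymm hpos (LieAlgebra.ad ℝ (so n) X) (had X hX0)
      1 fun Y Z => by
        rw [mem_sStd] at hX
        simp only [b, LinearMap.mk₂_apply, LieAlgebra.ad_apply, coe_lie_so]
        rw [htr, hX, one_mul]
    rw [killingForm_apply_apply, htrace]
    linarith

end Standard

/-! ### Every Cartan decomposition of `𝔰𝔬(n,1)` fixes a point of hyperbolic space -/

section FixedPoint

variable {n : ℕ} {g h : Matrix (Fin n ⊕ Fin 1) (Fin n ⊕ Fin 1) ℝ}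

theorem form_mul (hg : gᵀ * J n * g = J n) (hh : hᵀ * J n * h = J n) :
    (g * h)ᵀ * J n * (g * h) = J n := by
  rw [Matrix.transpose_mul]
  calc hᵀ * gᵀ * J n * (g * h) = hᵀ * (gᵀ * J n * g) * h := by simp only [Matrix.mul_assoc]
    _ = J n := by rw [hg, hh]

theorem inv_inv_form (g : Matrix (Fin n ⊕ Fin 1) (Fin n ⊕ Fin 1) ℝ) :
    J n * (J n * gᵀ * J n)ᵀ * J n = g := by
  simp only [Matrix.transpose_mul, Matrix.transpose_transpose, J_transpose]
  calc J n * (J n * (g * J n)) * J n = (J n * J n) * g * (J n * J n) := by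
        simp only [Matrix.mul_assoc]
    _ = g := by rw [J_mul_J, Matrix.one_mul, Matrix.mul_one]

theorem conj_mem_so (g : Matrix (Fin n ⊕ Fin 1) (Fin n ⊕ Fin 1) ℝ)
    {X : Matrix (Fin n ⊕ Fin 1) (Fin n ⊕ Fin 1) ℝ}
    (hX : X ∈ so n) : g * X * (J n * gᵀ * J n) ∈ so n := by
  have hX' : J n * Xᵀ = -(X * J n) := by
    have := congrArg (fun M => J n * M * J n) (mem_so.1 hX)
    simp only [Matrix.mul_neg, Matrix.neg_mul] at this
    rwa [Matrix.mul_assoc, Matrix.mul_assoc Xᵀ, J_mul_J, Matrix.mul_one, ← Matrix.mul_assoc (J n),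
      J_mul_J, Matrix.one_mul] at this
  rw [mem_so]
  simp only [Matrix.transpose_mul, Matrix.transpose_transpose, J_transpose]
  calc J n * (g * J n) * (Xᵀ * gᵀ) * J n = J n * g * (J n * Xᵀ) * gᵀ * J n := by
        simp only [Matrix.mul_assoc]
    _ = _ := by
        rw [hX']
        simp only [Matrix.mul_assoc, Matrix.neg_mul, Matrix.mul_neg]

/-- Conjugation by an element of `O(n,1)`, as an automorphism of `𝔰𝔬(n,1)`. -/
def conjLie (g : Matrix (Fin n ⊕ Fin 1) (Fin n ⊕ Fin 1) ℝ) (hg : gᵀ * J n * g = J n) :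
    so n ≃ₗ⁅ℝ⁆ so n where
  toFun X := ⟨g * X.1 * (J n * gᵀ * J n), conj_mem_so g X.2⟩
  map_add' X Y := Subtype.ext (by
    change g * (X.1 + Y.1) * _ = g * X.1 * _ + g * Y.1 * _
    rw [Matrix.mul_add, Matrix.add_mul])
  map_smul' c X := Subtype.ext (by
    change g * (c • X.1) * _ = c • (g * X.1 * _)
    rw [Matrix.mul_smul, Matrix.smul_mul])
  map_lie' {X Y} := Subtype.ext (by
    change g * (⁅X, Y⁆ : so n).1 * (J n * gᵀ * J n) = (⁅_, _⁆ : so n).1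
    rw [coe_lie_so X Y, coe_lie_so]
    have h1 : ∀ A B : Matrix (Fin n ⊕ Fin 1) (Fin n ⊕ Fin 1) ℝ,
        g * A * (J n * gᵀ * J n) * (g * B * (J n * gᵀ * J n)) = g * (A * B) * (J n * gᵀ * J n) :=
      fun A B => by
        calc _ = g * A * ((J n * gᵀ * J n) * g) * B * (J n * gᵀ * J n) := by
              simp only [Matrix.mul_assoc]
          _ = _ := by rw [conj_J_mul hg, Matrix.mul_one, ← Matrix.mul_assoc g A B]
    rw [h1, h1, Matrix.mul_sub, Matrix.sub_mul])
  invFun X := ⟨(J n * gᵀ * J n) * X.1 * g, by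
    have := conj_mem_so (J n * gᵀ * J n) X.2
    rwa [inv_inv_form] at this⟩
  left_inv X := Subtype.ext (by
    change (J n * gᵀ * J n) * (g * X.1 * (J n * gᵀ * J n)) * g = X.1
    calc _ = ((J n * gᵀ * J n) * g) * X.1 * ((J n * gᵀ * J n) * g) := by simp only [Matrix.mul_assoc]
      _ = _ := by rw [conj_J_mul hg, Matrix.mul_one, Matrix.one_mul])
  right_inv X := Subtype.ext (by
    change g * ((J n * gᵀ * J n) * X.1 * g) * (J n * gᵀ * J n) = X.1
    calc _ = (g * (J n * gᵀ * J n)) * X.1 * (g * (J n * gᵀ * J n)) := by simp only [Matrix.mul_assoc]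
      _ = _ := by rw [mul_conj_J hg, Matrix.mul_one, Matrix.one_mul])

theorem conjLie_coe (hg : gᵀ * J n * g = J n) (X : so n) :
    (conjLie g hg X).1 = g * X.1 * (J n * gᵀ * J n) := rfl

/-- The time entry is 1 at t = 0 and cannot vanish along exp(tX), because a vector of form -1 has
nonzero time component. -/
theorem exp_inr_pos {X : Matrix (Fin n ⊕ Fin 1) (Fin n ⊕ Fin 1) ℝ} (hX : X ∈ so n) :
    0 < NormedSpace.exp X (Sum.inr 0) (Sum.inr 0) := by
  let f : ℝ → ℝ := fun t => NormedSpace.exp (t • X) (Sum.inr 0) (Sum.inr 0)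
  have hf : Continuous f := continuous_iff_continuousAt.2 fun t =>
    (hasDerivAt_matrix.1 (hasDerivAt_exp_smul X t) _ _).continuousAt
  have h1 : ∀ t, f t ≠ 0 := fun t h0 => by
    have h2 := form_mulVec (exp_transpose_mul_J ((so n).smul_mem t hX)) (base n) (base n)
    rw [eq_vec (NormedSpace.exp (t • X) *ᵥ base n), form_vec, mulVec_base_inr] at h2
    change _ - f t * f t = _ at h2
    rw [h0, base_mem_hyp.1] at h2
    have := dotProduct_self_nonneg' (fun i => (NormedSpace.exp (t • X) *ᵥ base n) (Sum.inl i))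
    linarith
  by_contra! hneg
  obtain ⟨t, ht⟩ := mem_range_of_exists_le_of_exists_ge hf ⟨1, by simpa [f] using hneg⟩
    ⟨0, by simp [f]⟩
  exact h1 t ht

theorem exp_mulVec_mem_hyp {X : Matrix (Fin n ⊕ Fin 1) (Fin n ⊕ Fin 1) ℝ} (hX : X ∈ so n)
    {v : Fin n ⊕ Fin 1 → ℝ} (hv : v ∈ hyp n) : NormedSpace.exp X *ᵥ v ∈ hyp n :=
  mulVec_mem_hyp (exp_transpose_mul_J hX) (exp_inr_pos hX) hv

theorem exp_neg_eq {X : Matrix (Fin n ⊕ Fin 1) (Fin n ⊕ Fin 1) ℝ} (hX : X ∈ so n) :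
    J n * (NormedSpace.exp X)ᵀ * J n = NormedSpace.exp (-X) :=
  left_inv_eq_right_inv (conj_J_mul (exp_transpose_mul_J hX)) (exp_mul_exp_neg X)

/-- The elements of `O(n,1)` preserving hyperbolic space and two given subspaces of `𝔰𝔬(n,1)`. -/
def pairStabilizer (𝔨 𝔰 : Submodule ℝ (so n)) :
    Submonoid (Matrix (Fin n ⊕ Fin 1) (Fin n ⊕ Fin 1) ℝ) where
  carrier := {g | ∃ hg : gᵀ * J n * g = J n, (∀ v ∈ hyp n, g *ᵥ v ∈ hyp n) ∧
    (∀ X ∈ 𝔨, conjLie g hg X ∈ 𝔨) ∧ ∀ X ∈ 𝔰, conjLie g hg X ∈ 𝔰}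
  one_mem' := by
    have h1 : ∀ h X, conjLie (1 : Matrix (Fin n ⊕ Fin 1) (Fin n ⊕ Fin 1) ℝ) h X = X :=
      fun h X => Subtype.ext (by
        rw [conjLie_coe, Matrix.transpose_one, Matrix.mul_one, J_mul_J, Matrix.one_mul,
          Matrix.mul_one])
    refine ⟨by simp, fun v hv => by rwa [Matrix.one_mulVec], fun X hX => ?_, fun X hX => ?_⟩ <;>
      rwa [h1]
  mul_mem' := by
    rintro a b ⟨ha, ha1, ha2, ha3⟩ ⟨hb, hb1, hb2, hb3⟩
    have h1 : ∀ X, conjLie (a * b) (form_mul ha hb) X = conjLie a ha (conjLie b hb X) :=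
      fun X => Subtype.ext (by
        simp only [conjLie_coe, Matrix.transpose_mul]
        calc _ = a * b * X.1 * (J n * bᵀ * 1 * aᵀ * J n) := by
              simp only [Matrix.mul_assoc, Matrix.one_mul]
          _ = _ := by
              rw [← J_mul_J]
              simp only [Matrix.mul_assoc])
    refine ⟨form_mul ha hb, fun v hv => ?_, fun X hX => ?_, fun X hX => ?_⟩
    · rw [← Matrix.mulVec_mulVec]; exact ha1 _ (hb1 v hv)
    · rw [h1]; exact ha2 _ (hb2 X hX)
    · rw [h1]; exact ha3 _ (hb3 X hX)

theorem conjLie_exp_mem {W : Submodule ℝ (so n)} {X : so n} (hW : ∀ Y ∈ W, ⁅X, Y⁆ ∈ W) {Y : so n}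
    (hY : Y ∈ W) : conjLie (NormedSpace.exp X.1) (exp_transpose_mul_J X.2) Y ∈ W := by
  have h1 := conj_exp_mem X.1 (W.map (so n).toSubmodule.subtype) (by
    rintro _ ⟨Y, hY, rfl⟩
    exact ⟨⁅X, Y⁆, hW Y hY, coe_lie_so X Y⟩) Y.1 ⟨Y, hY, rfl⟩
  obtain ⟨Z, hZ, hZY⟩ := h1
  have : conjLie (NormedSpace.exp X.1) (exp_transpose_mul_J X.2) Y = Z :=
    Subtype.ext (by rw [conjLie_coe, exp_neg_eq X.2]; exact hZY.symm)
  rwa [this]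

variable {𝔨 𝔰 : Submodule ℝ (so n)}

theorem exp_mem_pairStabilizer (hc : IsCartanDecomposition 𝔨 𝔰) {X : so n} (hX : X ∈ 𝔨) :
    NormedSpace.exp X.1 ∈ pairStabilizer 𝔨 𝔰 :=
  ⟨exp_transpose_mul_J X.2, fun _ hv => exp_mulVec_mem_hyp X.2 hv,
    fun _ hY => conjLie_exp_mem (hc.lie_kk X hX) hY, fun _ hY => conjLie_exp_mem (hc.lie_ks X hX) hY⟩

/-- Conjugation by the stabilizer is isometric for the positive form of the decomposition, so it has
bounded orbits on 𝔰𝔬(n,1). Being multiplicative, it has bounded orbits on the generated associative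
algebra too, which contains the diagonal matrix units; conjugates of those reveal the squares of the
entries of `g`. -/
theorem exists_bound_pairStabilizer (hn : 2 ≤ n) (hc : IsCartanDecomposition 𝔨 𝔰) :
    ∃ C : ℝ, 0 ≤ C ∧ ∀ g ∈ pairStabilizer 𝔨 𝔰, ∀ v : Fin n ⊕ Fin 1 → ℝ, ‖g *ᵥ v‖ ≤ C * ‖v‖ := by
  have key : ∀ M ∈ Algebra.adjoin ℝ (so n : Set (Matrix (Fin n ⊕ Fin 1) (Fin n ⊕ Fin 1) ℝ)),
      ∀ i j, ∃ C : ℝ, ∀ g ∈ pairStabilizer 𝔨 𝔰, |(g * M * (J n * gᵀ * J n)) i j| ≤ C := by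
    intro M hM
    induction hM using Algebra.adjoin_induction with
    | mem Y hY =>
      intro i j
      let l : so n →ₗ[ℝ] ℝ :=
        { toFun := fun X => X.1 i j
          map_add' := fun _ _ => rfl
          map_smul' := fun _ _ => rfl }
      obtain ⟨C, hC⟩ := exists_sq_le_of_pos hc.form hc.form_isSymm (fun _ => hc.form_pos) l
      refine ⟨C * hc.form ⟨Y, hY⟩ ⟨Y, hY⟩ + 1, fun g hg => ?_⟩
      obtain ⟨hg, -, hg1, hg2⟩ := hg
      have h1 := hC (conjLie g hg ⟨Y, hY⟩)
      rw [hc.form_equiv _ hg1 hg2] at h1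
      have h2 : |l (conjLie g hg ⟨Y, hY⟩)| ≤ l (conjLie g hg ⟨Y, hY⟩) ^ 2 + 1 := by
        rw [← sq_abs]
        nlinarith [sq_nonneg (|l (conjLie g hg ⟨Y, hY⟩)| - 1), abs_nonneg (l (conjLie g hg ⟨Y, hY⟩))]
      exact h2.trans (by linarith)
    | algebraMap r =>
      intro i j
      refine ⟨|(algebraMap ℝ (Matrix (Fin n ⊕ Fin 1) (Fin n ⊕ Fin 1) ℝ) r) i j|, fun g hg => ?_⟩
      obtain ⟨hg, -⟩ := hg
      rw [← Algebra.commutes, Matrix.mul_assoc, mul_conj_J hg, Matrix.mul_one]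
    | add Y Z _ _ hY hZ =>
      intro i j
      obtain ⟨C, hC⟩ := hY i j
      obtain ⟨D, hD⟩ := hZ i j
      refine ⟨C + D, fun g hg => ?_⟩
      rw [Matrix.mul_add, Matrix.add_mul, Matrix.add_apply]
      exact (abs_add_le _ _).trans (add_le_add (hC g hg) (hD g hg))
    | mul Y Z _ _ hY hZ =>
      intro i j
      choose C hC using fun k => hY i k
      choose D hD using fun k => hZ k j
      refine ⟨∑ k, C k * D k, fun g hg => ?_⟩
      have h1 : g * (Y * Z) * (J n * gᵀ * J n) =
          (g * Y * (J n * gᵀ * J n)) * (g * Z * (J n * gᵀ * J n)) := by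
        calc _ = g * Y * 1 * Z * (J n * gᵀ * J n) := by simp only [Matrix.mul_assoc, Matrix.one_mul]
          _ = _ := by
            rw [← conj_J_mul hg.1]
            simp only [Matrix.mul_assoc]
      rw [h1, Matrix.mul_apply]
      refine (Finset.abs_sum_le_sum_abs _ _).trans (Finset.sum_le_sum fun k _ => ?_)
      rw [abs_mul]
      exact mul_le_mul (hC k g hg) (hD k g hg) (abs_nonneg _) ((abs_nonneg _).trans (hC k g hg))
  have hentry : ∀ i k, ∃ C : ℝ, ∀ g ∈ pairStabilizer 𝔨 𝔰, |g i k| ≤ C := fun i k => by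
    obtain ⟨C, hC⟩ := key _ (single_mem_adjoin hn k) i i
    refine ⟨C + 1, fun g hg => ?_⟩
    have h1 := hC g hg
    -- The two factors `J n` in the inverse contribute only signs.
    have h2 : |(g * Matrix.single k k (1 : ℝ) * (J n * gᵀ * J n)) i i| = |g i k| ^ 2 := by
      have hJ : ∀ i, |Sum.elim (fun _ : Fin n => (1 : ℝ)) (fun _ : Fin 1 => -1) i| = 1 := by
        rintro (i | i) <;> simp
      have h3 : (g * Matrix.single k k (1 : ℝ) * (J n * gᵀ * J n)) i i =
          g i k * (J n * gᵀ * J n) k i := by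
        rw [Matrix.mul_apply, Finset.sum_eq_single k]
        · simp
        · intro b _ hb
          rw [Matrix.mul_single_apply_of_ne _ _ _ _ _ hb, zero_mul]
        · simp
      rw [h3, J, LieAlgebra.Orthogonal.indefiniteDiagonal, Matrix.mul_diagonal,
        Matrix.diagonal_mul, Matrix.transpose_apply, abs_mul, abs_mul, abs_mul, hJ, hJ]
      ring
    rw [h2] at h1
    nlinarith [sq_nonneg (|g i k| - 1), abs_nonneg (g i k)]
  choose C hC using hentry
  have hC0 : ∀ i k, 0 ≤ C i k := fun i k => (abs_nonneg _).trans (hC i k 1 (Submonoid.one_mem _))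
  refine ⟨∑ i, ∑ k, C i k, Finset.sum_nonneg fun i _ => Finset.sum_nonneg fun k _ => hC0 i k,
    fun g hg v => ?_⟩
  rw [pi_norm_le_iff_of_nonneg (mul_nonneg (Finset.sum_nonneg fun i _ =>
    Finset.sum_nonneg fun k _ => hC0 i k) (norm_nonneg v))]
  intro i
  calc ‖(g *ᵥ v) i‖ ≤ ∑ k, ‖g i k * v k‖ := norm_sum_le Finset.univ fun k => g i k * v k
    _ ≤ ∑ k, C i k * ‖v‖ := Finset.sum_le_sum fun k _ => by
        rw [norm_mul]
        exact mul_le_mul (hC i k g hg) (norm_le_pi_norm v k) (norm_nonneg _) (hC0 i k)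
    _ = (∑ k, C i k) * ‖v‖ := (Finset.sum_mul _ _ _).symm
    _ ≤ _ := mul_le_mul_of_nonneg_right (Finset.single_le_sum (f := fun i => ∑ k, C i k)
        (fun i _ => Finset.sum_nonneg fun k _ => hC0 i k) (Finset.mem_univ i)) (norm_nonneg v)

theorem isClosed_hyp : IsClosed (hyp n) := by
  have h1 : hyp n = {v | form v v = -1} ∩ {v | 0 ≤ v (Sum.inr 0)} := by
    ext v
    refine ⟨fun hv => ⟨hv.1, hv.2.le⟩, fun hv => ⟨hv.1, lt_of_le_of_ne hv.2 fun h0 => ?_⟩⟩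
    have h2 := hv.1
    rw [Set.mem_ofPred_eq, eq_vec v, form_vec, ← h0] at h2
    have := dotProduct_self_nonneg' (fun i => v (Sum.inl i))
    linarith
  rw [h1]
  refine IsClosed.inter (isClosed_eq ?_ continuous_const)
    (isClosed_le continuous_const (continuous_apply _))
  simp only [form]
  exact continuous_id.dotProduct (continuous_const.matrix_mulVec continuous_id)

/-- A semigroup with bounded orbits preserving hyperbolic space has a fixed point: the minimum of an
invariant norm. -/
theorem exists_fixed_of_bounded (S : Submonoid (Matrix (Fin n ⊕ Fin 1) (Fin n ⊕ Fin 1) ℝ))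
    (hS : ∀ g ∈ S, ∀ v ∈ hyp n, g *ᵥ v ∈ hyp n) {C : ℝ} (hC0 : 0 ≤ C)
    (hC : ∀ g ∈ S, ∀ v : Fin n ⊕ Fin 1 → ℝ, ‖g *ᵥ v‖ ≤ C * ‖v‖) :
    ∃ x ∈ hyp n, ∀ g ∈ S, g *ᵥ x = x := by
  -- Over a monoid the supremum norm is only non-increasing under `S`, which is enough below.
  let N : (Fin n ⊕ Fin 1 → ℝ) → ℝ := fun v => ⨆ g : S, ‖g.1 *ᵥ v‖
  have hbdd : ∀ v, BddAbove (Set.range fun g : S => ‖g.1 *ᵥ v‖) := fun v =>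
    ⟨C * ‖v‖, by rintro _ ⟨g, rfl⟩; exact hC g.1 g.2 v⟩
  have hle : ∀ g ∈ S, ∀ v, ‖g *ᵥ v‖ ≤ N v := fun g hg v => le_ciSup (hbdd v) ⟨g, hg⟩
  have hnorm : ∀ v, ‖v‖ ≤ N v := fun v => by simpa using hle 1 S.one_mem v
  have hNC : ∀ v, N v ≤ C * ‖v‖ := fun v => ciSup_le fun g => hC g.1 g.2 v
  have hadd : ∀ v w, N (v + w) ≤ N v + N w := fun v w => ciSup_le fun g => by
    rw [Matrix.mulVec_add]
    exact (norm_add_le _ _).trans (add_le_add (hle g.1 g.2 v) (hle g.1 g.2 w))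
  have hsmul : ∀ c : ℝ, 0 ≤ c → ∀ v, N (c • v) ≤ c * N v := fun c hc v => ciSup_le fun g => by
    rw [Matrix.mulVec_smul, norm_smul, Real.norm_of_nonneg hc]
    exact mul_le_mul_of_nonneg_left (hle g.1 g.2 v) hc
  have hinv : ∀ g ∈ S, ∀ v, N (g *ᵥ v) ≤ N v := fun g hg v => ciSup_le fun k => by
    rw [Matrix.mulVec_mulVec]
    exact hle _ (S.mul_mem k.2 hg) v
  have hcont : Continuous N := by
    refine (LipschitzWith.of_le_add_mul ⟨C, hC0⟩ fun v w => ?_).continuous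
    have h1 := hadd w (v - w)
    rw [add_sub_cancel] at h1
    rw [dist_eq_norm]
    exact h1.trans (add_le_add_right (hNC _) _)
  -- Outside this ball `N` exceeds its value at the base point, so the minimum over a compact piece
  -- is global.
  obtain ⟨x, hx, hmin⟩ := ((isCompact_closedBall (0 : Fin n ⊕ Fin 1 → ℝ) (N (base n))).inter_left
    isClosed_hyp).exists_isMinOn ⟨base n, base_mem_hyp, by simpa using hnorm _⟩ hcont.continuousOn
  have hmin' : ∀ y ∈ hyp n, N x ≤ N y := fun y hy => by
    by_cases hyb : y ∈ Metric.closedBall (0 : Fin n ⊕ Fin 1 → ℝ) (N (base n))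
    · exact hmin ⟨hy, hyb⟩
    · have h1 : N x ≤ N (base n) := hmin ⟨base_mem_hyp, by simpa using hnorm _⟩
      rw [mem_closedBall_zero_iff, not_le] at hyb
      exact h1.trans (hyb.le.trans (hnorm y))
  refine ⟨x, hx.1, fun g hg => ?_⟩
  by_contra hne
  have hy := hS g hg x hx.1
  have hNy := hinv g hg x
  set y := g *ᵥ x
  -- If x and y = g x differed, x + y would have Minkowski length r > 2. The midpoint (x + y)/r
  -- would then satisfy N ≤ 2 N(x)/r < N(x), contradicting minimality.
  have hform := form_lt_neg_one_of_ne hy hx.1 hne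
  have hu : form (y + x) (y + x) < -4 := by
    rw [form_add_left, form_add_right, form_add_right, hy.1, hx.1.1, form_comm x y]
    linarith
  set r := √(-form (y + x) (y + x))
  have hr2 : r ^ 2 = -form (y + x) (y + x) := Real.sq_sqrt (by linarith)
  have hr : 2 < r := Real.lt_sqrt_of_sq_lt (by linarith)
  have hr0 : 0 < r := by linarith
  have hz : r⁻¹ • (y + x) ∈ hyp n := by
    refine ⟨?_, ?_⟩
    · rw [form_smul_left, form_smul_right, ← mul_assoc, ← sq, inv_pow, hr2]
      have := (hu.trans (by norm_num : (-4 : ℝ) < 0)).ne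
      field_simp
    · exact mul_pos (inv_pos.2 hr0) (add_pos hy.2 hx.1.2)
  have h1 := (hmin' _ hz).trans ((hsmul _ (inv_pos.2 hr0).le _).trans
    (mul_le_mul_of_nonneg_left (hadd y x) (inv_pos.2 hr0).le))
  have hpos : 0 < N x := by
    refine lt_of_lt_of_le (norm_pos_iff.2 fun h0 => ?_) (hnorm x)
    have := hx.1.2
    rw [h0] at this
    exact lt_irrefl _ this
  rw [inv_mul_eq_div, le_div_iff₀ hr0] at h1
  nlinarith

/-- The one-parameter groups of 𝔨 lie in the bounded stabilizer, so they fix a common point;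
differentiating at t = 0 gives the claim. -/
theorem exists_fixed_point (hn : 2 ≤ n) (hc : IsCartanDecomposition 𝔨 𝔰) :
    ∃ x ∈ hyp n, ∀ X ∈ 𝔨, X.1 *ᵥ x = 0 := by
  obtain ⟨C, hC0, hC⟩ := exists_bound_pairStabilizer hn hc
  obtain ⟨x, hx, hfix⟩ := exists_fixed_of_bounded _ (fun g hg => by
    obtain ⟨_, h, _⟩ := hg
    exact h) hC0 hC
  refine ⟨x, hx, fun X hX => ?_⟩
  have h1 : HasDerivAt (fun t : ℝ => NormedSpace.exp (t • X.1) *ᵥ x) (X.1 *ᵥ x) 0 := by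
    have := HasDerivAt.mulVec (hasDerivAt_exp_smul X.1 0) (hasDerivAt_const (0 : ℝ) x)
    rwa [zero_smul, NormedSpace.exp_zero, Matrix.one_mul, Matrix.one_mulVec, add_zero] at this
  have h2 : (fun t : ℝ => NormedSpace.exp (t • X.1) *ᵥ x) = fun _ => x :=
    funext fun t => by
      have h3 := exp_mem_pairStabilizer hc (𝔨.smul_mem t hX)
      rw [show (t • X : so n).1 = t • X.1 from rfl] at h3
      exact hfix _ h3
  rw [h2] at h1
  exact h1.unique (hasDerivAt_const _ _)

/-- Every Cartan decomposition of `𝔰𝔬(n,1)` is conjugate to the standard one. -/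
theorem exists_conj_std (hn : 2 ≤ n) (hc : IsCartanDecomposition 𝔨 𝔰) :
    ∃ X ∈ so n, ∃ hX : (NormedSpace.exp X)ᵀ * J n * NormedSpace.exp X = J n,
      𝔨 = (kStd n).comap (conjLie _ hX : so n →ₗ[ℝ] so n) ∧
      𝔰 = (sStd n).comap (conjLie _ hX : so n →ₗ[ℝ] so n) := by
  obtain ⟨x, hx, hfix⟩ := exists_fixed_point hn hc
  obtain ⟨X, hX, hXx⟩ := exists_eq_boost hx
  refine ⟨-X, neg_mem hX, exp_transpose_mul_J (neg_mem hX), ?_⟩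
  refine hc.eq_of_le ((isCartanDecomposition_std hn).comap _) fun Y hY => ?_
  change conjLie _ (exp_transpose_mul_J (neg_mem hX)) Y ∈ kStd n
  rw [mem_kStd_iff_base, conjLie_coe, exp_neg_eq (neg_mem hX), neg_neg, ← Matrix.mulVec_mulVec,
    ← Matrix.mulVec_mulVec, hXx, hfix Y hY, Matrix.mulVec_zero]

end FixedPoint

/-! ### Groups locally isomorphic to the isometry group of hyperbolic space -/

theorem exp_mulVec_eq_self {ι : Type} [Fintype ι] [DecidableEq ι] {X : Matrix ι ι ℝ} {v : ι → ℝ}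
    (h : X *ᵥ v = 0) : NormedSpace.exp X *ᵥ v = v := by
  have := exp_smul_mulVec_of_hasDerivAt X (fun _ => v)
    (fun t => by rw [h]; exact hasDerivAt_const t v) 1
  rwa [one_smul] at this

/-- The infinitesimal boosts, as a linear map into `𝔰𝔬(n,1)`. -/
def boostLin (n : ℕ) : (Fin n → ℝ) →ₗ[ℝ] so n where
  toFun v := ⟨boost v, boost_mem_so v⟩
  map_add' v w := Subtype.ext (by
    change boost (v + w) = boost v + boost w
    rw [boost, boost, boost, Matrix.fromBlocks_add]
    congr 1 <;> ext i j <;> simp)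
  map_smul' c v := Subtype.ext (by
    change boost (c • v) = c • boost v
    rw [boost, boost, Matrix.fromBlocks_smul]
    congr 1 <;> ext i j <;> simp)

theorem boostLin_injective (n : ℕ) : Function.Injective (boostLin n) := fun v w h => by
  have h1 := congrArg (fun X : so n => X.1 *ᵥ base n) h
  change boost v *ᵥ base n = boost w *ᵥ base n at h1
  rw [base, boost_mulVec, boost_mulVec, vec_inj, one_smul, one_smul] at h1
  exact h1.1

theorem boostLin_mem_sStd {n : ℕ} (v : Fin n → ℝ) : boostLin n v ∈ sStd n :=
  mem_sStd_iff_boost.2 ⟨v, rfl⟩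

theorem exists_boostLin_eq {n : ℕ} {X : so n} (hX : X ∈ sStd n) : ∃ v, boostLin n v = X := by
  obtain ⟨v, hv⟩ := mem_sStd_iff_boost.1 hX
  exact ⟨v, Subtype.ext hv.symm⟩

/-- Applied to the purely spatial vector `u`, the commutator gives (w · u)u - w. This is why maximal
abelian subspaces are lines. -/
theorem eq_smul_of_lie_boost_eq_zero {n : ℕ} {u w : Fin n → ℝ} (hu : u ⬝ᵥ u = 1)
    (h : ⁅boostLin n u, boostLin n w⁆ = 0) : w = (w ⬝ᵥ u) • u := by
  have h1 := congrArg (fun X : so n => X.1 *ᵥ vec u 0) h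
  simp only [coe_lie_so] at h1
  change (boost u * boost w - boost w * boost u) *ᵥ vec u 0 = (0 : Matrix _ _ ℝ) *ᵥ vec u 0 at h1
  rw [Matrix.sub_mulVec, ← Matrix.mulVec_mulVec, ← Matrix.mulVec_mulVec, Matrix.zero_mulVec,
    boost_mulVec, boost_mulVec, boost_mulVec, boost_mulVec, hu, one_smul, sub_eq_zero,
    vec_inj] at h1
  exact h1.1.symm

section Models

variable {ι 𝕜 : Type} [Fintype ι] [DecidableEq ι] [RCLike 𝕜]

/-- A realization of a linear group with Lie algebra `𝔰𝔬(n,1)` by isometries of hyperbolic space,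
such that the stabilizer of the base point is generated by one-parameter subgroups. -/
structure Model (n : ℕ) (G₀ : Subgroup (GL ι 𝕜)) (𝔤₀ : LieSubalgebra ℝ (Matrix ι ι 𝕜)) where
  ρ : G₀ →* Matrix (Fin n ⊕ Fin 1) (Fin n ⊕ Fin 1) ℝ
  φ : 𝔤₀ ≃ₗ⁅ℝ⁆ so n
  form : ∀ g, (ρ g)ᵀ * J n * ρ g = J n
  hyp : ∀ g, ∀ v ∈ hyp n, ρ g *ᵥ v ∈ hyp n
  exp_mem : ∀ X : 𝔤₀, ∃ g : G₀, ((g : GL ι 𝕜) : Matrix ι ι 𝕜) = NormedSpace.exp X.1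
  map_exp : ∀ (X : 𝔤₀) (g : G₀), ((g : GL ι 𝕜) : Matrix ι ι 𝕜) = NormedSpace.exp X.1 →
    ρ g = NormedSpace.exp (φ X).1
  conj : ∀ (g : G₀) (X : 𝔤₀), ∃ Y : 𝔤₀, Y.1 = (g : GL ι 𝕜).1 * X.1 * ((g⁻¹ : G₀) : GL ι 𝕜).1 ∧
    (φ Y).1 = ρ g * (φ X).1 * ρ g⁻¹
  stab : ∀ g, ρ g *ᵥ base n = base n → g ∈ K₀ G₀ ((kStd n).comap (φ : 𝔤₀ →ₗ[ℝ] so n))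

namespace Model

variable {n : ℕ} {G₀ : Subgroup (GL ι 𝕜)} {𝔤₀ : LieSubalgebra ℝ (Matrix ι ι 𝕜)}
  (M : Model n G₀ 𝔤₀)

theorem rho_mul_inv (g : G₀) : M.ρ g * M.ρ g⁻¹ = 1 := by rw [← map_mul, mul_inv_cancel, map_one]

theorem rho_inv_mul (g : G₀) : M.ρ g⁻¹ * M.ρ g = 1 := by rw [← map_mul, inv_mul_cancel, map_one]

theorem rho_inv (g : G₀) : J n * (M.ρ g)ᵀ * J n = M.ρ g⁻¹ :=
  left_inv_eq_right_inv (conj_J_mul (M.form g)) (M.rho_mul_inv g)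

theorem exists_exp (X : so n) : ∃ g : G₀, M.ρ g = NormedSpace.exp X.1 := by
  obtain ⟨g, hg⟩ := M.exp_mem (M.φ.symm X)
  exact ⟨g, by rw [M.map_exp _ _ hg, LieEquiv.apply_symm_apply]⟩

theorem conj_exp (g : G₀) {X Y : 𝔤₀} (h : Y.1 = (g : GL ι 𝕜).1 * X.1 * ((g⁻¹ : G₀) : GL ι 𝕜).1) :
    NormedSpace.exp Y.1 =
      (g : GL ι 𝕜).1 * NormedSpace.exp X.1 * ((g⁻¹ : G₀) : GL ι 𝕜).1 := by
  rw [h]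
  exact Matrix.exp_units_conj (g : GL ι 𝕜) X.1

/-- Moving the base point of a model. -/
def twist (g₀ : G₀) : Model n G₀ 𝔤₀ where
  ρ :=
    { toFun := fun g => M.ρ (g₀ * g * g₀⁻¹)
      map_one' := by simp
      map_mul' := fun g h => by rw [← map_mul]; congr 1; group }
  φ := M.φ.trans (conjLie (M.ρ g₀) (M.form g₀))
  form g := M.form _
  hyp g := M.hyp _
  exp_mem := M.exp_mem
  map_exp X g hg := by
    change M.ρ (g₀ * g * g₀⁻¹) = NormedSpace.exp (conjLie (M.ρ g₀) (M.form g₀) (M.φ X)).1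
    obtain ⟨Y, hY, hY'⟩ := M.conj g₀ X
    rw [conjLie_coe, M.rho_inv, ← hY']
    apply M.map_exp
    rw [conj_exp g₀ hY, ← hg]
    rfl
  conj g X := by
    obtain ⟨Y, hY, hY'⟩ := M.conj g X
    refine ⟨Y, hY, ?_⟩
    change (conjLie (M.ρ g₀) (M.form g₀) (M.φ Y)).1 = M.ρ (g₀ * g * g₀⁻¹) *
      (conjLie (M.ρ g₀) (M.form g₀) (M.φ X)).1 * M.ρ (g₀ * g⁻¹ * g₀⁻¹)
    rw [conjLie_coe, conjLie_coe, M.rho_inv, hY']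
    simp only [map_mul]
    calc _ = M.ρ g₀ * M.ρ g * 1 * (M.φ X).1 * 1 * M.ρ g⁻¹ * M.ρ g₀⁻¹ := by
          simp only [Matrix.mul_assoc, Matrix.mul_one]
      _ = _ := by
          rw [← M.rho_inv_mul g₀]
          simp only [Matrix.mul_assoc]
  stab g hg := by
    have h1 := M.stab _ hg
    -- Conjugation by g₀⁻¹ carries the generators exp X of the old stabilizer to generators of the
    -- new one.
    have key : ∀ k ∈ K₀ G₀ ((kStd n).comap (M.φ : 𝔤₀ →ₗ[ℝ] so n)), g₀⁻¹ * k * g₀ ∈ K₀ G₀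
        ((kStd n).comap (M.φ.trans (conjLie (M.ρ g₀) (M.form g₀)) : 𝔤₀ →ₗ[ℝ] so n)) := by
      intro k hk
      induction hk using Subgroup.closure_induction with
      | mem k hk =>
        obtain ⟨X, hX, hkX⟩ := hk
        obtain ⟨Y, hY, hY'⟩ := M.conj g₀⁻¹ X
        refine Subgroup.subset_closure ⟨Y, ?_, ?_⟩
        · change conjLie (M.ρ g₀) (M.form g₀) (M.φ Y) ∈ kStd n
          have : conjLie (M.ρ g₀) (M.form g₀) (M.φ Y) = M.φ X := Subtype.ext (by
            rw [conjLie_coe, M.rho_inv, hY', inv_inv]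
            calc _ = (M.ρ g₀ * M.ρ g₀⁻¹) * (M.φ X).1 * (M.ρ g₀ * M.ρ g₀⁻¹) := by
                  simp only [Matrix.mul_assoc]
              _ = _ := by rw [M.rho_mul_inv, Matrix.one_mul, Matrix.mul_one])
          rw [this]
          exact hX
        · rw [conj_exp _ hY, ← hkX, inv_inv]
          rfl
      | one => simp
      | mul a b _ _ ha hb =>
        have : g₀⁻¹ * (a * b) * g₀ = (g₀⁻¹ * a * g₀) * (g₀⁻¹ * b * g₀) := by group
        rw [this]
        exact Subgroup.mul_mem _ ha hb
      | inv a _ ha =>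
        have : g₀⁻¹ * a⁻¹ * g₀ = (g₀⁻¹ * a * g₀)⁻¹ := by group
        rw [this]
        exact Subgroup.inv_mem _ ha
    have h2 := key _ h1
    have h3 : g₀⁻¹ * (g₀ * g * g₀⁻¹) * g₀ = g := by group
    rwa [h3] at h2

/-- Every Cartan decomposition becomes the standard one in a suitable model. -/
theorem exists_model_of_isCartanDecomposition (M : Model n G₀ 𝔤₀) (hn : 2 ≤ n)
    {𝔨₀ 𝔰₀ : Submodule ℝ 𝔤₀} (hc : IsCartanDecomposition 𝔨₀ 𝔰₀) : ∃ M' : Model n G₀ 𝔤₀,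
      𝔨₀ = (kStd n).comap (M'.φ : 𝔤₀ →ₗ[ℝ] so n) ∧ 𝔰₀ = (sStd n).comap (M'.φ : 𝔤₀ →ₗ[ℝ] so n) := by
  obtain ⟨X, hX, hX', hk, hs⟩ := exists_conj_std hn (hc.comap M.φ.symm)
  obtain ⟨g₀, hg₀⟩ := M.exists_exp ⟨X, hX⟩
  have key : ∀ (Y : 𝔤₀), (M.twist g₀).φ Y = conjLie _ hX' (M.φ Y) := fun Y => by
    change conjLie (M.ρ g₀) (M.form g₀) (M.φ Y) = _
    congr 2
  refine ⟨M.twist g₀, ?_, ?_⟩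
  · ext Y
    change _ ↔ (M.twist g₀).φ Y ∈ kStd n
    rw [key]
    have h1 := SetLike.ext_iff.1 hk (M.φ Y)
    rw [Submodule.mem_comap, Submodule.mem_comap] at h1
    change M.φ.symm (M.φ Y) ∈ 𝔨₀ ↔ _ at h1
    rw [LieEquiv.symm_apply_apply] at h1
    exact h1
  · ext Y
    change _ ↔ (M.twist g₀).φ Y ∈ sStd n
    rw [key]
    have h1 := SetLike.ext_iff.1 hs (M.φ Y)
    rw [Submodule.mem_comap, Submodule.mem_comap] at h1
    change M.φ.symm (M.φ Y) ∈ 𝔰₀ ↔ _ at h1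
    rw [LieEquiv.symm_apply_apply] at h1
    exact h1

/-! ### The decomposition G = KAH as a statement about triangles -/

theorem mulVec_base_of_mem_K₀ {k : G₀} (hk : k ∈ K₀ G₀ ((kStd n).comap (M.φ : 𝔤₀ →ₗ[ℝ] so n))) :
    M.ρ k *ᵥ base n = base n := by
  induction hk using Subgroup.closure_induction with
  | mem k hk =>
    obtain ⟨X, hX, hkX⟩ := hk
    rw [M.map_exp X k hkX]
    exact exp_mulVec_eq_self (mem_kStd_iff_base.1 hX)
  | one => rw [map_one, Matrix.one_mulVec]
  | mul a b _ _ ha hb => rw [map_mul, ← Matrix.mulVec_mulVec, hb, ha]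
  | inv a _ ha =>
    conv_lhs => rw [← ha]
    rw [Matrix.mulVec_mulVec, M.rho_inv_mul, Matrix.one_mulVec]

/-- The boosts in the Lie algebra of a model. -/
def boostMap : (Fin n → ℝ) →ₗ[ℝ] 𝔤₀ := (M.φ.symm : so n →ₗ[ℝ] 𝔤₀) ∘ₗ boostLin n

theorem phi_boostMap (v : Fin n → ℝ) : M.φ (M.boostMap v) = boostLin n v :=
  M.φ.apply_symm_apply _

theorem boostMap_injective : Function.Injective M.boostMap :=
  M.φ.symm.injective.comp (boostLin_injective n)

theorem map_exp_boostMap {g : G₀} {t : ℝ} {v : Fin n → ℝ}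
    (hg : ((g : GL ι 𝕜) : Matrix ι ι 𝕜) = NormedSpace.exp (t • M.boostMap v).1) :
    M.ρ g = NormedSpace.exp (t • boost v) := by
  rw [M.map_exp _ _ hg]
  have : M.φ (t • M.boostMap v) = t • boostLin n v := by
    rw [← map_smul, ← map_smul, phi_boostMap]
  rw [this]
  rfl

theorem KAHDecomposition_iff (hn : 2 ≤ n) {v : Fin 3 → Fin n → ℝ} (hv : ∀ j, v j ⬝ᵥ v j = 1) :
    KAHDecomposition G₀ ((kStd n).comap (M.φ : 𝔤₀ →ₗ[ℝ] so n))
      (Submodule.pi Set.univ fun j => Submodule.span ℝ {M.boostMap (v j)}) ↔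
    Module.finrank ℝ (Submodule.span ℝ (Set.range v)) = 2 := by
  constructor
  · intro h
    refine finrank_eq_two_of_forall_exists_move hn hv fun z hz => ?_
    have h1 : ∀ j, ∃ g : G₀, M.ρ g *ᵥ base n = z j := fun j => by
      obtain ⟨X, hX, hXz⟩ := exists_eq_boost (hz j)
      obtain ⟨g, hg⟩ := M.exists_exp ⟨X, hX⟩
      exact ⟨g, by rw [hg, hXz]⟩
    choose g hg using h1
    -- Decomposing the inverses, k_j a_j x = g_j⁻¹ gives x g_j = a_j⁻¹ k_j⁻¹, which sends the base
    -- point to a_j⁻¹ · base, on the j-th geodesic.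
    have h2 : (fun j => (g j)⁻¹) ∈ (Set.univ : Set (Fin 3 → G₀)) := Set.mem_univ _
    rw [← h] at h2
    obtain ⟨_, ⟨k, hk, a, ⟨X, hX, ha⟩, rfl⟩, _, ⟨x, rfl⟩, hkax⟩ := h2
    refine ⟨M.ρ x, M.form x, fun j => ?_⟩
    obtain ⟨t, ht⟩ := Submodule.mem_span_singleton.1 (hX j (Set.mem_univ j))
    have haj := ha j
    rw [← ht] at haj
    have hρa := M.map_exp_boostMap haj
    have hkj := M.mulVec_base_of_mem_K₀ (hk j (Set.mem_univ j))
    have hj : k j * a j * x = (g j)⁻¹ := congrFun hkax j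
    refine ⟨-t, ?_⟩
    have h3 : x = (a j)⁻¹ * (k j)⁻¹ * (g j)⁻¹ := by rw [← hj]; group
    have h4 : M.ρ (k j)⁻¹ *ᵥ base n = base n := by
      conv_lhs => rw [← hkj]
      rw [Matrix.mulVec_mulVec, M.rho_inv_mul, Matrix.one_mulVec]
    have h5 : M.ρ (a j)⁻¹ = NormedSpace.exp ((-t) • boost (v j)) := by
      refine left_inv_eq_right_inv (M.rho_inv_mul (a j)) ?_
      rw [hρa, neg_smul, exp_mul_exp_neg]
    rw [h3, map_mul, map_mul, ← hg j, Matrix.mulVec_mulVec, Matrix.mul_assoc, M.rho_inv_mul,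
      Matrix.mul_one, ← Matrix.mulVec_mulVec, h4, h5, exp_boost_base (hv j)]
  · intro h
    refine Set.eq_univ_of_forall fun g => ?_
    obtain ⟨_, ⟨x, rfl⟩, hx⟩ := exists_move_of_finrank_eq_two (S := MonoidHom.mrange M.ρ)
      (fun X hX => by
        obtain ⟨y, hy⟩ := M.exists_exp ⟨X, hX⟩
        exact ⟨y, hy⟩)
      (by rintro _ ⟨y, rfl⟩ v hv; exact M.hyp y v hv) hv h
      (z := fun j => M.ρ (g j)⁻¹ *ᵥ base n) (fun j => M.hyp _ _ base_mem_hyp)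
    choose t ht using hx
    choose a ha using fun j => M.exp_mem ((-t j) • M.boostMap (v j))
    -- Since x g_j⁻¹ and a_j⁻¹ agree on the base point, g_j x⁻¹ a_j⁻¹ fixes it and lies in K₀ by
    -- `stab`.
    refine ⟨fun j => g j * x⁻¹ * (a j)⁻¹ * a j, ⟨fun j => g j * x⁻¹ * (a j)⁻¹, fun j _ => ?_, a,
      ⟨fun j => (-t j) • M.boostMap (v j), fun j _ =>
        Submodule.smul_mem _ _ (Submodule.mem_span_singleton_self _), ha⟩, rfl⟩, fun _ => x,
        ⟨x, rfl⟩, ?_⟩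
    · refine M.stab _ ?_
      have h1 : M.ρ (a j)⁻¹ = NormedSpace.exp (t j • boost (v j)) := by
        refine left_inv_eq_right_inv (M.rho_inv_mul (a j)) ?_
        rw [M.map_exp_boostMap (ha j), neg_smul, exp_neg_mul_exp]
      have h2 := ht j
      rw [map_mul, map_mul, ← Matrix.mulVec_mulVec, h1, exp_boost_base (hv j), ← h2,
        Matrix.mulVec_mulVec, Matrix.mulVec_mulVec, Matrix.mul_assoc (M.ρ (g j)),
        M.rho_inv_mul, Matrix.mul_one, M.rho_mul_inv,
        Matrix.one_mulVec]
    · funext j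
      change g j * x⁻¹ * (a j)⁻¹ * a j * x = g j
      group

theorem finrank_sup (v : Fin 3 → Fin n → ℝ) :
    Module.finrank ℝ ↥(Submodule.span ℝ {M.boostMap (v 0)} ⊔ Submodule.span ℝ {M.boostMap (v 1)} ⊔
      Submodule.span ℝ {M.boostMap (v 2)}) = Module.finrank ℝ (Submodule.span ℝ (Set.range v)) := by
  have h1 : Set.range v = {v 0} ∪ {v 1} ∪ {v 2} := by
    ext x
    simp only [Set.mem_range, Fin.exists_fin_succ, Set.mem_union, Set.mem_singleton_iff,
      eq_comm (b := x)]
    simp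
    tauto
  have h2 : Submodule.span ℝ {M.boostMap (v 0)} ⊔ Submodule.span ℝ {M.boostMap (v 1)} ⊔
      Submodule.span ℝ {M.boostMap (v 2)} = (Submodule.span ℝ (Set.range v)).map M.boostMap := by
    rw [Submodule.map_span, h1, Set.image_union, Set.image_union, Set.image_singleton,
      Set.image_singleton, Set.image_singleton, Submodule.span_union, Submodule.span_union]
  rw [h2]
  exact (Submodule.equivMapOfInjective _ M.boostMap_injective _).finrank_eq.symm

theorem mem_sStd_boostMap (v : Fin n → ℝ) :
    M.boostMap v ∈ (sStd n).comap (M.φ : 𝔤₀ →ₗ[ℝ] so n) := by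
  change M.φ (M.boostMap v) ∈ sStd n
  rw [phi_boostMap]
  exact boostLin_mem_sStd v

theorem exists_boostMap_eq {X : 𝔤₀} (hX : X ∈ (sStd n).comap (M.φ : 𝔤₀ →ₗ[ℝ] so n)) :
    ∃ v, M.boostMap v = X := by
  obtain ⟨v, hv⟩ := exists_boostLin_eq (X := M.φ X) hX
  exact ⟨v, M.φ.toLinearEquiv.injective ((M.phi_boostMap v).trans hv)⟩

theorem lie_eq_zero_of_mem_span {L : Type} [LieRing L] [LieAlgebra ℝ L] {X Y Z : L}
    (hX : X ∈ Submodule.span ℝ {Z}) (hY : Y ∈ Submodule.span ℝ {Z}) : ⁅X, Y⁆ = 0 := by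
  obtain ⟨a, rfl⟩ := Submodule.mem_span_singleton.1 hX
  obtain ⟨b, rfl⟩ := Submodule.mem_span_singleton.1 hY
  simp

/-- The maximal abelian subspaces are the lines. -/
theorem exists_eq_span_of_isMaximalAbelian (hn : 2 ≤ n) {𝔞 : Submodule ℝ 𝔤₀}
    (h : IsMaximalAbelian ((sStd n).comap (M.φ : 𝔤₀ →ₗ[ℝ] so n)) 𝔞) :
    ∃ v : Fin n → ℝ, v ⬝ᵥ v = 1 ∧ 𝔞 = Submodule.span ℝ {M.boostMap v} := by
  obtain ⟨X, hX, hX0⟩ : ∃ X ∈ 𝔞, X ≠ 0 := by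
    -- The zero subspace is not maximal, being contained in the line of any boost.
    by_contra! h0
    let e : Fin n → ℝ := Pi.single ⟨0, by omega⟩ 1
    have he : e ≠ 0 := by simp [e]
    have hle : 𝔞 ≤ Submodule.span ℝ {M.boostMap e} := fun X hX => by
      rw [h0 X hX]; exact zero_mem _
    have h1 := h.2 ⟨by
      rw [Submodule.span_singleton_le_iff_mem]; exact M.mem_sStd_boostMap e,
      fun X hX Y hY => lie_eq_zero_of_mem_span hX hY⟩ hle (Submodule.mem_span_singleton_self _)
    exact he (M.boostMap_injective ((h0 _ h1).trans (map_zero _).symm))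
  obtain ⟨w, rfl⟩ := M.exists_boostMap_eq (h.1.1 hX)
  have hw : w ≠ 0 := fun h0 => hX0 (by rw [h0, map_zero])
  obtain ⟨r, u, hr, hu, rfl⟩ := exists_unit_of_ne_zero hw
  have hu𝔞 : M.boostMap u ∈ 𝔞 := by
    have := 𝔞.smul_mem r⁻¹ hX
    rwa [map_smul, smul_smul, inv_mul_cancel₀ hr.ne', one_smul] at this
  refine ⟨u, hu, le_antisymm (fun Y hY => ?_) ((Submodule.span_singleton_le_iff_mem _ _).2 hu𝔞)⟩
  obtain ⟨y, rfl⟩ := M.exists_boostMap_eq (h.1.1 hY)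
  have h1 : ⁅boostLin n u, boostLin n y⁆ = 0 := by
    rw [← M.phi_boostMap, ← M.phi_boostMap, ← LieEquiv.map_lie, h.1.2 _ hu𝔞 _ hY]
    exact map_zero (M.φ : 𝔤₀ →ₗ[ℝ] so n)
  rw [eq_smul_of_lie_boost_eq_zero hu h1, map_smul]
  exact Submodule.smul_mem _ _ (Submodule.mem_span_singleton_self _)

theorem KAHDecomposition_iff_finrank (M : Model n G₀ 𝔤₀) (hn : 2 ≤ n) {𝔨₀ 𝔰₀ : Submodule ℝ 𝔤₀}
    (hc : IsCartanDecomposition 𝔨₀ 𝔰₀) {𝔞₁ 𝔞₂ 𝔞₃ : Submodule ℝ 𝔤₀} (h₁ : IsMaximalAbelian 𝔰₀ 𝔞₁)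
    (h₂ : IsMaximalAbelian 𝔰₀ 𝔞₂) (h₃ : IsMaximalAbelian 𝔰₀ 𝔞₃) :
    KAHDecomposition G₀ 𝔨₀ (Submodule.pi Set.univ ![𝔞₁, 𝔞₂, 𝔞₃]) ↔
      Module.finrank ℝ ↥(𝔞₁ ⊔ 𝔞₂ ⊔ 𝔞₃) = 2 := by
  obtain ⟨M', rfl, rfl⟩ := M.exists_model_of_isCartanDecomposition hn hc
  obtain ⟨v₁, hv₁, rfl⟩ := M'.exists_eq_span_of_isMaximalAbelian hn h₁
  obtain ⟨v₂, hv₂, rfl⟩ := M'.exists_eq_span_of_isMaximalAbelian hn h₂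
  obtain ⟨v₃, hv₃, rfl⟩ := M'.exists_eq_span_of_isMaximalAbelian hn h₃
  have h1 := M'.KAHDecomposition_iff hn (v := ![v₁, v₂, v₃]) (fun j => by
    fin_cases j <;> assumption)
  rw [← M'.finrank_sup] at h1
  have h2 : (fun j => Submodule.span ℝ {M'.boostMap (![v₁, v₂, v₃] j)}) =
      ![Submodule.span ℝ {M'.boostMap v₁}, Submodule.span ℝ {M'.boostMap v₂},
        Submodule.span ℝ {M'.boostMap v₃}] := by
    funext j
    fin_cases j <;> rfl
  rw [h2] at h1
  exact h1

theorem isPolarType (M : Model n G₀ 𝔤₀) (hn : 2 ≤ n) : IsPolarType G₀ 𝔤₀ := by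
  let e₀ : Fin n → ℝ := Pi.single ⟨0, by omega⟩ 1
  let e₁ : Fin n → ℝ := Pi.single ⟨1, by omega⟩ 1
  -- Any three unit directions spanning a plane would do; two of them may coincide.
  let v : Fin 3 → Fin n → ℝ := ![e₀, e₀, e₁]
  have hv : ∀ j, v j ⬝ᵥ v j = 1 := fun j => by fin_cases j <;> simp [v, e₀, e₁]
  refine ⟨_, _, (isCartanDecomposition_std hn).comap M.φ,
    Submodule.pi Set.univ fun j => Submodule.span ℝ {M.boostMap (v j)}, fun X hX j hj => ?_,
    fun X hX Y hY j => lie_eq_zero_of_mem_span (hX j (Set.mem_univ j)) (hY j (Set.mem_univ j)),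
    (M.KAHDecomposition_iff hn hv).2 ?_⟩
  · exact (Submodule.span_singleton_le_iff_mem _ _).2 (M.mem_sStd_boostMap (v j)) (hX j hj)
  · have h1 : Set.range v = Set.range ![e₀, e₁] := by
      ext x
      simp [v]
    have h2 : LinearIndependent ℝ ![e₀, e₁] := by
      rw [LinearIndependent.pair_iff]
      intro a b hab
      have ha := congrFun hab ⟨0, by omega⟩
      have hb := congrFun hab ⟨1, by omega⟩
      simp [e₀, e₁] at ha hb
      exact ⟨ha, hb⟩
    rw [h1, finrank_span_eq_card h2, Fintype.card_fin]

end Model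

end Models

/-! ### The model of `SO_e(n,1)` -/

section Lorentz

variable {n : ℕ}

theorem mem_SO_of_mem_SOe {g : GL (Fin n ⊕ Fin 1) ℝ} (hg : g ∈ SOe n) : g ∈ SO n := by
  obtain ⟨s, -, rfl⟩ := hg
  exact s.2

theorem one_le_sq_of_form {g : Matrix (Fin n ⊕ Fin 1) (Fin n ⊕ Fin 1) ℝ} (hg : gᵀ * J n * g = J n) :
    1 ≤ g (Sum.inr 0) (Sum.inr 0) ^ 2 := by
  have h1 := (form_mulVec hg (base n) (base n)).trans base_mem_hyp.1
  rw [← mulVec_base_inr g (Sum.inr 0)]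
  rw [eq_vec (g *ᵥ base n)] at h1 ⊢
  rw [form_vec] at h1
  rw [vec_inr]
  nlinarith [dotProduct_self_nonneg' fun i => (g *ᵥ base n) (Sum.inl i)]

/-- The time entry is continuous on SO(n,1) with square at least 1, so on the connected component of
1 it keeps its sign. -/
theorem inr_pos_of_mem_SOe {g : GL (Fin n ⊕ Fin 1) ℝ} (hg : g ∈ SOe n) :
    0 < g.1 (Sum.inr 0) (Sum.inr 0) := by
  obtain ⟨s, hs, rfl⟩ := hg
  let f : SO n → ℝ := fun s => s.1.1 (Sum.inr 0) (Sum.inr 0)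
  have hf : Continuous f :=
    (Units.continuous_val.comp continuous_subtype_val).matrix_elem _ _
  by_contra h
  have h1 : (0 : ℝ) ∈ Set.Icc (f s) (f 1) := ⟨not_lt.1 h, by simp [f]⟩
  obtain ⟨u, -, hu⟩ := (isPreconnected_connectedComponent (x := (1 : SO n))).intermediate_value
    hs mem_connectedComponent hf.continuousOn h1
  have h2 := one_le_sq_of_form u.2.1
  change u.1.1 (Sum.inr 0) (Sum.inr 0) = 0 at hu
  rw [hu] at h2
  norm_num at h2

/-- An isometry has determinant ±1, and exp X is the square of the isometry exp(X/2). -/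
theorem det_exp_of_mem_so {X : Matrix (Fin n ⊕ Fin 1) (Fin n ⊕ Fin 1) ℝ} (hX : X ∈ so n) :
    (NormedSpace.exp X).det = 1 := by
  have hY : (1 / 2 : ℝ) • X ∈ so n := (so n).smul_mem _ hX
  have h1 : NormedSpace.exp X =
      NormedSpace.exp ((1 / 2 : ℝ) • X) * NormedSpace.exp ((1 / 2 : ℝ) • X) := by
    rw [← Matrix.exp_add_of_commute _ _ rfl, ← add_smul]
    norm_num
  have h2 := congrArg Matrix.det (exp_transpose_mul_J hY)
  have h3 := congrArg Matrix.det (J_mul_J (n := n))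
  rw [Matrix.det_mul, Matrix.det_one] at h3
  rw [Matrix.det_mul, Matrix.det_mul, Matrix.det_transpose] at h2
  rw [h1, Matrix.det_mul]
  linear_combination (J n).det * h2 + (1 - (NormedSpace.exp ((1 / 2 : ℝ) • X)).det ^ 2) * h3

theorem continuous_exp_smul {ι 𝕜 : Type} [Fintype ι] [DecidableEq ι] [RCLike 𝕜]
    (X : Matrix ι ι 𝕜) : Continuous fun t : ℝ => NormedSpace.exp (t • X) :=
  continuous_matrix fun i j => continuous_iff_continuousAt.2 fun t =>
    (hasDerivAt_matrix.1 (hasDerivAt_exp_smul X t) i j).continuousAt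

theorem exists_mem_SOe_exp {X : Matrix (Fin n ⊕ Fin 1) (Fin n ⊕ Fin 1) ℝ} (hX : X ∈ so n) :
    ∃ g ∈ SOe n, g.1 = NormedSpace.exp X := by
  let γ : ℝ → SO n := fun t => ⟨⟨NormedSpace.exp (t • X), NormedSpace.exp (-(t • X)),
    exp_mul_exp_neg _, exp_neg_mul_exp _⟩, exp_transpose_mul_J ((so n).smul_mem t hX),
    det_exp_of_mem_so ((so n).smul_mem t hX)⟩
  have hγ : Continuous γ := by
    refine Continuous.subtype_mk (Units.continuous_iff.2 ⟨continuous_exp_smul X, ?_⟩) _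
    change Continuous fun t : ℝ => NormedSpace.exp (-(t • X))
    simp only [← smul_neg]
    exact continuous_exp_smul (-X)
  have h0 : γ 0 = 1 := by
    refine Subtype.ext (Units.ext ?_)
    change NormedSpace.exp ((0 : ℝ) • X) = 1
    rw [zero_smul, NormedSpace.exp_zero]
  refine ⟨γ 1, ⟨γ 1, ?_, rfl⟩, ?_⟩
  · change γ 1 ∈ connectedComponent (1 : SO n)
    rw [← h0]
    exact (isPreconnected_range hγ).subset_connectedComponent ⟨0, rfl⟩ ⟨1, rfl⟩
  · change NormedSpace.exp ((1 : ℝ) • X) = _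
    rw [one_smul]

/-- The defining representation of `SO_e(n,1)`. -/
def defRep (n : ℕ) : SOe n →* Matrix (Fin n ⊕ Fin 1) (Fin n ⊕ Fin 1) ℝ :=
  (Units.coeHom _).comp (SOe n).subtype

theorem defRep_form (g : SOe n) : (defRep n g)ᵀ * J n * defRep n g = J n :=
  (mem_SO_of_mem_SOe g.2).1

/-- The subgroup of `SO_e(n,1)` generated by the rotations. -/
abbrev rotations (n : ℕ) : Subgroup (SOe n) := K₀ (SOe n) (kStd n)

theorem exp_mem_map_rotations {X : so n} (hX : X ∈ kStd n) :
    NormedSpace.exp X.1 ∈ (rotations n).toSubmonoid.map (defRep n) := by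
  obtain ⟨g, hg, hgX⟩ := exists_mem_SOe_exp X.2
  exact ⟨⟨g, hg⟩, Subgroup.subset_closure ⟨X, hX, hgX⟩, hgX⟩

theorem rot_mem_kStd (a b : Fin n → ℝ) : (⟨rot a b, rot_mem_so a b⟩ : so n) ∈ kStd n := by
  rw [mem_kStd_iff_base]
  change rot a b *ᵥ vec 0 1 = 0
  rw [rot_mulVec]
  ext (i | i) <;> simp

theorem exp_rot_mem (t : ℝ) (a b : Fin n → ℝ) :
    NormedSpace.exp (t • rot a b) ∈ (rotations n).toSubmonoid.map (defRep n) :=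
  exp_mem_map_rotations (X := t • ⟨rot a b, rot_mem_so a b⟩)
    ((kStd n).smul_mem t (rot_mem_kStd a b))

theorem exists_vec_of_fix_base {g : Matrix (Fin n ⊕ Fin 1) (Fin n ⊕ Fin 1) ℝ}
    (hg : gᵀ * J n * g = J n) (hb : g *ᵥ base n = base n) (a : Fin n → ℝ) :
    ∃ b, g *ᵥ vec a 0 = vec b 0 := by
  have h1 := form_mulVec hg (vec a 0) (base n)
  rw [hb, eq_vec (g *ᵥ vec a 0), base, form_vec, form_vec] at h1
  simp only [dotProduct_zero, mul_one, zero_sub, neg_inj] at h1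
  exact ⟨_, (eq_vec _).trans (by rw [h1])⟩

/-- A rotation brings any number of leading vectors of an orthonormal frame but the last one into
standard position. -/
theorem exists_rotation_fix {N : ℕ} (g : SOe (N + 1))
    (hg : defRep (N + 1) g *ᵥ base (N + 1) = base (N + 1)) (m : ℕ) (hm : m ≤ N) :
    ∃ k ∈ rotations (N + 1), defRep (N + 1) (k * g) *ᵥ base (N + 1) = base (N + 1) ∧
      ∀ i : Fin (N + 1), i.1 < m →
        defRep (N + 1) (k * g) *ᵥ vec (Pi.single i 1) 0 = vec (Pi.single i 1) 0 := by
  induction m with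
  | zero => exact ⟨1, one_mem _, by rwa [one_mul], fun i hi => absurd hi (Nat.not_lt_zero _)⟩
  | succ m ih =>
    obtain ⟨k, hk, hb, hfix⟩ := ih (by omega)
    have hform := defRep_form (k * g)
    let f : Fin (N + 1) → ℝ := Pi.single ⟨m, by omega⟩ 1
    let f' : Fin (N + 1) → ℝ := Pi.single ⟨m + 1, by omega⟩ 1
    obtain ⟨a, ha⟩ := exists_vec_of_fix_base hform hb f
    have hff : f ⬝ᵥ f = 1 := by simp [f]
    have haa : a ⬝ᵥ a = 1 := by
      have := form_mulVec hform (vec f 0) (vec f 0)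
      rwa [ha, form_vec, form_vec, hff, mul_zero, sub_zero, sub_zero] at this
    have hai : ∀ i : Fin (N + 1), i.1 < m → a ⬝ᵥ Pi.single i 1 = 0 := fun i hi => by
      have := form_mulVec hform (vec f 0) (vec (Pi.single i 1) 0)
      rw [ha, hfix i hi, form_vec, form_vec, mul_zero, sub_zero, sub_zero] at this
      rw [this]
      simp [f, Fin.ext_iff, hi.ne']
    -- `a` is the image of the m-th basis vector `f`. The next basis vector `f'`, which exists
    -- because m < N, is there to correct a sign; the earlier basis vectors are orthogonal to `a`,
    -- `f` and `f'` and remain fixed.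
    obtain ⟨_, ⟨r, hr, rfl⟩, c, hc, h1, h2⟩ := exists_turn_nonneg (f := f) (g := f') exp_rot_mem
      hff (by simp [f']) (by simp [f, f']) a
    have hc1 : c = 1 := by
      have := form_mulVec (defRep_form r) (vec a 0) (vec a 0)
      rw [h1, form_vec, form_vec, haa, smul_dotProduct, dotProduct_smul, hff] at this
      simp only [smul_eq_mul, mul_one, mul_zero, sub_zero] at this
      nlinarith
    rw [hc1, one_smul] at h1
    refine ⟨r * k, mul_mem hr hk, ?_, fun i hi => ?_⟩
    · rw [mul_assoc, map_mul, ← Matrix.mulVec_mulVec, hb]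
      exact h2 0 1 (by simp) (by simp) (by simp)
    · rw [mul_assoc, map_mul, ← Matrix.mulVec_mulVec]
      rcases Nat.lt_succ_iff_lt_or_eq.1 hi with hi | hi
      · rw [hfix i hi]
        exact h2 _ _ (hai i hi) (by simp [f, Fin.ext_iff, hi.ne'])
          (by simp only [f', single_one_dotProduct, Pi.single_apply, Fin.ext_iff]; rw [if_neg]; omega)
      · have : i = ⟨m, by omega⟩ := Fin.ext hi
        rw [this]
        change _ *ᵥ _ *ᵥ vec f 0 = vec f 0
        rw [ha, h1]

/-- After rotations have fixed all basis vectors but the last spatial one, only the sign of that one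
is open, and determinant 1 settles it. -/
theorem mem_rotations_of_fix_base (hn : 1 ≤ n) (g : SOe n)
    (hg : defRep n g *ᵥ base n = base n) : g ∈ rotations n := by
  obtain ⟨N, rfl⟩ : ∃ N, n = N + 1 := ⟨n - 1, by omega⟩
  obtain ⟨k, hk, hb, hfix⟩ := exists_rotation_fix g hg N le_rfl
  have hform := defRep_form (k * g)
  obtain ⟨a, ha⟩ := exists_vec_of_fix_base hform hb (Pi.single (Fin.last N) 1)
  have hai : ∀ i : Fin (N + 1), i.1 < N → a i = 0 := fun i hi => by
    have := form_mulVec hform (vec (Pi.single (Fin.last N) 1) 0) (vec (Pi.single i 1) 0)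
    rw [ha, hfix i hi, form_vec, form_vec, mul_zero, sub_zero, sub_zero] at this
    simpa [Fin.ext_iff, hi.ne] using this
  set M := defRep (N + 1) (k * g) with hM
  have hdiag : M =
      Matrix.diagonal (Sum.elim (fun i => if i = Fin.last N then a i else 1) fun _ => 1) := by
    have hcol : ∀ i j, M i j = (M *ᵥ Pi.single j 1) i := by simp
    have hl : ∀ j : Fin (N + 1), (Pi.single (Sum.inl j) 1 : Fin (N + 1) ⊕ Fin 1 → ℝ) =
        vec (Pi.single j 1) 0 := fun j => by
      ext (i | i) <;> simp [Pi.single_apply]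
    have hr : (Pi.single (Sum.inr 0) 1 : Fin (N + 1) ⊕ Fin 1 → ℝ) = base (N + 1) := by
      ext (i | i)
      · simp [base]
      · simp [base, Subsingleton.elim i 0]
    ext i (j | j)
    · rw [hcol, hl]
      by_cases hj : j = Fin.last N
      · rw [hj, ha]
        rcases i with i | i
        · by_cases hi : i = Fin.last N
          · simp [hi]
          · rw [vec_inl, hai i (by have := Fin.val_ne_of_ne hi; simp at this; omega),
              Matrix.diagonal_apply_ne _ (by simpa using hi)]
        · simp
      · rw [hfix j (by have := Fin.val_ne_of_ne hj; simp at this; omega)]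
        rcases i with i | i
        · simp only [vec_inl, Matrix.diagonal_apply, Sum.inl.injEq, Sum.elim_inl, Pi.single_apply]
          split_ifs with h1 h2
          · exact absurd (h1.symm.trans h2) hj
          · rfl
          · rfl
        · simp
    · rw [hcol, Subsingleton.elim j 0, hr, hb]
      rcases i with i | i
      · simp [base]
      · simp [base, Subsingleton.elim i 0]
  have hdet : M.det = 1 := (mem_SO_of_mem_SOe (k * g).2).2
  rw [hdiag, Matrix.det_diagonal] at hdet
  have hal : a (Fin.last N) = 1 := by simpa using hdet
  have h1 : k * g = 1 := by
    refine Subtype.ext (Units.ext ?_)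
    change M = 1
    rw [hdiag, ← Matrix.diagonal_one]
    congr 1
    ext (i | i)
    · by_cases hi : i = Fin.last N
      · simp [hi, hal]
      · simp [hi]
    · rfl
  rw [← inv_eq_of_mul_eq_one_right h1]
  exact inv_mem hk

/-- `SO_e(n,1)` as the isometry group of hyperbolic space. -/
def modelSOe (hn : 1 ≤ n) : Model n (SOe n) (so n) where
  ρ := defRep n
  φ := LieEquiv.refl
  form := defRep_form
  hyp g v hv := mulVec_mem_hyp (defRep_form g) (inr_pos_of_mem_SOe g.2) hv
  exp_mem X := by
    obtain ⟨g, hg, hgX⟩ := exists_mem_SOe_exp X.2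
    exact ⟨⟨g, hg⟩, hgX⟩
  map_exp X g hg := hg
  conj g X := by
    have h1 : J n * (defRep n g)ᵀ * J n = defRep n g⁻¹ :=
      left_inv_eq_right_inv (conj_J_mul (defRep_form g))
        (by rw [← map_mul, mul_inv_cancel, map_one])
    refine ⟨⟨defRep n g * X.1 * defRep n g⁻¹, ?_⟩, rfl, rfl⟩
    rw [← h1]
    exact conj_mem_so _ X.2
  stab g hg := mem_rotations_of_fix_base hn g hg

end Lorentz

/-! ### The models of `SL(2,ℝ)` and `SL(2,ℂ)` -/

section Polarization

variable {n : ℕ} {M : Matrix (Fin n ⊕ Fin 1) (Fin n ⊕ Fin 1) ℝ}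

theorem matrix_eq_of_forall_mulVec {ι : Type} [Fintype ι] [DecidableEq ι] {A B : Matrix ι ι ℝ}
    (h : ∀ v, A *ᵥ v = B *ᵥ v) : A = B :=
  Matrix.toLin'.injective (LinearMap.ext h)

/-- Polarization: in the Hermitian model only the quadratic form, as a determinant, is directly
accessible. -/
theorem transpose_mul_J_mul_of_form (h : ∀ v, form (M *ᵥ v) (M *ᵥ v) = form v v) :
    Mᵀ * J n * M = J n := by
  refine matrix_eq_of_forall_mulVec fun v => dotProduct_eq _ _ fun u => ?_
  have h1 := h (u + v)
  simp only [Matrix.mulVec_add, form_add_left, form_add_right, h] at h1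
  rw [form_comm v u, form_comm (M *ᵥ v)] at h1
  rw [dotProduct_comm _ u, dotProduct_comm _ u, ← Matrix.mulVec_mulVec, ← Matrix.mulVec_mulVec,
    Matrix.dotProduct_mulVec, Matrix.vecMul_transpose]
  change form (M *ᵥ u) (M *ᵥ v) = form u v
  linarith

theorem mem_so_of_form (h : ∀ v, form (M *ᵥ v) v = 0) : M ∈ so n := by
  rw [mem_so]
  refine matrix_eq_of_forall_mulVec fun v => dotProduct_eq _ _ fun u => ?_
  have h1 := h (u + v)
  simp only [Matrix.mulVec_add, form_add_left, form_add_right, h] at h1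
  rw [form_comm (M *ᵥ v) u] at h1
  rw [dotProduct_comm _ u, dotProduct_comm _ u, ← Matrix.mulVec_mulVec, Matrix.neg_mulVec,
    dotProduct_neg, ← Matrix.mulVec_mulVec, Matrix.dotProduct_mulVec, Matrix.vecMul_transpose]
  change form (M *ᵥ u) v = -form u (M *ᵥ v)
  linarith

end Polarization

/-! ### Determinants and exponentials of 2 × 2 matrices -/

section TwoByTwo

variable {𝕜 : Type} [RCLike 𝕜]

theorem exp_smul_mul_of_hasDerivAt {ι : Type} [Fintype ι] [DecidableEq ι] (X : Matrix ι ι 𝕜)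
    (c : ℝ → Matrix ι ι 𝕜) (hc : ∀ t, HasDerivAt c (X * c t) t) (t : ℝ) :
    NormedSpace.exp (t • X) * c 0 = c t := by
  have key : ∀ s, HasDerivAt (fun s => NormedSpace.exp (s • -X) * c s) 0 s := fun s => by
    convert HasDerivAt.matrix_mul (hasDerivAt_exp_smul (-X) s) (hc s) using 1
    rw [← Matrix.mul_assoc, Matrix.mul_neg, Matrix.neg_mul, neg_add_cancel]
  have h : NormedSpace.exp (t • -X) * c t = NormedSpace.exp ((0 : ℝ) • -X) * c 0 := by
    ext i j
    exact is_const_of_deriv_eq_zero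
      (fun s => (hasDerivAt_matrix.1 (key s) i j).differentiableAt)
      (fun s => (hasDerivAt_matrix.1 (key s) i j).deriv) t 0
  simp only [zero_smul, NormedSpace.exp_zero, Matrix.one_mul] at h
  rw [← h, ← Matrix.mul_assoc, smul_neg, exp_mul_exp_neg, Matrix.one_mul]

/-- Liouville's formula: the logarithmic derivative of det exp(tX) is the trace of X. -/
theorem det_exp_of_trace_eq_zero {X : Matrix (Fin 2) (Fin 2) 𝕜} (hX : X.trace = 0) :
    (NormedSpace.exp X).det = 1 := by
  have key : ∀ t : ℝ, HasDerivAt (fun t : ℝ => (NormedSpace.exp (t • X)).det) 0 t := fun t => by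
    have h := hasDerivAt_matrix.1 (hasDerivAt_exp_smul' X t)
    have h1 : (fun t : ℝ => (NormedSpace.exp (t • X)).det) = fun t : ℝ =>
        NormedSpace.exp (t • X) 0 0 * NormedSpace.exp (t • X) 1 1 -
          NormedSpace.exp (t • X) 0 1 * NormedSpace.exp (t • X) 1 0 :=
      funext fun t => Matrix.det_fin_two _
    rw [h1]
    refine (((h 0 0).mul (h 1 1)).sub ((h 0 1).mul (h 1 0))).congr_deriv ?_
    rw [Matrix.trace_fin_two] at hX
    simp only [Matrix.mul_apply, Fin.sum_univ_two]
    generalize NormedSpace.exp (t • X) = M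
    linear_combination ((M 0 0 * M 1 1 - M 0 1 * M 1 0)) * hX
  have h := is_const_of_deriv_eq_zero (fun s => (key s).differentiableAt)
    (fun s => (key s).deriv) 1 0
  simpa using h

/-- The polar form of the determinant. -/
theorem trace_mul_adjugate (h k : Matrix (Fin 2) (Fin 2) 𝕜) :
    (h * k.adjugate).trace = (h + k).det - h.det - k.det := by
  simp [Matrix.trace_fin_two, Matrix.adjugate_fin_two, Matrix.det_fin_two, Matrix.mul_apply,
    Fin.sum_univ_two]
  ring

theorem mul_self_of_trace_eq_zero {B : Matrix (Fin 2) (Fin 2) 𝕜} (hB : B.trace = 0) :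
    B * B = (-B.det) • (1 : Matrix (Fin 2) (Fin 2) 𝕜) := by
  rw [Matrix.trace_fin_two] at hB
  have h1 : B 1 1 = -B 0 0 := by linear_combination hB
  ext i j
  fin_cases i <;> fin_cases j <;>
    simp [Matrix.mul_apply, Fin.sum_univ_two, Matrix.det_fin_two, h1] <;> ring

theorem exp_smul_of_mul_self_eq_neg_one {ι : Type} [Fintype ι] [DecidableEq ι] {N : Matrix ι ι 𝕜}
    (hN : N * N = -1) (t : ℝ) :
    NormedSpace.exp (t • N) = Real.cos t • (1 : Matrix ι ι 𝕜) + Real.sin t • N := by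
  have h := exp_smul_mul_of_hasDerivAt N
    (fun t => Real.cos t • (1 : Matrix ι ι 𝕜) + Real.sin t • N) (fun t => by
      rw [hasDerivAt_matrix]
      intro i j
      have h1 := ((Real.hasDerivAt_cos t).smul_const ((1 : Matrix ι ι 𝕜) i j)).add
        ((Real.hasDerivAt_sin t).smul_const (N i j))
      refine h1.congr_deriv ?_
      rw [Matrix.mul_add, Matrix.mul_smul, Matrix.mul_smul, hN, Matrix.mul_one]
      simp only [Matrix.add_apply, Matrix.smul_apply, Matrix.neg_apply]
      simp [add_comm]) t
  simpa using h

theorem trace_conj_eq_zero {ι : Type} [Fintype ι] [DecidableEq ι] {X : Matrix ι ι 𝕜}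
    (hX : X.trace = 0) {g g' : Matrix ι ι 𝕜} (h : g' * g = 1) : (g * X * g').trace = 0 := by
  rw [Matrix.trace_mul_comm, ← Matrix.mul_assoc, h, Matrix.one_mul, hX]

/-- Such a `g` is a unit quaternion: its scalar part c is real and its skew-Hermitian part squares
to -s² with c² + s² = 1. So g = cos θ + sin θ N with N² = -1, uniformly for ℝ and ℂ. -/
theorem exists_exp_of_mul_conjTranspose_eq_one {g : Matrix (Fin 2) (Fin 2) 𝕜} (hg : g.det = 1)
    (h : g * gᴴ = 1) : ∃ N : Matrix (Fin 2) (Fin 2) 𝕜, ∃ t : ℝ, N.trace = 0 ∧ Nᴴ = -N ∧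
      g = NormedSpace.exp (t • N) := by
  have hadj : gᴴ = g.adjugate :=
    left_inv_eq_right_inv (mul_eq_one_comm.1 h) (by rw [Matrix.mul_adjugate, hg, one_smul])
  have h00 : g 1 1 = star (g 0 0) := by
    have := congrFun (congrFun hadj 0) 0
    rw [Matrix.adjugate_fin_two] at this
    simpa using this.symm
  have h10 : g 1 0 = -star (g 0 1) := by
    have := congrFun (congrFun hadj 1) 0
    rw [Matrix.adjugate_fin_two] at this
    simp at this
    simp [this]
  rw [Matrix.det_fin_two, h00, h10] at hg
  set a := g 0 0 with ha
  set b := g 0 1 with hb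
  set c : ℝ := RCLike.re a
  have hac : a + star a = 2 * (c : 𝕜) := RCLike.add_conj a
  set p : 𝕜 := a - c with hp
  have hpa : a = c + p := by rw [hp]; ring
  have hpp : star p = -p := by
    have : star p = star a - c := by simp [hp]
    rw [this, hp]
    linear_combination hac
  have hp2 : p * p = -((‖p‖ ^ 2 : ℝ) : 𝕜) := by
    have := RCLike.mul_conj p
    rw [RCLike.star_def] at hpp
    rw [hpp] at this
    push_cast
    linear_combination -this
  have hb2 : b * star b = ((‖b‖ ^ 2 : ℝ) : 𝕜) := by
    push_cast
    exact RCLike.mul_conj b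
  set s : ℝ := √(‖p‖ ^ 2 + ‖b‖ ^ 2) with hs
  have hs2 : s ^ 2 = ‖p‖ ^ 2 + ‖b‖ ^ 2 := Real.sq_sqrt (by positivity)
  have hcs : c ^ 2 + s ^ 2 = 1 ^ 2 := by
    have h1 : star a = c - p := by rw [hpa]; simp [hpp]; ring
    rw [h1, hpa] at hg
    have : ((c ^ 2 + s ^ 2 : ℝ) : 𝕜) = ((1 : ℝ) : 𝕜) := by
      rw [hs2]
      push_cast
      push_cast at hp2 hb2
      linear_combination hg + hp2 - hb2
    rw [RCLike.ofReal_inj] at this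
    rw [this, one_pow]
  have hgA : g = c • (1 : Matrix (Fin 2) (Fin 2) 𝕜) + !![p, b; -star b, -p] := by
    ext i j
    fin_cases i <;> fin_cases j
    · simp [← ha, hp, RCLike.real_smul_eq_coe_mul]
    · simp [← hb]
    · simp [h10]
    · have : g 1 1 = c - p := by rw [h00, hpa]; simp [hpp]; ring
      simp [this, RCLike.real_smul_eq_coe_mul]
      ring
  obtain ⟨N, hN, htr, hskew, hAN⟩ : ∃ N : Matrix (Fin 2) (Fin 2) 𝕜, N * N = -1 ∧ N.trace = 0 ∧
      Nᴴ = -N ∧ !![p, b; -star b, -p] = s • N := by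
    -- If s = 0, then g is c times the identity and any trace zero skew-Hermitian `N` with N² = -1
    -- will do.
    by_cases hs0 : s = 0
    · have h1 : ‖p‖ = 0 := by nlinarith [sq_nonneg ‖p‖, sq_nonneg ‖b‖]
      have h2 : ‖b‖ = 0 := by nlinarith [sq_nonneg ‖p‖, sq_nonneg ‖b‖]
      rw [norm_eq_zero] at h1 h2
      refine ⟨!![0, 1; -1, 0], ?_, ?_, ?_, ?_⟩
      · ext i j; fin_cases i <;> fin_cases j <;> simp
      · simp [Matrix.trace_fin_two]
      · ext i j; fin_cases i <;> fin_cases j <;> simp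
      · rw [h1, h2, hs0]
        ext i j; fin_cases i <;> fin_cases j <;> simp
    · have hA : !![p, b; -star b, -p] * !![p, b; -star b, -p] =
          (-(s ^ 2)) • (1 : Matrix (Fin 2) (Fin 2) 𝕜) := by
        rw [RCLike.star_def] at hb2
        rw [hs2]
        ext i j
        fin_cases i <;> fin_cases j <;>
          simp [Matrix.mul_apply, Fin.sum_univ_two, RCLike.real_smul_eq_coe_mul] <;>
          push_cast at hp2 hb2 ⊢
        · linear_combination hp2 - hb2
        · ring
        · ring
        · linear_combination hp2 - hb2
      refine ⟨s⁻¹ • !![p, b; -star b, -p], ?_, ?_, ?_, ?_⟩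
      · rw [Matrix.smul_mul, Matrix.mul_smul, hA, smul_smul, smul_smul]
        have : s⁻¹ * s⁻¹ * -(s ^ 2) = -1 := by field_simp
        rw [this, neg_one_smul]
      · simp [Matrix.trace_fin_two]
      · rw [Matrix.conjTranspose_smul, ← smul_neg]
        congr 1
        ext i j; fin_cases i <;> fin_cases j <;> simp [hpp]
      · rw [smul_smul, mul_inv_cancel₀ hs0, one_smul]
  obtain ⟨θ, hc, hs'⟩ := exists_polar_of_sq zero_le_one hcs
  refine ⟨N, θ, htr, hskew, ?_⟩
  rw [exp_smul_of_mul_self_eq_neg_one hN, hgA, hAN, hc, hs', one_mul, one_mul]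

end TwoByTwo

theorem HasDerivAt.linearMap_matrix {ι 𝕜 F : Type} [Fintype ι] [DecidableEq ι] [RCLike 𝕜]
    [NormedAddCommGroup F] [NormedSpace ℝ F] (D : Matrix ι ι 𝕜 →ₗ[ℝ] F) {A : ℝ → Matrix ι ι 𝕜}
    {A' : Matrix ι ι 𝕜} {t : ℝ} (h : HasDerivAt A A' t) :
    HasDerivAt (fun s => D (A s)) (D A') t := by
  open scoped Matrix.Norms.Operator in
  let _ : NormedSpace ℝ (Matrix ι ι 𝕜) := Matrix.linftyOpNormedSpace
  let _ : FiniteDimensional ℝ (Matrix ι ι 𝕜) := Module.Finite.matrix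
  exact (LinearMap.toContinuousLinearMap D).hasFDerivAt.comp_hasDerivAt t h

/-- An identification of Minkowski space with the Hermitian `2 × 2` matrices, taking the quadratic
form to minus the determinant. -/
structure HermitianModel (n : ℕ) (𝕜 : Type) [RCLike 𝕜] where
  E : (Fin n ⊕ Fin 1 → ℝ) →ₗ[ℝ] Matrix (Fin 2) (Fin 2) 𝕜
  D : Matrix (Fin 2) (Fin 2) 𝕜 →ₗ[ℝ] (Fin n ⊕ Fin 1 → ℝ)
  herm : ∀ v, (E v)ᴴ = E v
  D_E : ∀ v, D (E v) = v
  E_D : ∀ h, hᴴ = h → E (D h) = h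
  det_E : ∀ v, (E v).det = ((-form v v : ℝ) : 𝕜)
  E_base : E (base n) = 1

/-! ### The action of SL(2) on Hermitian matrices -/

namespace HermitianModel

variable {n : ℕ} {𝕜 : Type} [RCLike 𝕜] (P : HermitianModel n 𝕜)

theorem E_injective : Function.Injective P.E := Function.LeftInverse.injective P.D_E

theorem trace_E_mul_adjugate (v w : Fin n ⊕ Fin 1 → ℝ) :
    (P.E v * (P.E w).adjugate).trace = ((-2 * form v w : ℝ) : 𝕜) := by
  rw [trace_mul_adjugate, ← map_add, P.det_E, P.det_E, P.det_E, form_add_left, form_add_right,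
    form_add_right, form_comm w v]
  push_cast
  ring

theorem trace_E (a : Fin n → ℝ) (t : ℝ) : (P.E (vec a t)).trace = ((2 * t : ℝ) : 𝕜) := by
  have := P.trace_E_mul_adjugate (vec a t) (base n)
  rw [P.E_base, Matrix.adjugate_one, Matrix.mul_one, base, form_vec] at this
  rw [this]
  simp

/-- The action of a matrix `g` on Minkowski space corresponding to `h ↦ g h gᴴ`. -/
def act (g : Matrix (Fin 2) (Fin 2) 𝕜) : Matrix (Fin n ⊕ Fin 1) (Fin n ⊕ Fin 1) ℝ :=
  LinearMap.toMatrix' (P.D ∘ₗ LinearMap.mulLeft ℝ g ∘ₗ LinearMap.mulRight ℝ gᴴ ∘ₗ P.E)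

/-- The infinitesimal action corresponding to `h ↦ X h + h Xᴴ`. -/
def lieAct (X : Matrix (Fin 2) (Fin 2) 𝕜) : Matrix (Fin n ⊕ Fin 1) (Fin n ⊕ Fin 1) ℝ :=
  LinearMap.toMatrix' (P.D ∘ₗ (LinearMap.mulLeft ℝ X + LinearMap.mulRight ℝ Xᴴ) ∘ₗ P.E)

theorem E_act (g : Matrix (Fin 2) (Fin 2) 𝕜) (v : Fin n ⊕ Fin 1 → ℝ) :
    P.E (P.act g *ᵥ v) = g * P.E v * gᴴ := by
  rw [act, LinearMap.toMatrix'_mulVec, Matrix.mul_assoc]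
  refine P.E_D _ ?_
  simp [Matrix.conjTranspose_mul, P.herm, Matrix.mul_assoc]

theorem E_lieAct (X : Matrix (Fin 2) (Fin 2) 𝕜) (v : Fin n ⊕ Fin 1 → ℝ) :
    P.E (P.lieAct X *ᵥ v) = X * P.E v + P.E v * Xᴴ := by
  rw [lieAct, LinearMap.toMatrix'_mulVec]
  refine P.E_D _ ?_
  simp [Matrix.conjTranspose_mul, P.herm, add_comm]

theorem lieAct_mulVec (X : Matrix (Fin 2) (Fin 2) 𝕜) (v : Fin n ⊕ Fin 1 → ℝ) :
    P.lieAct X *ᵥ v = P.D (X * P.E v + P.E v * Xᴴ) := by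
  rw [← P.E_lieAct, P.D_E]

theorem act_mulVec (X : Matrix (Fin 2) (Fin 2) 𝕜) (v : Fin n ⊕ Fin 1 → ℝ) :
    P.act X *ᵥ v = P.D (X * P.E v * Xᴴ) := by
  rw [← P.E_act, P.D_E]

theorem eq_of_forall_E {A B : Matrix (Fin n ⊕ Fin 1) (Fin n ⊕ Fin 1) ℝ}
    (h : ∀ v, P.E (A *ᵥ v) = P.E (B *ᵥ v)) : A = B :=
  matrix_eq_of_forall_mulVec fun v => P.E_injective (h v)

theorem act_one : P.act 1 = 1 := P.eq_of_forall_E fun v => by simp [E_act]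

theorem act_mul (g h : Matrix (Fin 2) (Fin 2) 𝕜) : P.act (g * h) = P.act g * P.act h :=
  P.eq_of_forall_E fun v => by
    simp only [E_act, ← Matrix.mulVec_mulVec, Matrix.conjTranspose_mul, Matrix.mul_assoc]

theorem act_form {g : Matrix (Fin 2) (Fin 2) 𝕜} (hg : g.det = 1) :
    (P.act g)ᵀ * J n * P.act g = J n := by
  refine transpose_mul_J_mul_of_form fun v => ?_
  have h := P.det_E (P.act g *ᵥ v)
  rw [E_act, Matrix.det_mul, Matrix.det_mul, Matrix.det_conjTranspose, hg, star_one, one_mul,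
    mul_one, P.det_E, RCLike.ofReal_inj] at h
  linarith

/-- For h = `P.E v`, the matrix X h adj(h) is det h times X, so its trace vanishes, and likewise for
the conjugate term. This trace is the polarized determinant. -/
theorem lieAct_mem_so {X : Matrix (Fin 2) (Fin 2) 𝕜} (hX : X.trace = 0) : P.lieAct X ∈ so n := by
  refine mem_so_of_form fun v => ?_
  have h := P.trace_E_mul_adjugate (P.lieAct X *ᵥ v) v
  have h1 : (X * P.E v * (P.E v).adjugate).trace = 0 := by
    rw [Matrix.mul_assoc, Matrix.mul_adjugate, Matrix.mul_smul, Matrix.mul_one, Matrix.trace_smul,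
      hX, smul_zero]
  have h2 : (P.E v * Xᴴ * (P.E v).adjugate).trace = 0 := by
    rw [Matrix.trace_mul_comm, ← Matrix.mul_assoc, Matrix.adjugate_mul, Matrix.smul_mul,
      Matrix.one_mul, Matrix.trace_smul, Matrix.trace_conjTranspose, hX, star_zero, smul_zero]
  rw [E_lieAct, Matrix.add_mul, Matrix.trace_add, h1, h2, add_zero, eq_comm,
    RCLike.ofReal_eq_zero] at h
  linarith

/-- The orbit exp(tX) h exp(tX)ᴴ satisfies the linear differential equation of the infinitesimal
action. -/
theorem exp_lieAct (X : Matrix (Fin 2) (Fin 2) 𝕜) :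
    P.act (NormedSpace.exp X) = NormedSpace.exp (P.lieAct X) := by
  refine matrix_eq_of_forall_mulVec fun v => ?_
  have h := exp_smul_mulVec_of_hasDerivAt (P.lieAct X)
    (fun t => P.act (NormedSpace.exp (t • X)) *ᵥ v) (fun t => by
      rw [lieAct_mulVec, E_act]
      have h1 : ∀ t : ℝ, P.act (NormedSpace.exp (t • X)) *ᵥ v =
          P.D (NormedSpace.exp (t • X) * P.E v * NormedSpace.exp (t • Xᴴ)) := fun t => by
        rw [act_mulVec, ← Matrix.exp_conjTranspose, Matrix.conjTranspose_smul, star_trivial]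
      simp only [h1]
      have hE : HasDerivAt (fun _ : ℝ => P.E v) 0 t :=
        hasDerivAt_matrix.2 fun i j => hasDerivAt_const t (P.E v i j)
      have h2 := HasDerivAt.matrix_mul (HasDerivAt.matrix_mul (hasDerivAt_exp_smul' X t)
        hE) (hasDerivAt_exp_smul Xᴴ t)
      refine (HasDerivAt.linearMap_matrix P.D h2).congr_deriv ?_
      rw [← Matrix.exp_conjTranspose, Matrix.conjTranspose_smul, star_trivial]
      simp only [Matrix.mul_zero, add_zero, Matrix.mul_assoc]) 1
  simp only [zero_smul, NormedSpace.exp_zero, act_one, Matrix.one_mulVec, one_smul] at h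
  exact h.symm

theorem lieAct_conj {g g' X : Matrix (Fin 2) (Fin 2) 𝕜} (h : g * g' = 1) :
    P.lieAct (g * X * g') = P.act g * P.lieAct X * P.act g' :=
  P.eq_of_forall_E fun v => by
    have h' : g'ᴴ * gᴴ = 1 := by rw [← Matrix.conjTranspose_mul, h, Matrix.conjTranspose_one]
    simp only [E_act, E_lieAct, ← Matrix.mulVec_mulVec, Matrix.conjTranspose_mul, Matrix.mul_add,
      Matrix.add_mul]
    calc _ = g * X * g' * P.E v * (g'ᴴ * gᴴ) + (g * g') * P.E v * (g'ᴴ * (Xᴴ * gᴴ)) := by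
          rw [h', h, Matrix.mul_one, Matrix.one_mul]
      _ = _ := by simp only [Matrix.mul_assoc]

/-- The infinitesimal action as a homomorphism of Lie algebras. -/
def lieHom : slReal (Fin 2) 𝕜 →ₗ⁅ℝ⁆ so n where
  toFun X := ⟨P.lieAct X.1, P.lieAct_mem_so X.2⟩
  map_add' X Y := Subtype.ext (P.eq_of_forall_E fun v => by
    change P.E (P.lieAct (X.1 + Y.1) *ᵥ v) = P.E ((P.lieAct X.1 + P.lieAct Y.1) *ᵥ v)
    rw [Matrix.add_mulVec, map_add, E_lieAct, E_lieAct, E_lieAct, Matrix.conjTranspose_add]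
    noncomm_ring)
  map_smul' c X := Subtype.ext (P.eq_of_forall_E fun v => by
    change P.E (P.lieAct (c • X.1) *ᵥ v) = P.E ((c • P.lieAct X.1) *ᵥ v)
    rw [Matrix.smul_mulVec, map_smul, E_lieAct, E_lieAct, Matrix.conjTranspose_smul, star_trivial,
      Matrix.smul_mul, Matrix.mul_smul, smul_add])
  map_lie' {X Y} := Subtype.ext (P.eq_of_forall_E fun v => by
    rw [coe_lie_so]
    change P.E (P.lieAct (X.1 * Y.1 - Y.1 * X.1) *ᵥ v) =
      P.E ((P.lieAct X.1 * P.lieAct Y.1 - P.lieAct Y.1 * P.lieAct X.1) *ᵥ v)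
    simp only [Matrix.sub_mulVec, map_sub, ← Matrix.mulVec_mulVec, E_lieAct,
      Matrix.conjTranspose_sub, Matrix.conjTranspose_mul]
    noncomm_ring)

theorem lieHom_coe (X : slReal (Fin 2) 𝕜) : (P.lieHom X).1 = P.lieAct X.1 := rfl

/-- Acting trivially on the identity makes X skew-Hermitian; acting trivially on the rest then makes
it commute with all Hermitian matrices. So it is scalar, and zero by its trace. -/
theorem lieHom_injective : Function.Injective P.lieHom := by
  refine (injective_iff_map_eq_zero P.lieHom).2 fun X hX => ?_
  have h1 : ∀ v, X.1 * P.E v + P.E v * X.1ᴴ = 0 := fun v => by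
    rw [← P.E_lieAct, ← P.lieHom_coe, hX]
    change P.E ((0 : Matrix _ _ ℝ) *ᵥ v) = 0
    rw [Matrix.zero_mulVec, map_zero]
  have h2 : X.1ᴴ = -X.1 := by
    have := h1 (base n)
    rw [P.E_base, Matrix.mul_one, Matrix.one_mul, add_comm] at this
    exact eq_neg_of_add_eq_zero_left this
  have h3 : ∀ h : Matrix (Fin 2) (Fin 2) 𝕜, hᴴ = h → X.1 * h = h * X.1 := fun h hh => by
    have := h1 (P.D h)
    rwa [P.E_D h hh, h2, Matrix.mul_neg, ← sub_eq_add_neg, sub_eq_zero] at this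
  have hd := h3 !![1, 0; 0, 0] (by ext i j; fin_cases i <;> fin_cases j <;> simp)
  have ho := h3 !![0, 1; 1, 0] (by ext i j; fin_cases i <;> fin_cases j <;> simp)
  have htr : X.1.trace = 0 := X.2
  rw [Matrix.trace_fin_two] at htr
  have h01 := congrFun (congrFun hd 0) 1
  have h10 := congrFun (congrFun hd 1) 0
  have h00 := congrFun (congrFun ho 0) 1
  simp [Matrix.mul_apply, Fin.sum_univ_two] at h01 h10 h00
  have h11 : X.1 0 0 = 0 := by
    rw [← h00, ← two_mul] at htr
    simpa using htr
  refine Subtype.ext ?_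
  ext i j
  fin_cases i <;> fin_cases j
  · exact h11
  · exact h01.symm
  · exact h10
  · exact h00.symm.trans h11

theorem E_vec (c : Fin n → ℝ) (s : ℝ) : P.E (vec c s) = P.E (vec c 0) + s • 1 := by
  rw [← P.E_base, ← map_smul, ← map_add, base, smul_vec, vec_add]
  simp

/-- The Clifford relation: a trace zero Hermitian matrix squares to minus its determinant by
Cayley–Hamilton, and polarization does the rest. -/
theorem E_mul_E_add (b c : Fin n → ℝ) :
    P.E (vec b 0) * P.E (vec c 0) + P.E (vec c 0) * P.E (vec b 0) =
      (2 * b ⬝ᵥ c) • (1 : Matrix (Fin 2) (Fin 2) 𝕜) := by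
  have h : ∀ a : Fin n → ℝ, P.E (vec a 0) * P.E (vec a 0) = (a ⬝ᵥ a) • 1 := fun a => by
    rw [mul_self_of_trace_eq_zero (by rw [P.trace_E]; simp), P.det_E, form_vec,
      RCLike.real_smul_eq_coe_smul (K := 𝕜)]
    simp
  have h1 := h (b + c)
  have h2 : vec (b + c) 0 = vec b 0 + vec c 0 := by rw [vec_add, add_zero]
  rw [h2, map_add, Matrix.add_mul, Matrix.mul_add, Matrix.mul_add, h, h, add_dotProduct,
    dotProduct_add, dotProduct_add, dotProduct_comm c b] at h1
  have h3 : (b ⬝ᵥ b + b ⬝ᵥ c + (b ⬝ᵥ c + c ⬝ᵥ c)) • (1 : Matrix (Fin 2) (Fin 2) 𝕜) =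
      (b ⬝ᵥ b) • 1 + (2 * b ⬝ᵥ c) • 1 + (c ⬝ᵥ c) • 1 := by
    rw [← add_smul, ← add_smul]; congr 1; ring
  rw [h3, add_assoc, add_assoc, add_left_cancel_iff, ← add_assoc, add_right_cancel_iff] at h1
  exact h1

theorem exists_lieHom_eq_boostLin (b : Fin n → ℝ) : ∃ X, P.lieHom X = boostLin n b := by
  -- The factor 1/2 compensates for the two-sided action of a Hermitian matrix, which doubles its
  -- effect on the identity.
  refine ⟨⟨(1 / 2 : ℝ) • P.E (vec b 0), ?_⟩, Subtype.ext (P.eq_of_forall_E fun v => ?_)⟩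
  · change ((1 / 2 : ℝ) • P.E (vec b 0)).trace = 0
    rw [Matrix.trace_smul, P.trace_E]
    simp
  · change P.E (P.lieAct ((1 / 2 : ℝ) • P.E (vec b 0)) *ᵥ v) = P.E (boost b *ᵥ v)
    rw [eq_vec v]
    generalize (fun i => v (Sum.inl i)) = c
    generalize v (Sum.inr 0) = s
    have h1 : vec (s • b) 0 = s • vec b 0 := by rw [smul_vec, mul_zero]
    rw [boost_mulVec, E_lieAct, Matrix.conjTranspose_smul, star_trivial, P.herm, P.E_vec c,
      P.E_vec (s • b), h1, map_smul, Matrix.smul_mul, Matrix.mul_smul, ← smul_add, Matrix.mul_add,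
      Matrix.add_mul, Matrix.smul_mul, Matrix.mul_smul, Matrix.mul_one, Matrix.one_mul,
      add_add_add_comm, P.E_mul_E_add, smul_add, smul_smul, ← two_smul ℝ (s • P.E (vec b 0)),
      smul_smul]
    have h2 : (1 / 2 : ℝ) * (2 * b ⬝ᵥ c) = b ⬝ᵥ c := by ring
    rw [h2]
    norm_num
    rw [add_comm]

theorem lieHom_surjective : Function.Surjective P.lieHom := by
  intro X
  obtain ⟨A, b, hA, hX⟩ := exists_blocks X
  -- Boosts generate: [boost u, boost w] has spatial block u wᵀ - w uᵀ, and summing over u = A e_j,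
  -- w = e_j gives A - Aᵀ = 2A. So a homomorphism reaching all boosts is onto.
  have key : X = boostLin n b + (1 / 2 : ℝ) • ∑ j,
      ⁅boostLin n (A *ᵥ Pi.single j 1), boostLin n (Pi.single j 1)⁆ := by
    refine Subtype.ext (matrix_eq_of_forall_mulVec fun v => ?_)
    rw [hX, add_comm]
    change _ = (boost b + (1 / 2 : ℝ) • (so n).subtype (∑ j, ⁅boostLin n (A *ᵥ Pi.single j 1),
      boostLin n (Pi.single j 1)⁆)) *ᵥ v
    rw [Matrix.add_mulVec, Matrix.add_mulVec]
    congr 1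
    rw [eq_vec v]
    generalize (fun i => v (Sum.inl i)) = c
    generalize v (Sum.inr 0) = s
    rw [map_sum, Matrix.smul_mulVec, Matrix.sum_mulVec]
    have h1 : ∀ j, (so n).subtype ⁅boostLin n (A *ᵥ Pi.single j 1), boostLin n (Pi.single j 1)⁆ *ᵥ
        vec c s = vec (c j • (A *ᵥ Pi.single j 1) - ((A *ᵥ Pi.single j 1) ⬝ᵥ c) • Pi.single j 1) 0 := by
      intro j
      change (boost _ * boost _ - boost _ * boost _) *ᵥ vec c s = _
      rw [Matrix.sub_mulVec, ← Matrix.mulVec_mulVec, ← Matrix.mulVec_mulVec, boost_mulVec,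
        boost_mulVec, boost_mulVec, boost_mulVec, sub_eq_iff_eq_add, vec_add, vec_inj]
      refine ⟨by simp, by simp [dotProduct_comm]⟩
    simp only [h1]
    ext (i | i)
    · have hA' : ∀ k, A k i = -A i k := fun k => congrFun (congrFun hA i) k
      have h2 : (fun k => A k i) ⬝ᵥ c = -∑ k, c k * A i k := by
        simp [dotProduct, hA', mul_comm]
      simp only [vec, Matrix.fromBlocks_mulVec, Sum.elim_inl, Pi.smul_apply, Finset.sum_apply,
        Pi.sub_apply, Matrix.mulVec_single_one, smul_eq_mul, Pi.single_apply, Finset.sum_sub_distrib,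
        mul_ite, mul_one, mul_zero, Finset.sum_ite_eq, Finset.mem_univ, if_true, Matrix.col_apply]
      rw [show A.col i ⬝ᵥ c = _ from h2, Sum.elim_comp_inl, Matrix.zero_mulVec, add_zero,
        sub_neg_eq_add, ← two_mul, one_div, inv_mul_cancel_left₀ two_ne_zero]
      simp only [Matrix.mulVec, dotProduct, mul_comm]
    · simp [vec, Matrix.fromBlocks_mulVec]
  choose Y hY using P.exists_lieHom_eq_boostLin
  refine ⟨Y b + (1 / 2 : ℝ) • ∑ j, ⁅Y (A *ᵥ Pi.single j 1), Y (Pi.single j 1)⁆, ?_⟩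
  rw [key, map_add, map_smul, map_sum, hY]
  simp only [LieHom.map_lie, hY]

/-- The isomorphism of the trace zero matrices with `𝔰𝔬(n,1)`. -/
def lieEquiv : slReal (Fin 2) 𝕜 ≃ₗ⁅ℝ⁆ so n :=
  LieEquiv.ofBijective P.lieHom ⟨P.lieHom_injective, P.lieHom_surjective⟩

theorem lieEquiv_coe (X : slReal (Fin 2) 𝕜) : (P.lieEquiv X).1 = P.lieAct X.1 := rfl

theorem det_of_mem_SL {g : GL (Fin 2) 𝕜} (hg : g ∈ SL (Fin 2) 𝕜) : g.1.det = 1 :=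
  congrArg Units.val hg

theorem exists_mem_SL_exp {X : Matrix (Fin 2) (Fin 2) 𝕜} (hX : X.trace = 0) :
    ∃ g ∈ SL (Fin 2) 𝕜, g.1 = NormedSpace.exp X :=
  ⟨⟨NormedSpace.exp X, NormedSpace.exp (-X), exp_mul_exp_neg X, exp_neg_mul_exp X⟩,
    Units.ext (det_exp_of_trace_eq_zero hX), rfl⟩

/-- The time entry of the action is half the trace of g gᴴ, hence nonnegative, and an isometry
cannot have time entry zero. -/
theorem act_mem_hyp {g : Matrix (Fin 2) (Fin 2) 𝕜} (hg : g.det = 1) {v : Fin n ⊕ Fin 1 → ℝ}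
    (hv : v ∈ hyp n) : P.act g *ᵥ v ∈ hyp n := by
  have hform := P.act_form hg
  refine mulVec_mem_hyp hform ?_ hv
  have h1 := one_le_sq_of_form hform
  have h2 : 0 ≤ P.act g (Sum.inr 0) (Sum.inr 0) := by
    have h3 := P.trace_E (fun i => (P.act g *ᵥ base n) (Sum.inl i))
      ((P.act g *ᵥ base n) (Sum.inr 0))
    rw [← eq_vec, E_act, P.E_base, Matrix.mul_one, mulVec_base_inr] at h3
    open scoped ComplexOrder in
    have h4 := (Matrix.posSemidef_self_mul_conjTranspose g).trace_nonneg
    rw [h3] at h4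
    have h5 := RCLike.ofReal_nonneg.1 h4
    linarith
  exact lt_of_le_of_ne h2 fun h => by rw [← h] at h1; norm_num at h1

/-- `SL(2,𝕜)` acting on hyperbolic space through Hermitian matrices. -/
def model : Model n (SL (Fin 2) 𝕜) (slReal (Fin 2) 𝕜) where
  ρ :=
    { toFun := fun g => P.act g.1.1
      map_one' := P.act_one
      map_mul' := fun g h => P.act_mul g.1.1 h.1.1 }
  φ := P.lieEquiv
  form g := P.act_form (det_of_mem_SL g.2)
  hyp g v hv := P.act_mem_hyp (det_of_mem_SL g.2) hv
  exp_mem X := by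
    obtain ⟨g, hg, hgX⟩ := exists_mem_SL_exp X.2
    exact ⟨⟨g, hg⟩, hgX⟩
  map_exp X g hg := by
    change P.act g.1.1 = _
    rw [hg, P.exp_lieAct]
    rfl
  conj g X :=
    ⟨⟨g.1.1 * X.1 * (g⁻¹ : SL (Fin 2) 𝕜).1.1, trace_conj_eq_zero X.2 g.1.inv_mul⟩, rfl,
      P.lieAct_conj g.1.mul_inv⟩
  stab g hg := by
    change P.act g.1.1 *ᵥ base n = base n at hg
    -- The base point corresponds to the identity matrix, so its stabilizer consists of unitary
    -- matrices.
    have h1 : g.1.1 * g.1.1ᴴ = 1 := by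
      have := P.E_act g.1.1 (base n)
      rwa [hg, P.E_base, Matrix.mul_one, eq_comm] at this
    obtain ⟨N, t, htr, hN, hgN⟩ :=
      exists_exp_of_mul_conjTranspose_eq_one (det_of_mem_SL g.2) h1
    refine Subgroup.subset_closure ⟨t • ⟨N, htr⟩, Submodule.smul_mem _ t ?_, hgN⟩
    change P.lieEquiv ⟨N, htr⟩ ∈ kStd n
    rw [mem_kStd_iff_base, lieEquiv_coe, lieAct_mulVec, P.E_base, hN]
    simp

end HermitianModel

/-- The real symmetric `2 × 2` matrices as Minkowski space. -/
def hermitianModelReal : HermitianModel 2 ℝ where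
  E :=
    { toFun := fun v => !![v (Sum.inr 0) + v (Sum.inl 0), v (Sum.inl 1);
        v (Sum.inl 1), v (Sum.inr 0) - v (Sum.inl 0)]
      map_add' := fun v w => by
        ext i j
        fin_cases i <;> fin_cases j <;> simp <;> ring
      map_smul' := fun c v => by
        ext i j
        fin_cases i <;> fin_cases j <;> simp <;> ring }
  D :=
    { toFun := fun h => vec ![(h 0 0 - h 1 1) / 2, h 0 1] ((h 0 0 + h 1 1) / 2)
      map_add' := fun v w => by
        rw [vec_add, vec_inj]
        refine ⟨?_, by simp; ring⟩
        ext i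
        fin_cases i
        · simp; ring
        · simp
      map_smul' := fun c v => by
        rw [RingHom.id_apply, smul_vec, vec_inj]
        refine ⟨?_, by simp; ring⟩
        ext i
        fin_cases i
        · simp; ring
        · simp }
  herm v := by
    ext i j
    fin_cases i <;> fin_cases j <;> simp
  D_E v := by
    ext (i | i)
    · fin_cases i <;> simp
    · simp [Subsingleton.elim i 0]
  E_D h hh := by
    have h1 : h 1 0 = h 0 1 := by simpa using congrFun (congrFun hh 0) 1
    ext i j
    fin_cases i <;> fin_cases j <;> simp [h1] <;> ring
  det_E v := by
    rw [eq_vec v, form_vec]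
    simp [Matrix.det_fin_two, dotProduct, Fin.sum_univ_two]
    ring
  E_base := by
    ext i j
    fin_cases i <;> fin_cases j <;> simp [base]

/-- The complex Hermitian `2 × 2` matrices as Minkowski space. -/
def hermitianModelComplex : HermitianModel 3 ℂ where
  E :=
    { toFun := fun v => !![(v (Sum.inr 0) + v (Sum.inl 0) : ℂ), ⟨v (Sum.inl 1), v (Sum.inl 2)⟩;
        ⟨v (Sum.inl 1), -v (Sum.inl 2)⟩, (v (Sum.inr 0) - v (Sum.inl 0) : ℂ)]
      map_add' := fun v w => by
        ext i j
        fin_cases i <;> fin_cases j <;> apply Complex.ext <;> simp <;> ring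
      map_smul' := fun c v => by
        ext i j
        fin_cases i <;> fin_cases j <;> apply Complex.ext <;> simp <;> ring }
  D :=
    { toFun := fun h => vec ![((h 0 0).re - (h 1 1).re) / 2, (h 0 1).re, (h 0 1).im]
        (((h 0 0).re + (h 1 1).re) / 2)
      map_add' := fun v w => by
        rw [vec_add, vec_inj]
        refine ⟨?_, by simp; ring⟩
        ext i
        fin_cases i
        · simp; ring
        · simp
        · simp
      map_smul' := fun c v => by
        rw [RingHom.id_apply, smul_vec, vec_inj]
        refine ⟨?_, by simp; ring⟩
        ext i
        fin_cases i
        · simp; ring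
        · simp
        · simp }
  herm v := by
    ext i j
    fin_cases i <;> fin_cases j <;> apply Complex.ext <;> simp
  D_E v := by
    ext (i | i)
    · fin_cases i <;> simp
    · simp [Subsingleton.elim i 0]
  E_D h hh := by
    have h00 : (h 0 0).im = 0 := by
      have := congrArg Complex.im (congrFun (congrFun hh 0) 0)
      simp at this
      linarith
    have h11 : (h 1 1).im = 0 := by
      have := congrArg Complex.im (congrFun (congrFun hh 1) 1)
      simp at this
      linarith
    have h10 : h 1 0 = star (h 0 1) := (congrFun (congrFun hh 1) 0).symm
    ext i j
    fin_cases i <;> fin_cases j <;> apply Complex.ext <;> simp [h10, h00, h11] <;> ring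
  det_E v := by
    rw [eq_vec v, form_vec]
    simp only [LinearMap.coe_mk, AddHom.coe_mk, Matrix.det_fin_two]
    apply Complex.ext
    · simp [dotProduct, Fin.sum_univ_three]
      ring
    · simp [dotProduct, Fin.sum_univ_three]
      ring
  E_base := by
    ext i j
    fin_cases i <;> fin_cases j <;> apply Complex.ext <;> simp [base]

/-! ### The listed groups and the conclusion -/

theorem exists_model {ι 𝕜 : Type} [Fintype ι] [DecidableEq ι] [RCLike 𝕜]
    {G₀ : Subgroup (GL ι 𝕜)} {𝔤₀ : LieSubalgebra ℝ (Matrix ι ι 𝕜)} (h : IsListed G₀ 𝔤₀) :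
    ∃ n, 2 ≤ n ∧ Nonempty (Model n G₀ 𝔤₀) := by
  cases h with
  | SL2R => exact ⟨2, le_rfl, ⟨hermitianModelReal.model⟩⟩
  | SL2C => exact ⟨3, by norm_num, ⟨hermitianModelComplex.model⟩⟩
  | SOe n hn => exact ⟨n, hn, ⟨modelSOe (by omega)⟩⟩

end TripleSpace

end

theorem theorem3p2 {ι 𝕜 : Type} [Fintype ι] [DecidableEq ι] [RCLike 𝕜]
    (G₀ : Subgroup (GL ι 𝕜)) (𝔤₀ : LieSubalgebra ℝ (Matrix ι ι 𝕜))
    (hG₀ : TripleSpace.IsListed G₀ 𝔤₀) :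
    (∀ 𝔨₀ 𝔰₀ : Submodule ℝ 𝔤₀, TripleSpace.IsCartanDecomposition 𝔨₀ 𝔰₀ →
      ∀ 𝔞₁ 𝔞₂ 𝔞₃ : Submodule ℝ 𝔤₀,
        TripleSpace.IsMaximalAbelian 𝔰₀ 𝔞₁ → TripleSpace.IsMaximalAbelian 𝔰₀ 𝔞₂ →
        TripleSpace.IsMaximalAbelian 𝔰₀ 𝔞₃ →
        (TripleSpace.KAHDecomposition G₀ 𝔨₀ (Submodule.pi Set.univ ![𝔞₁, 𝔞₂, 𝔞₃]) ↔
          Module.finrank ℝ ↥(𝔞₁ ⊔ 𝔞₂ ⊔ 𝔞₃) = 2)) ∧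
    TripleSpace.IsPolarType G₀ 𝔤₀ := by
  obtain ⟨n, hn, ⟨M⟩⟩ := TripleSpace.exists_model hG₀
  exact ⟨fun 𝔨₀ 𝔰₀ hc 𝔞₁ 𝔞₂ 𝔞₃ h₁ h₂ h₃ => M.KAHDecomposition_iff_finrank hn hc h₁ h₂ h₃,
    M.isPolarType hn⟩
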